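/- For $0<\beta\le 1$ let $\mathbf C_\beta$ be the complex plane with the line element $|z|^{\beta-1}|dz|$, a flat cone of total angle $2\pi\beta$. Let $0<\beta,\gamma\le 1$ and let $(z,w)$ be the coordinates on the product cone $\mathbf C_\beta\times\mathbf C_\gamma$, with metric $g=|z|^{2\beta-2}|dz|^2+|w|^{2\gamma-2}|dw|^2$, apex $0$ and dilations $D_t(z,w)=(t^{1/\beta}z,t^{1/\gamma}w)$, $t>0$. A real function $u$ on it is called harmonic if $u\in W^{1,2}_{\mathrm{loc}}$ and $\int\langle\nabla u,\nabla\varphi\rangle_g\,d\mathrm{vol}_g=0$ for all test functions $\varphi$, and homogeneous of degree $d$ if $u\circ D_t=t^d u$ for all $t>0$ (functions being identified when they agree almost everywhere). Let $\mathcal H_{\le 2}$ be the space spanned by the homogeneous harmonic functions of degree $d\in[0,2]$, regarded as a subspace of $L^2(B_R,d\mathrm{vol}_g)$ for any ball $B_R$, $R>0$, about the apex. **Proposition.** The following functions are homogeneous harmonic of degree in $[0,2]$, and $\mathcal H_{\le 2}$ is spanned by them: - the constant $1$; - the real and imaginary parts of $z$ if $\beta\ge 1/2$, and those of $z^2$ if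 $\beta=1$; - the real and imaginary parts of $w$ if $\gamma\ge 1/2$, and those of $w^2$ if $\gamma=1$; - the real and imaginary parts of $zw$ and of $z\bar w$ if $\beta=\gamma=1$; - the quadratic harmonic function $\beta^{-2}|z|^{2\beta}-\gamma^{-2}|w|^{2\gamma}$. -/

import Mathlib

open MeasureTheory

noncomputable section

namespace ConeProduct

/-- The Riemannian volume of `ℂ_β × ℂ_γ` in the coordinates `(z, w)`, where `ℂ_β` is `ℂ` with the
line element `|z|^(β-1) |dz|` (a flat cone of total angle `2πβ`): it has density
`|z|^(2β-2) |w|^(2γ-2)` with respect to Lebesgue measure. -/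
def vol (β γ : ℝ) : Measure (ℂ × ℂ) :=
  volume.withDensity fun p =>
    ENNReal.ofReal (‖p.1‖ ^ (2 * β - 2) * ‖p.2‖ ^ (2 * γ - 2))

/-- The inner product of two real covectors at the point `p`, for the metric
`|z|^(2β-2) |dz|² + |w|^(2γ-2) |dw|²`. -/
def coInner (β γ : ℝ) (p : ℂ × ℂ) (a b : ℂ × ℂ →L[ℝ] ℝ) : ℝ :=
  ‖p.1‖ ^ (2 - 2 * β) * (a (1, 0) * b (1, 0) + a (Complex.I, 0) * b (Complex.I, 0)) +
    ‖p.2‖ ^ (2 - 2 * γ) * (a (0, 1) * b (0, 1) + a (0, Complex.I) * b (0, Complex.I))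

/-- Smooth test functions with compact support. -/
def IsTest (φ : ℂ × ℂ → ℝ) : Prop :=
  ContDiff ℝ (⊤ : ℕ∞) φ ∧ HasCompactSupport φ

/-- `G` is the weak (distributional) differential of `u`. -/
def IsWeakDifferential (u : ℂ × ℂ → ℝ) (G : ℂ × ℂ → (ℂ × ℂ →L[ℝ] ℝ)) : Prop :=
  LocallyIntegrable u ∧ LocallyIntegrable G ∧
    ∀ φ : ℂ × ℂ → ℝ, IsTest φ → ∀ e : ℂ × ℂ,
      ∫ p, u p * fderiv ℝ φ p e = -∫ p, G p e * φ p

/-- `u ∈ W^{1,2}_loc(ℂ_β × ℂ_γ)` with differential `G`: both `u²` and `|du|²` are locally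
integrable for the metric and the volume of the cone. -/
def IsLocSobolev (β γ : ℝ) (u : ℂ × ℂ → ℝ) (G : ℂ × ℂ → (ℂ × ℂ →L[ℝ] ℝ)) : Prop :=
  IsWeakDifferential u G ∧
    LocallyIntegrable (fun p => u p ^ 2) (vol β γ) ∧
    LocallyIntegrable (fun p => coInner β γ p (G p) (G p)) (vol β γ)

/-- `u` is a (weakly) harmonic function on `ℂ_β × ℂ_γ`: it lies in `W^{1,2}_loc` and
`∫ ⟨du, dφ⟩ = 0` for all test functions `φ`. -/
def IsHarmonic (β γ : ℝ) (u : ℂ × ℂ → ℝ) : Prop :=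
  ∃ G : ℂ × ℂ → (ℂ × ℂ →L[ℝ] ℝ), IsLocSobolev β γ u G ∧
    ∀ φ : ℂ × ℂ → ℝ, IsTest φ →
      ∫ p, coInner β γ p (G p) (fderiv ℝ φ p) ∂(vol β γ) = 0

/-- The dilation of the cone `ℂ_β × ℂ_γ` by the factor `t > 0`. -/
def dilation (β γ t : ℝ) (p : ℂ × ℂ) : ℂ × ℂ :=
  (((t ^ (1 / β) : ℝ) : ℂ) * p.1, ((t ^ (1 / γ) : ℝ) : ℂ) * p.2)

/-- `u` is homogeneous of degree `d` on the cone (functions are taken up to null sets). -/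
def IsHomogeneous (β γ d : ℝ) (u : ℂ × ℂ → ℝ) : Prop :=
  ∀ t : ℝ, 0 < t → ∀ᵐ p : ℂ × ℂ, u (dilation β γ t p) = t ^ d * u p

/-- Homogeneous harmonic functions of some degree `d ∈ [0, 2]`. -/
def IsSubquadraticHarmonic (β γ : ℝ) (u : ℂ × ℂ → ℝ) : Prop :=
  IsHarmonic β γ u ∧ ∃ d : ℝ, 0 ≤ d ∧ d ≤ 2 ∧ IsHomogeneous β γ d u

/-- The distance to the apex; the distance from `0` to `z` in `ℂ_β` is `|z|^β / β`. -/
def rho (β γ : ℝ) (p : ℂ × ℂ) : ℝ :=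
  Real.sqrt ((‖p.1‖ ^ β / β) ^ 2 + (‖p.2‖ ^ γ / γ) ^ 2)

/-- The volume of the cone restricted to the ball of radius `R` about the apex. -/
def ballVol (β γ R : ℝ) : Measure (ℂ × ℂ) :=
  (vol β γ).restrict {p | rho β γ p < R}

/-- The subspace of `L²(B_R)` spanned by (the classes of) a set of functions on the cone. -/
def spanL2 (β γ R : ℝ) (S : Set (ℂ × ℂ → ℝ)) : Submodule ℝ (Lp ℝ 2 (ballVol β γ R)) :=
  Submodule.span ℝ {f | ∃ u ∈ S, f =ᵐ[ballVol β γ R] u}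

/-- The space `H_{≤2}`, as a subspace of `L²(B_R)`. -/
def subquadraticHarmonics (β γ R : ℝ) : Submodule ℝ (Lp ℝ 2 (ballVol β γ R)) :=
  spanL2 β γ R {u | IsSubquadraticHarmonic β γ u}

/-- The real and imaginary parts of a complex function. -/
def reIm (h : ℂ × ℂ → ℂ) : Set (ℂ × ℂ → ℝ) :=
  {fun p => (h p).re, fun p => (h p).im}

/-- The explicit list of spanning functions. -/
def explicitList (β γ : ℝ) : Set (ℂ × ℂ → ℝ) :=
  {v | v = (fun _ => 1) ∨
    (1 / 2 ≤ β ∧ v ∈ reIm fun p => p.1) ∨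
    (β = 1 ∧ v ∈ reIm fun p => p.1 ^ 2) ∨
    (1 / 2 ≤ γ ∧ v ∈ reIm fun p => p.2) ∨
    (γ = 1 ∧ v ∈ reIm fun p => p.2 ^ 2) ∨
    (β = 1 ∧ γ = 1 ∧ v ∈ reIm fun p => p.1 * p.2) ∨
    (β = 1 ∧ γ = 1 ∧ v ∈ reIm fun p => p.1 * (starRingEnd ℂ) p.2) ∨
    v = fun p => ‖p.1‖ ^ (2 * β) / β ^ 2 - ‖p.2‖ ^ (2 * γ) / γ ^ 2}

end ConeProduct

end

section

open Filter Topology Set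

namespace ConeProduct

/-! ### Weights and local integrability -/

/-! Each cone is conformal to the plane, so in the Dirichlet form the weight of a factor cancels in
the directions of that factor (`wt_mul_coInner`). In flat coordinates a harmonic u is therefore a
very weak solution of |w|^(2γ-2) Δ_z u + |z|^(2β-2) Δ_w u = 0
(`IsHarmonic.integral_mul_lap_eq_zero`). Neither regularity theory nor the spectrum of the link is
used: u is only tested against explicit functions.

Let s = |z|^(2β)/β² and t = |w|^(2γ)/γ², so that s + t is the squared distance to the apex, and put
μ = m/β, ν = n/γ. On Re(c z^m) Re(c' w^n) F(s,t) the cone Laplacian acts on F as 4(s F_ss + (1+μ)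
F_s + t F_tt + (1+ν) F_t). Such functions need not be smooth on the axes; replacing |z|² by |z|² + δ
and letting δ → 0 shows that u is orthogonal to all the resulting images
(`IsHarmonic.integral_profile_eq_zero`).

Choose F = s^k t^l X(s+t) with a cutoff X. Homogeneity of degree d turns every radial integral into
a one-dimensional integral times a moment M(k,l) = ∫ u Re(c z^m) Re(c' w^n) s^k t^l over the unit
ball (`IsHomogeneous.integral_mul_radial`). The result is a recursion: if M(k-1,l) and M(k,l-1)
vanish, or are absent, then (k + l + (μ+ν-d)/2) M(k,l) = 0 (`moment_eq_zero_of_pred`).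

For d ≤ 2 the factor vanishes in only two situations. One is k = l = 0 and μ + ν = d; then the
harmonic product itself has degree at most 2 and lies in the span of the list
(`harmProd_mem_explicitSpan`). The other is d = 2, m = n = 0, k + l = 1; there M(1,0) + M(0,1) is
controlled by M(0,0), and M(1,0) - M(0,1) is a pairing with the quadratic function. So if u is
orthogonal on the unit ball to the listed functions of its own degree, all its moments vanish
(`moment_eq_zero`).

Vanishing moments force u = 0 on the unit ball by Weierstrass and Stone-Weierstrass approximation
(`ae_eq_zero_of_moment_eq_zero`), and homogeneity spreads this to the whole cone. Applying this to u
minus its L² projection on the listed functions of degree d gives the spanning statement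
(`exists_mem_explicitSpan_ae_eq`). That the listed functions are harmonic is Green's identity,
directly for the polynomials and through the regularisation for the quadratic function. -/

/-- The density `|z|^(2α-2)` of the cone `ℂ_α`. -/
noncomputable def wt (α : ℝ) (z : ℂ) : ℝ := ‖z‖ ^ (2 * α - 2)

lemma wt_nonneg (α : ℝ) (z : ℂ) : 0 ≤ wt α z := Real.rpow_nonneg (norm_nonneg _) _

lemma wt_pos {α : ℝ} {z : ℂ} (hz : z ≠ 0) : 0 < wt α z :=
  Real.rpow_pos_of_pos (norm_pos_iff.2 hz) _

@[fun_prop]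
lemma measurable_wt (α : ℝ) : Measurable (wt α) := by unfold wt; fun_prop

lemma aestronglyMeasurable_wt_fst (α : ℝ) :
    AEStronglyMeasurable (fun p : ℂ × ℂ => wt α p.1) :=
  (by fun_prop : Measurable fun p : ℂ × ℂ => wt α p.1).aestronglyMeasurable

lemma aestronglyMeasurable_wt_snd (α : ℝ) :
    AEStronglyMeasurable (fun p : ℂ × ℂ => wt α p.2) :=
  (by fun_prop : Measurable fun p : ℂ × ℂ => wt α p.2).aestronglyMeasurable

/-- Polar coordinates in real dimension 2 contribute one extra power of the radius, so only r + 1 >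
-1 is needed at the origin. -/
lemma locallyIntegrable_norm_rpow {r : ℝ} (hr : -2 < r) :
    LocallyIntegrable (fun z : ℂ => ‖z‖ ^ r) := by
  rw [locallyIntegrable_iff]
  intro K hK
  obtain ⟨R, hR⟩ := hK.isBounded.subset_ball (0 : ℂ)
  refine IntegrableOn.mono_set ?_ hR
  have h := (integrableOn_fun_norm_addHaar (volume : Measure ℂ) (f := fun x : ℝ => x ^ r) (r := R))
  rw [h]
  rw [Complex.finrank_real_complex]
  rcases le_or_gt R 0 with hR0 | hR0
  · rw [Set.Ioo_eq_empty (by simpa using hR0)]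
    exact integrableOn_empty
  · have h2 : IntegrableOn (fun y : ℝ => y ^ (r + 1)) (Ioo 0 R) := by
      rw [← integrableOn_Ioc_iff_integrableOn_Ioo,
        ← intervalIntegrable_iff_integrableOn_Ioc_of_le hR0.le]
      exact intervalIntegral.intervalIntegrable_rpow' (by linarith)
    refine h2.congr_fun (fun y hy => ?_) measurableSet_Ioo
    simp only [Nat.add_one_sub_one, pow_one, smul_eq_mul]
    rw [Real.rpow_add hy.1, Real.rpow_one, mul_comm]

lemma locallyIntegrable_mul_prod {f g : ℂ → ℝ} (hf : LocallyIntegrable f)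
    (hg : LocallyIntegrable g) : LocallyIntegrable (fun p : ℂ × ℂ => f p.1 * g p.2) := by
  rw [locallyIntegrable_iff]
  intro K hK
  have h1 := hf.integrableOn_isCompact (hK.image continuous_fst)
  have h2 := hg.integrableOn_isCompact (hK.image continuous_snd)
  have h3 := Integrable.mul_prod h1 h2
  rw [Measure.prod_restrict] at h3
  exact IntegrableOn.mono_set h3 (fun p hp => ⟨⟨p, hp, rfl⟩, ⟨p, hp, rfl⟩⟩)

lemma locallyIntegrable_norm_rpow_mul {r r' : ℝ} (hr : -2 < r) (hr' : -2 < r') :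
    LocallyIntegrable (fun p : ℂ × ℂ => ‖p.1‖ ^ r * ‖p.2‖ ^ r') :=
  locallyIntegrable_mul_prod (locallyIntegrable_norm_rpow hr) (locallyIntegrable_norm_rpow hr')

lemma locallyIntegrable_wt_mul_wt {β γ : ℝ} (hβ : 0 < β) (hγ : 0 < γ) :
    LocallyIntegrable (fun p : ℂ × ℂ => wt β p.1 * wt γ p.2) :=
  locallyIntegrable_norm_rpow_mul (by linarith) (by linarith)

lemma ae_fst_ne_zero : ∀ᵐ p : ℂ × ℂ, p.1 ≠ 0 := by
  have h : volume ({0} : Set ℂ) = 0 := by simp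
  exact Measure.quasiMeasurePreserving_fst.ae (p := fun z : ℂ => z ≠ 0) (μb := volume)
    (by rw [ae_iff]; simp)

lemma ae_snd_ne_zero : ∀ᵐ p : ℂ × ℂ, p.2 ≠ 0 :=
  Measure.quasiMeasurePreserving_snd.ae (p := fun z : ℂ => z ≠ 0) (μb := volume)
    (by rw [ae_iff]; simp)

/-- Off the axes the two weights are positive. -/
lemma ae_ne_zero : ∀ᵐ p : ℂ × ℂ, p.1 ≠ 0 ∧ p.2 ≠ 0 := by
  filter_upwards [ae_fst_ne_zero, ae_snd_ne_zero] with p h1 h2 using ⟨h1, h2⟩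

lemma vol_eq (β γ : ℝ) :
    vol β γ = volume.withDensity fun p => ENNReal.ofReal (wt β p.1 * wt γ p.2) := rfl

lemma measurable_density (β γ : ℝ) :
    Measurable fun p : ℂ × ℂ => ENNReal.ofReal (wt β p.1 * wt γ p.2) := by fun_prop

lemma integral_vol (β γ : ℝ) (f : ℂ × ℂ → ℝ) :
    ∫ p, f p ∂(vol β γ) = ∫ p, wt β p.1 * wt γ p.2 * f p := by
  rw [vol_eq, integral_withDensity_eq_integral_toReal_smul (measurable_density β γ) (by simp)]
  simp [ENNReal.toReal_ofReal, wt_nonneg]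

lemma setIntegral_vol (β γ : ℝ) (f : ℂ × ℂ → ℝ) {s : Set (ℂ × ℂ)} (hs : MeasurableSet s) :
    ∫ p in s, f p ∂(vol β γ) = ∫ p in s, wt β p.1 * wt γ p.2 * f p := by
  rw [vol_eq, restrict_withDensity hs,
    integral_withDensity_eq_integral_toReal_smul (measurable_density β γ) (by simp)]
  simp [ENNReal.toReal_ofReal, wt_nonneg]

lemma integrable_vol_iff {β γ : ℝ} {f : ℂ × ℂ → ℝ} :
    Integrable f (vol β γ) ↔ Integrable (fun p => wt β p.1 * wt γ p.2 * f p) := by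
  rw [vol_eq, integrable_withDensity_iff_integrable_smul' (measurable_density β γ) (by simp)]
  simp [ENNReal.toReal_ofReal, wt_nonneg]

lemma integrableOn_vol_iff {β γ : ℝ} {f : ℂ × ℂ → ℝ} {s : Set (ℂ × ℂ)} (hs : MeasurableSet s) :
    IntegrableOn f s (vol β γ) ↔ IntegrableOn (fun p => wt β p.1 * wt γ p.2 * f p) s := by
  rw [IntegrableOn, vol_eq, restrict_withDensity hs,
    integrable_withDensity_iff_integrable_smul' (measurable_density β γ) (by simp)]
  simp [ENNReal.toReal_ofReal, wt_nonneg, IntegrableOn]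

lemma locallyIntegrable_vol_iff {β γ : ℝ} {f : ℂ × ℂ → ℝ} :
    LocallyIntegrable f (vol β γ) ↔
      LocallyIntegrable (fun p => wt β p.1 * wt γ p.2 * f p) := by
  rw [locallyIntegrable_iff, locallyIntegrable_iff]
  exact forall₂_congr fun K hK => integrableOn_vol_iff hK.measurableSet

lemma vol_absolutelyContinuous (β γ : ℝ) : vol β γ ≪ volume :=
  withDensity_absolutelyContinuous _ _

/-- Conformal invariance of the planar Dirichlet energy: the volume density of a factor cancels
against the inverse metric of the same factor, and only the weight of the other factor survives. -/
lemma wt_mul_coInner {β γ : ℝ} {p : ℂ × ℂ} (h1 : p.1 ≠ 0) (h2 : p.2 ≠ 0)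
    (a b : ℂ × ℂ →L[ℝ] ℝ) :
    wt β p.1 * wt γ p.2 * coInner β γ p a b =
      wt γ p.2 * (a (1, 0) * b (1, 0) + a (Complex.I, 0) * b (Complex.I, 0)) +
        wt β p.1 * (a (0, 1) * b (0, 1) + a (0, Complex.I) * b (0, Complex.I)) := by
  have e1 : wt β p.1 * ‖p.1‖ ^ (2 - 2 * β) = 1 := by
    rw [wt, ← Real.rpow_add (norm_pos_iff.2 h1)]; simp
  have e2 : wt γ p.2 * ‖p.2‖ ^ (2 - 2 * γ) = 1 := by
    rw [wt, ← Real.rpow_add (norm_pos_iff.2 h2)]; simp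
  rw [coInner]
  linear_combination (wt γ p.2 * (a (1, 0) * b (1, 0) + a (Complex.I, 0) * b (Complex.I, 0))) * e1 +
    (wt β p.1 * (a (0, 1) * b (0, 1) + a (0, Complex.I) * b (0, Complex.I))) * e2

/-- Arithmetic-geometric mean criterion for local integrability of `w * f`. -/
lemma locallyIntegrable_of_le_add {w v₁ v₂ : ℂ × ℂ → ℝ}
    (hm : AEStronglyMeasurable w) (h1 : LocallyIntegrable v₁)
    (h2 : LocallyIntegrable v₂) (h : ∀ᵐ p, |w p| ≤ v₁ p + v₂ p) : LocallyIntegrable w := by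
  refine (h1.add h2).mono hm ?_
  filter_upwards [h] with p hp
  exact hp.trans (le_abs_self _)

lemma abs_mul_le_add {w f : ℝ} (hw : 0 ≤ w) : |w * f| ≤ w + w * f ^ 2 := by
  rw [abs_mul, abs_of_nonneg hw]
  have : |f| ≤ 1 + f ^ 2 := by
    rw [abs_le]; constructor <;> nlinarith [sq_nonneg (f - 1), sq_nonneg (f + 1)]
  nlinarith

/-! ### Local integrability of the weighted function and its weighted derivatives -/

section Sobolev

variable {β γ : ℝ} {u : ℂ × ℂ → ℝ} {G : ℂ × ℂ → (ℂ × ℂ →L[ℝ] ℝ)}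

lemma IsLocSobolev.locallyIntegrable_wt_mul (hβ : 0 < β) (hγ : 0 < γ)
    (h : IsLocSobolev β γ u G) :
    LocallyIntegrable (fun p => wt β p.1 * wt γ p.2 * u p) := by
  have hu := h.1.1.aestronglyMeasurable
  refine locallyIntegrable_of_le_add (by fun_prop (disch := exact hu))
    (locallyIntegrable_wt_mul_wt hβ hγ)
    (locallyIntegrable_vol_iff.1 h.2.1) (ae_of_all _ fun p => ?_)
  exact abs_mul_le_add (mul_nonneg (wt_nonneg _ _) (wt_nonneg _ _))

/-- Arithmetic-geometric mean with reciprocal weights. It is applied with y = |z|^(2α-2) and x =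
|z|^(2-2α), the latter being locally bounded because α ≤ 1. -/
lemma abs_le_add_mul_sq {x y c : ℝ} (hx : 0 ≤ x) (h : x * y = 1) : |c| ≤ x + y * c ^ 2 := by
  have e : x + y * c ^ 2 - |c| = x * (1 - y * |c| + (y * |c|) ^ 2) := by
    rw [← sq_abs c]
    linear_combination (|c| - y * |c| ^ 2) * h
  have : 0 ≤ 1 - y * |c| + (y * |c|) ^ 2 := by nlinarith [sq_nonneg (y * |c| - 1)]
  have := mul_nonneg hx this
  linarith

/-- The L² condition controls u² only with both weights. The missing weight in z is inserted
together with its reciprocal, whose contribution |z|^(2-2β) |w|^(2γ-2) is locally integrable. -/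
lemma IsLocSobolev.locallyIntegrable_snd_wt_mul (hβ1 : β ≤ 1) (hγ : 0 < γ)
    (h : IsLocSobolev β γ u G) : LocallyIntegrable (fun p => wt γ p.2 * u p) := by
  have hu := h.1.1.aestronglyMeasurable
  refine locallyIntegrable_of_le_add ((aestronglyMeasurable_wt_snd γ).mul hu)
    (locallyIntegrable_norm_rpow_mul (r := 2 - 2 * β) (r' := 2 * γ - 2) (by linarith) (by linarith))
    (locallyIntegrable_vol_iff.1 h.2.1) ?_
  filter_upwards [ae_fst_ne_zero] with p hp
  have e1 : ‖p.1‖ ^ (2 - 2 * β) * wt β p.1 = 1 := by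
    rw [wt, ← Real.rpow_add (norm_pos_iff.2 hp)]; simp
  have hw := wt_nonneg γ p.2
  have := mul_le_mul_of_nonneg_left
    (abs_le_add_mul_sq (c := u p) (Real.rpow_nonneg (norm_nonneg p.1) _) e1) hw
  rw [abs_mul, abs_of_nonneg hw]
  exact this.trans_eq (by rw [wt]; ring)

lemma IsLocSobolev.locallyIntegrable_fst_wt_mul (hβ : 0 < β) (hγ1 : γ ≤ 1)
    (h : IsLocSobolev β γ u G) : LocallyIntegrable (fun p => wt β p.1 * u p) := by
  have hu := h.1.1.aestronglyMeasurable
  refine locallyIntegrable_of_le_add ((aestronglyMeasurable_wt_fst β).mul hu)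
    (locallyIntegrable_norm_rpow_mul (r := 2 * β - 2) (r' := 2 - 2 * γ) (by linarith) (by linarith))
    (locallyIntegrable_vol_iff.1 h.2.1) ?_
  filter_upwards [ae_snd_ne_zero] with p hp
  have e1 : ‖p.2‖ ^ (2 - 2 * γ) * wt γ p.2 = 1 := by
    rw [wt, ← Real.rpow_add (norm_pos_iff.2 hp)]; simp
  have hw := wt_nonneg β p.1
  have := mul_le_mul_of_nonneg_left
    (abs_le_add_mul_sq (c := u p) (Real.rpow_nonneg (norm_nonneg p.2) _) e1) hw
  rw [abs_mul, abs_of_nonneg hw]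
  exact this.trans_eq (by rw [wt]; ring)

/-- By `wt_mul_coInner` the energy density contains the squared z-derivatives with the weight of w
alone, which is exactly the weight wanted here. -/
lemma IsLocSobolev.locallyIntegrable_snd_wt_mul_apply (hγ : 0 < γ)
    (h : IsLocSobolev β γ u G) (e : ℂ × ℂ) (he : e = (1, 0) ∨ e = (Complex.I, 0)) :
    LocallyIntegrable (fun p => wt γ p.2 * G p e) := by
  have hG := h.1.2.1.aestronglyMeasurable
  have hGe : ∀ e, AEStronglyMeasurable (fun p => G p e) := fun e => by fun_prop
  have hGe' := hGe e
  refine locallyIntegrable_of_le_add (v₁ := fun p => wt γ p.2)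
    ((aestronglyMeasurable_wt_snd γ).mul hGe')
    ?_ (locallyIntegrable_vol_iff.1 h.2.2) ?_
  · simpa [wt] using locallyIntegrable_norm_rpow_mul (r := 0) (r' := 2 * γ - 2)
      (by norm_num) (by linarith)
  filter_upwards [ae_ne_zero] with p hp
  refine (abs_mul_le_add (wt_nonneg _ _)).trans ?_
  rw [wt_mul_coInner hp.1 hp.2]
  have hw := wt_nonneg γ p.2
  have hw' := wt_nonneg β p.1
  have : 0 ≤ wt β p.1 * (G p (0, 1) * G p (0, 1) + G p (0, Complex.I) * G p (0, Complex.I)) :=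
    mul_nonneg hw' (by nlinarith [sq_nonneg (G p (0, 1)), sq_nonneg (G p (0, Complex.I))])
  have : G p e ^ 2 ≤ G p (1, 0) * G p (1, 0) + G p (Complex.I, 0) * G p (Complex.I, 0) := by
    rcases he with rfl | rfl
    · nlinarith [sq_nonneg (G p (Complex.I, 0))]
    · nlinarith [sq_nonneg (G p (1, 0))]
  nlinarith

lemma IsLocSobolev.locallyIntegrable_fst_wt_mul_apply (hβ : 0 < β)
    (h : IsLocSobolev β γ u G) (e : ℂ × ℂ) (he : e = (0, 1) ∨ e = (0, Complex.I)) :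
    LocallyIntegrable (fun p => wt β p.1 * G p e) := by
  have hG := h.1.2.1.aestronglyMeasurable
  have hGe : ∀ e, AEStronglyMeasurable (fun p => G p e) := fun e => by fun_prop
  have hGe' := hGe e
  refine locallyIntegrable_of_le_add (v₁ := fun p => wt β p.1)
    ((aestronglyMeasurable_wt_fst β).mul hGe')
    ?_ (locallyIntegrable_vol_iff.1 h.2.2) ?_
  · simpa [wt] using locallyIntegrable_norm_rpow_mul (r := 2 * β - 2) (r' := 0)
      (by linarith) (by norm_num)
  filter_upwards [ae_ne_zero] with p hp
  refine (abs_mul_le_add (wt_nonneg _ _)).trans ?_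
  rw [wt_mul_coInner hp.1 hp.2]
  have hw := wt_nonneg β p.1
  have hw' := wt_nonneg γ p.2
  have : 0 ≤ wt γ p.2 * (G p (1, 0) * G p (1, 0) + G p (Complex.I, 0) * G p (Complex.I, 0)) :=
    mul_nonneg hw' (by nlinarith [sq_nonneg (G p (1, 0)), sq_nonneg (G p (Complex.I, 0))])
  have : G p e ^ 2 ≤ G p (0, 1) * G p (0, 1) + G p (0, Complex.I) * G p (0, Complex.I) := by
    rcases he with rfl | rfl
    · nlinarith [sq_nonneg (G p (0, Complex.I))]
    · nlinarith [sq_nonneg (G p (0, 1))]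
  nlinarith

end Sobolev

/-! ### Regularised weights and weighted integration by parts -/

/-- The smooth regularisation `(|z|² + δ)^(α-1)` of the density of the cone. -/
noncomputable def regWt (α δ : ℝ) (z : ℂ) : ℝ := (‖z‖ ^ 2 + δ) ^ (α - 1)

lemma norm_sq_rpow (z : ℂ) (x : ℝ) : (‖z‖ ^ 2) ^ x = ‖z‖ ^ (2 * x) := by
  rw [← Real.rpow_natCast, ← Real.rpow_mul (norm_nonneg _)]; norm_num

lemma wt_eq_norm_sq (α : ℝ) (z : ℂ) : wt α z = (‖z‖ ^ 2) ^ (α - 1) := by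
  rw [norm_sq_rpow, wt]; ring_nf

lemma contDiff_regWt (α : ℝ) {δ : ℝ} (hδ : 0 < δ) : ContDiff ℝ (⊤ : ℕ∞) (regWt α δ) :=
  ((contDiff_norm_sq ℝ).add contDiff_const).rpow_const_of_ne fun z => by positivity

lemma regWt_nonneg (α : ℝ) {δ : ℝ} (hδ : 0 < δ) (z : ℂ) : 0 ≤ regWt α δ z :=
  Real.rpow_nonneg (by positivity) _

/-- The exponent α - 1 is nonpositive, so adding δ to the base can only lower the value. This makes
the true weight a dominating function for every δ. -/
lemma regWt_le {α δ : ℝ} (hα : α ≤ 1) (hδ : 0 < δ) {z : ℂ} (hz : z ≠ 0) :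
    regWt α δ z ≤ wt α z := by
  have := norm_pos_iff.2 hz
  rw [wt_eq_norm_sq]
  exact Real.rpow_le_rpow_of_nonpos (by positivity) (by linarith) (by linarith)

lemma tendsto_add_rpow {x : ℝ} (hx : 0 < x) (r : ℝ) {ι : Type*} {l : Filter ι} {δ : ι → ℝ}
    (hδ : Tendsto δ l (𝓝 0)) : Tendsto (fun n => (x + δ n) ^ r) l (𝓝 (x ^ r)) := by
  have h : Tendsto (fun n => x + δ n) l (𝓝 x) := by simpa using hδ.const_add x
  exact h.rpow_const (Or.inl hx.ne')

lemma tendsto_regWt (α : ℝ) {z : ℂ} (hz : z ≠ 0) {ι : Type*} {l : Filter ι} {δ : ι → ℝ}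
    (hδ : Tendsto δ l (𝓝 0)) : Tendsto (fun n => regWt α (δ n) z) l (𝓝 (wt α z)) := by
  have := norm_pos_iff.2 hz
  rw [wt_eq_norm_sq]
  exact tendsto_add_rpow (by positivity) _ hδ

/-- The directional derivative of `φ` along `e`. -/
noncomputable def dirD {E : Type*} [NormedAddCommGroup E] [NormedSpace ℝ E] (e : E) (φ : E → ℝ) :
    E → ℝ := fun p => fderiv ℝ φ p e

lemma contDiff_dirD {E : Type*} [NormedAddCommGroup E] [NormedSpace ℝ E] {φ : E → ℝ}
    (h : ContDiff ℝ (⊤ : ℕ∞) φ) (e : E) : ContDiff ℝ (⊤ : ℕ∞) (dirD e φ) :=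
  (h.fderiv_right (m := ((⊤ : ℕ∞) : WithTop ℕ∞)) (by simp)).clm_apply contDiff_const

lemma IsTest.dirD {φ : ℂ × ℂ → ℝ} (h : IsTest φ) (e : ℂ × ℂ) : IsTest (dirD e φ) :=
  ⟨contDiff_dirD h.1 e, h.2.fderiv_apply ℝ e⟩

lemma IsTest.mul_left {φ ψ : ℂ × ℂ → ℝ} (h : IsTest φ) (hψ : ContDiff ℝ (⊤ : ℕ∞) ψ) :
    IsTest (fun p => ψ p * φ p) :=
  ⟨hψ.mul h.1, h.2.mul_left⟩

lemma IsTest.integrable_mul {f φ : ℂ × ℂ → ℝ} (h : IsTest φ) (hf : LocallyIntegrable f) :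
    Integrable (fun p => f p * φ p) :=
  hf.integrable_smul_right_of_hasCompactSupport h.1.continuous h.2

instance isAddHaarMeasure_volume_prod : (volume : Measure (ℂ × ℂ)).IsAddHaarMeasure :=
  inferInstanceAs ((volume : Measure ℂ).prod (volume : Measure ℂ)).IsAddHaarMeasure

/-! ### Weighted integration by parts -/

lemma integral_mul_dirD {U φ : ℂ × ℂ → ℝ} (hU : ContDiff ℝ (⊤ : ℕ∞) U) (h : IsTest φ)
    (e : ℂ × ℂ) : ∫ p, U p * dirD e φ p = -∫ p, dirD e U p * φ p := by
  refine integral_mul_fderiv_eq_neg_fderiv_mul_of_integrable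
    (h.integrable_mul (contDiff_dirD hU e).continuous.locallyIntegrable)
    ((h.dirD e).integrable_mul hU.continuous.locallyIntegrable)
    (h.integrable_mul hU.continuous.locallyIntegrable)
    (fun p _ => hU.differentiable (by simp) p) (fun p _ => h.1.differentiable (by simp) p)

/-- `g` is the weak derivative of `u` along `e`. -/
def HasWeakDirD (e : ℂ × ℂ) (u g : ℂ × ℂ → ℝ) : Prop :=
  ∀ φ, IsTest φ → ∫ p, u p * dirD e φ p = -∫ p, g p * φ p

/-- A singular weight times a test function is not a test function, so the weak derivative cannot be
used on it at once. Smooth weights that are constant along e may be absorbed into the test function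
without producing a derivative term; dominated convergence then reaches the singular weight. -/
lemma weighted_ibp_of_approx {e : ℂ × ℂ} {u g b : ℂ × ℂ → ℝ} {bs : ℕ → ℂ × ℂ → ℝ}
    (hw : HasWeakDirD e u g) (hbs : ∀ n, ContDiff ℝ (⊤ : ℕ∞) (bs n))
    (hbe : ∀ n p, dirD e (bs n) p = 0) (hle : ∀ n, ∀ᵐ p, |bs n p| ≤ |b p|)
    (hlim : ∀ᵐ p, Tendsto (fun n => bs n p) atTop (𝓝 (b p)))
    (hu : AEStronglyMeasurable u) (hg : AEStronglyMeasurable g)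
    (hbu : LocallyIntegrable fun p => b p * u p) (hbg : LocallyIntegrable fun p => b p * g p)
    {φ : ℂ × ℂ → ℝ} (hφ : IsTest φ) :
    ∫ p, b p * u p * dirD e φ p = -∫ p, b p * g p * φ p := by
  have key : ∀ (f ψ : ℂ × ℂ → ℝ), AEStronglyMeasurable f → IsTest ψ →
      LocallyIntegrable (fun p => b p * f p) →
      Tendsto (fun n => ∫ p, f p * (bs n p * ψ p)) atTop (𝓝 (∫ p, b p * f p * ψ p)) := by
    intro f ψ hf hψ hbf
    refine tendsto_integral_filter_of_dominated_convergence (fun p => ‖b p * f p * ψ p‖)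
      (Eventually.of_forall fun n => ?_) (Eventually.of_forall fun n => ?_)
      (hψ.integrable_mul hbf).norm ?_
    · exact hf.mul (((hbs n).continuous.mul hψ.1.continuous).aestronglyMeasurable)
    · filter_upwards [hle n] with p hp
      simp only [norm_mul, Real.norm_eq_abs]
      calc |f p| * (|bs n p| * |ψ p|) = |bs n p| * (|f p| * |ψ p|) := by ring
        _ ≤ |b p| * (|f p| * |ψ p|) := by gcongr
        _ = _ := by ring
    · filter_upwards [hlim] with p hp
      have := (hp.mul_const (ψ p)).const_mul (f p)
      convert this using 2
      ring
  refine tendsto_nhds_unique (key u (dirD e φ) hu (hφ.dirD e) hbu) ?_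
  refine ((key g φ hg hφ hbg).neg).congr fun n => ?_
  rw [← hw _ (hφ.mul_left (hbs n))]
  congr 1; ext p
  have h1 : dirD e (fun p => bs n p * φ p) p = bs n p * dirD e φ p + dirD e (bs n) p * φ p := by
    unfold dirD
    rw [fderiv_fun_mul ((hbs n).differentiable (by simp) p) (hφ.1.differentiable (by simp) p)]
    simp [mul_comm]
  rw [h1, hbe n p]; ring

lemma dirD_comp_snd {f : ℂ → ℝ} (hf : Differentiable ℝ f) (v : ℂ) (p : ℂ × ℂ) :
    dirD (v, 0) (fun p : ℂ × ℂ => f p.2) p = 0 := by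
  have : HasFDerivAt (fun p : ℂ × ℂ => f p.2)
      ((fderiv ℝ f p.2).comp (ContinuousLinearMap.snd ℝ ℂ ℂ)) p :=
    (hf p.2).hasFDerivAt.comp p hasFDerivAt_snd
  rw [dirD, this.fderiv]; simp

lemma dirD_comp_fst {f : ℂ → ℝ} (hf : Differentiable ℝ f) (v : ℂ) (p : ℂ × ℂ) :
    dirD (0, v) (fun p : ℂ × ℂ => f p.1) p = 0 := by
  have : HasFDerivAt (fun p : ℂ × ℂ => f p.1)
      ((fderiv ℝ f p.1).comp (ContinuousLinearMap.fst ℝ ℂ ℂ)) p :=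
    (hf p.1).hasFDerivAt.comp p hasFDerivAt_fst
  rw [dirD, this.fderiv]; simp

/-- The weight depends on w and the derivative is taken in z, so the weight passes through untouched
even on its singular set. -/
lemma weighted_ibp_snd {γ : ℝ} (hγ1 : γ ≤ 1) {v : ℂ} {u g : ℂ × ℂ → ℝ}
    (hw : HasWeakDirD (v, 0) u g) (hu : AEStronglyMeasurable u) (hg : AEStronglyMeasurable g)
    (hbu : LocallyIntegrable fun p => wt γ p.2 * u p)
    (hbg : LocallyIntegrable fun p => wt γ p.2 * g p) {φ : ℂ × ℂ → ℝ} (hφ : IsTest φ) :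
    ∫ p, wt γ p.2 * u p * dirD (v, 0) φ p = -∫ p, wt γ p.2 * g p * φ p := by
  have hpos : ∀ n : ℕ, (0 : ℝ) < 1 / ((n : ℝ) + 1) := fun n => Nat.one_div_pos_of_nat
  refine weighted_ibp_of_approx (bs := fun n p => regWt γ (1 / ((n : ℝ) + 1)) p.2) hw
    (fun n => (contDiff_regWt γ (hpos n)).comp contDiff_snd)
    (fun n p => dirD_comp_snd ((contDiff_regWt γ (hpos n)).differentiable (by simp)) v p)
    (fun n => ?_) ?_ hu hg hbu hbg hφ
  · filter_upwards [ae_snd_ne_zero] with p hp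
    rw [abs_of_nonneg (regWt_nonneg _ (hpos n) _), abs_of_nonneg (wt_nonneg _ _)]
    exact regWt_le hγ1 (hpos n) hp
  · filter_upwards [ae_snd_ne_zero] with p hp
    exact tendsto_regWt γ hp tendsto_one_div_add_atTop_nhds_zero_nat

lemma weighted_ibp_fst {β : ℝ} (hβ1 : β ≤ 1) {v : ℂ} {u g : ℂ × ℂ → ℝ}
    (hw : HasWeakDirD (0, v) u g) (hu : AEStronglyMeasurable u) (hg : AEStronglyMeasurable g)
    (hbu : LocallyIntegrable fun p => wt β p.1 * u p)
    (hbg : LocallyIntegrable fun p => wt β p.1 * g p) {φ : ℂ × ℂ → ℝ} (hφ : IsTest φ) :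
    ∫ p, wt β p.1 * u p * dirD (0, v) φ p = -∫ p, wt β p.1 * g p * φ p := by
  have hpos : ∀ n : ℕ, (0 : ℝ) < 1 / ((n : ℝ) + 1) := fun n => Nat.one_div_pos_of_nat
  refine weighted_ibp_of_approx (bs := fun n p => regWt β (1 / ((n : ℝ) + 1)) p.1) hw
    (fun n => (contDiff_regWt β (hpos n)).comp contDiff_fst)
    (fun n p => dirD_comp_fst ((contDiff_regWt β (hpos n)).differentiable (by simp)) v p)
    (fun n => ?_) ?_ hu hg hbu hbg hφ
  · filter_upwards [ae_fst_ne_zero] with p hp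
    rw [abs_of_nonneg (regWt_nonneg _ (hpos n) _), abs_of_nonneg (wt_nonneg _ _)]
    exact regWt_le hβ1 (hpos n) hp
  · filter_upwards [ae_fst_ne_zero] with p hp
    exact tendsto_regWt β hp tendsto_one_div_add_atTop_nhds_zero_nat

/-! ### Green identities -/

/-- The flat Laplacian in the `z`-plane. -/
noncomputable def lapFst (φ : ℂ × ℂ → ℝ) (p : ℂ × ℂ) : ℝ :=
  dirD (1, 0) (dirD (1, 0) φ) p + dirD (Complex.I, 0) (dirD (Complex.I, 0) φ) p

/-- The flat Laplacian in the `w`-plane. -/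
noncomputable def lapSnd (φ : ℂ × ℂ → ℝ) (p : ℂ × ℂ) : ℝ :=
  dirD (0, 1) (dirD (0, 1) φ) p + dirD (0, Complex.I) (dirD (0, Complex.I) φ) p

lemma locallyIntegrable_wt_fst {β : ℝ} (hβ : 0 < β) :
    LocallyIntegrable (fun p : ℂ × ℂ => wt β p.1) := by
  simpa [wt] using
    locallyIntegrable_norm_rpow_mul (r := 2 * β - 2) (r' := 0)
      (by linarith) (by norm_num)

lemma locallyIntegrable_wt_snd {γ : ℝ} (hγ : 0 < γ) :
    LocallyIntegrable (fun p : ℂ × ℂ => wt γ p.2) := by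
  simpa [wt] using
    locallyIntegrable_norm_rpow_mul (r := 0) (r' := 2 * γ - 2)
      (by norm_num) (by linarith)

lemma LocallyIntegrable.mul_continuous {f g : ℂ × ℂ → ℝ} (hf : LocallyIntegrable f)
    (hg : Continuous g) : LocallyIntegrable (fun p => f p * g p) := by
  rw [locallyIntegrable_iff] at hf ⊢
  exact fun K hK => (hf K hK).mul_continuousOn hg.continuousOn hK

lemma integral_four {f₁ f₂ f₃ f₄ : ℂ × ℂ → ℝ} (h₁ : Integrable f₁) (h₂ : Integrable f₂)
    (h₃ : Integrable f₃) (h₄ : Integrable f₄) :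
    ∫ p, (f₁ p + f₂ p + (f₃ p + f₄ p)) =
      (∫ p, f₁ p) + (∫ p, f₂ p) + ((∫ p, f₃ p) + ∫ p, f₄ p) := by
  rw [integral_add (f := fun p => f₁ p + f₂ p) (g := fun p => f₃ p + f₄ p) (h₁.add h₂) (h₃.add h₄),
    integral_add h₁ h₂, integral_add h₃ h₄]

/-- A harmonic function is a very weak solution of the flat-coordinate equation. -/
lemma IsHarmonic.integral_mul_lap_eq_zero {β γ : ℝ} (hβ : 0 < β) (hβ1 : β ≤ 1) (hγ : 0 < γ)
    (hγ1 : γ ≤ 1) {u : ℂ × ℂ → ℝ} (h : IsHarmonic β γ u) {φ : ℂ × ℂ → ℝ} (hφ : IsTest φ) :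
    ∫ p, u p * (wt γ p.2 * lapFst φ p + wt β p.1 * lapSnd φ p) = 0 := by
  obtain ⟨G, hG, hH⟩ := h
  have hu := hG.1.1.aestronglyMeasurable
  have hGm := hG.1.2.1.aestronglyMeasurable
  have hGe : ∀ e, AEStronglyMeasurable (fun p => G p e) := fun e => by fun_prop
  have hweak : ∀ e, HasWeakDirD e u (fun p => G p e) := fun e φ hφ => hG.1.2.2 φ hφ e
  have hbu := hG.locallyIntegrable_snd_wt_mul hβ1 hγ
  have hau := hG.locallyIntegrable_fst_wt_mul hβ hγ1
  have hz : ∀ v : ℂ, LocallyIntegrable (fun p => wt γ p.2 * G p (v, 0)) →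
      ∫ p, wt γ p.2 * u p * dirD (v, 0) (dirD (v, 0) φ) p =
        -∫ p, wt γ p.2 * G p (v, 0) * dirD (v, 0) φ p := fun v hv =>
    weighted_ibp_snd hγ1 (hweak _) hu (hGe _) hbu hv (hφ.dirD _)
  have hw : ∀ v : ℂ, LocallyIntegrable (fun p => wt β p.1 * G p (0, v)) →
      ∫ p, wt β p.1 * u p * dirD (0, v) (dirD (0, v) φ) p =
        -∫ p, wt β p.1 * G p (0, v) * dirD (0, v) φ p := fun v hv =>
    weighted_ibp_fst hβ1 (hweak _) hu (hGe _) hau hv (hφ.dirD _)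
  have b1 := hG.locallyIntegrable_snd_wt_mul_apply hγ (1, 0) (Or.inl rfl)
  have b2 := hG.locallyIntegrable_snd_wt_mul_apply hγ (Complex.I, 0) (Or.inr rfl)
  have b3 := hG.locallyIntegrable_fst_wt_mul_apply hβ (0, 1) (Or.inl rfl)
  have b4 := hG.locallyIntegrable_fst_wt_mul_apply hβ (0, Complex.I) (Or.inr rfl)
  have h0 := hH φ hφ
  rw [integral_vol] at h0
  have h1 : ∫ p, (wt γ p.2 * G p (1, 0) * dirD (1, 0) φ p +
      wt γ p.2 * G p (Complex.I, 0) * dirD (Complex.I, 0) φ p +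
      (wt β p.1 * G p (0, 1) * dirD (0, 1) φ p +
      wt β p.1 * G p (0, Complex.I) * dirD (0, Complex.I) φ p)) = 0 := by
    rw [← h0]
    refine integral_congr_ae ?_
    filter_upwards [ae_ne_zero] with p hp
    rw [wt_mul_coInner hp.1 hp.2]
    simp only [dirD]; ring
  rw [integral_four ((hφ.dirD _).integrable_mul b1) ((hφ.dirD _).integrable_mul b2)
    ((hφ.dirD _).integrable_mul b3) ((hφ.dirD _).integrable_mul b4)] at h1
  have h2 : ∫ p, u p * (wt γ p.2 * lapFst φ p + wt β p.1 * lapSnd φ p) =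
      ∫ p, (wt γ p.2 * u p * dirD (1, 0) (dirD (1, 0) φ) p +
        wt γ p.2 * u p * dirD (Complex.I, 0) (dirD (Complex.I, 0) φ) p +
        (wt β p.1 * u p * dirD (0, 1) (dirD (0, 1) φ) p +
        wt β p.1 * u p * dirD (0, Complex.I) (dirD (0, Complex.I) φ) p)) := by
    congr 1; ext p; simp only [lapFst, lapSnd]; ring
  rw [h2, integral_four (((hφ.dirD _).dirD _).integrable_mul hbu)
    (((hφ.dirD _).dirD _).integrable_mul hbu) (((hφ.dirD _).dirD _).integrable_mul hau)
    (((hφ.dirD _).dirD _).integrable_mul hau), hz 1 b1, hz _ b2, hw 1 b3, hw _ b4]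
  linarith

/-- Green's identity for a smooth function. -/
lemma integral_grad_mul_grad {β γ : ℝ} (hβ : 0 < β) (hβ1 : β ≤ 1) (hγ : 0 < γ)
    (hγ1 : γ ≤ 1) {U : ℂ × ℂ → ℝ} (hU : ContDiff ℝ (⊤ : ℕ∞) U) {φ : ℂ × ℂ → ℝ} (hφ : IsTest φ) :
    ∫ p, (wt γ p.2 * (dirD (1, 0) U p * dirD (1, 0) φ p +
        dirD (Complex.I, 0) U p * dirD (Complex.I, 0) φ p) +
      wt β p.1 * (dirD (0, 1) U p * dirD (0, 1) φ p +
        dirD (0, Complex.I) U p * dirD (0, Complex.I) φ p)) =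
    -∫ p, (wt γ p.2 * lapFst U p + wt β p.1 * lapSnd U p) * φ p := by
  have hbc : ∀ f : ℂ × ℂ → ℝ, Continuous f → LocallyIntegrable (fun p => wt γ p.2 * f p) :=
    fun f hf => LocallyIntegrable.mul_continuous (locallyIntegrable_wt_snd hγ) hf
  have hac : ∀ f : ℂ × ℂ → ℝ, Continuous f → LocallyIntegrable (fun p => wt β p.1 * f p) :=
    fun f hf => LocallyIntegrable.mul_continuous (locallyIntegrable_wt_fst hβ) hf
  have c1 : ∀ e, Continuous (dirD e U) := fun e => (contDiff_dirD hU e).continuous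
  have c2 : ∀ e, Continuous (dirD e (dirD e U)) :=
    fun e => (contDiff_dirD (contDiff_dirD hU e) e).continuous
  -- The first derivatives of U play the part of the weakly differentiable function, which brings
  -- the singular weights under the same integration by parts.
  have hweak : ∀ e, HasWeakDirD e (dirD e U) (dirD e (dirD e U)) := fun e φ hφ =>
    integral_mul_dirD (contDiff_dirD hU e) hφ e
  have hz : ∀ v : ℂ, ∫ p, wt γ p.2 * dirD (v, 0) U p * dirD (v, 0) φ p =
        -∫ p, wt γ p.2 * dirD (v, 0) (dirD (v, 0) U) p * φ p := fun v =>
    weighted_ibp_snd hγ1 (hweak _) (c1 _).aestronglyMeasurable (c2 _).aestronglyMeasurable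
      (hbc _ (c1 _)) (hbc _ (c2 _)) hφ
  have hw : ∀ v : ℂ, ∫ p, wt β p.1 * dirD (0, v) U p * dirD (0, v) φ p =
        -∫ p, wt β p.1 * dirD (0, v) (dirD (0, v) U) p * φ p := fun v =>
    weighted_ibp_fst hβ1 (hweak _) (c1 _).aestronglyMeasurable (c2 _).aestronglyMeasurable
      (hac _ (c1 _)) (hac _ (c2 _)) hφ
  have e1 := integral_four ((hφ.dirD (1, 0)).integrable_mul (hbc _ (c1 (1, 0))))
    ((hφ.dirD (Complex.I, 0)).integrable_mul (hbc _ (c1 (Complex.I, 0))))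
    ((hφ.dirD (0, 1)).integrable_mul (hac _ (c1 (0, 1))))
    ((hφ.dirD (0, Complex.I)).integrable_mul (hac _ (c1 (0, Complex.I))))
  have e2 := integral_four (hφ.integrable_mul (hbc _ (c2 (1, 0))))
    (hφ.integrable_mul (hbc _ (c2 (Complex.I, 0))))
    (hφ.integrable_mul (hac _ (c2 (0, 1))))
    (hφ.integrable_mul (hac _ (c2 (0, Complex.I))))
  rw [hz, hz, hw, hw] at e1
  have e3 : ∀ a b c d : ℝ, -a + -b + (-c + -d) = -(a + b + (c + d)) := by intros; ring
  rw [e3, ← e2] at e1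
  convert e1 using 2
  · ext p; ring
  · congr 1; ext p; simp only [lapFst, lapSnd]; ring

/-! ### Linear structure -/

lemma coInner_add_left (β γ : ℝ) (p : ℂ × ℂ) (a a' b : ℂ × ℂ →L[ℝ] ℝ) :
    coInner β γ p (a + a') b = coInner β γ p a b + coInner β γ p a' b := by
  simp only [coInner, add_apply]; ring

lemma coInner_smul_left (β γ : ℝ) (p : ℂ × ℂ) (c : ℝ) (a b : ℂ × ℂ →L[ℝ] ℝ) :
    coInner β γ p (c • a) b = c * coInner β γ p a b := by
  simp only [coInner, smul_apply, smul_eq_mul]; ring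

lemma coInner_self_nonneg (β γ : ℝ) (p : ℂ × ℂ) (a : ℂ × ℂ →L[ℝ] ℝ) :
    0 ≤ coInner β γ p a a := by
  have h1 := Real.rpow_nonneg (norm_nonneg p.1) (2 - 2 * β)
  have h2 := Real.rpow_nonneg (norm_nonneg p.2) (2 - 2 * γ)
  unfold coInner
  have := mul_nonneg h1 (add_nonneg
     (mul_self_nonneg (a (1, 0))) (mul_self_nonneg (a (Complex.I, 0))))
  have := mul_nonneg h2 (add_nonneg
     (mul_self_nonneg (a (0, 1))) (mul_self_nonneg (a (0, Complex.I))))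
  linarith

lemma coInner_add_self_le (β γ : ℝ) (p : ℂ × ℂ) (a b : ℂ × ℂ →L[ℝ] ℝ) :
    coInner β γ p (a + b) (a + b) ≤ 2 * coInner β γ p a a + 2 * coInner β γ p b b := by
  -- Nonnegativity of |a - b|² is the parallelogram bound for |a + b|².
  have h := coInner_self_nonneg β γ p (a + (-1 : ℝ) • b)
  simp only [coInner, smul_apply, smul_eq_mul,
    add_apply] at h ⊢
  linarith

lemma aestronglyMeasurable_coInner (β γ : ℝ) {G H : ℂ × ℂ → (ℂ × ℂ →L[ℝ] ℝ)}
    (hG : AEStronglyMeasurable G) (hH : AEStronglyMeasurable H) :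
    AEStronglyMeasurable (fun p => coInner β γ p (G p) (H p)) := by
  have hG' : ∀ e, AEStronglyMeasurable (fun p => G p e) := fun e => by fun_prop
  have hH' : ∀ e, AEStronglyMeasurable (fun p => H p e) := fun e => by fun_prop
  have m1 : AEStronglyMeasurable (fun p : ℂ × ℂ => ‖p.1‖ ^ (2 - 2 * β)) :=
    (by fun_prop : Measurable fun p : ℂ × ℂ => ‖p.1‖ ^ (2 - 2 * β)).aestronglyMeasurable
  have m2 : AEStronglyMeasurable (fun p : ℂ × ℂ => ‖p.2‖ ^ (2 - 2 * γ)) :=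
    (by fun_prop : Measurable fun p : ℂ × ℂ => ‖p.2‖ ^ (2 - 2 * γ)).aestronglyMeasurable
  unfold coInner
  exact (m1.mul (((hG' _).mul (hH' _)).add ((hG' _).mul (hH' _)))).add
    (m2.mul (((hG' _).mul (hH' _)).add ((hG' _).mul (hH' _))))

section Linear

variable {β γ : ℝ} {u v : ℂ × ℂ → ℝ} {G H : ℂ × ℂ → (ℂ × ℂ →L[ℝ] ℝ)}

lemma IsLocSobolev.integrable_coInner (hβ : 0 < β) (hγ : 0 < γ) (h : IsLocSobolev β γ u G)
    {φ : ℂ × ℂ → ℝ} (hφ : IsTest φ) :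
    Integrable (fun p => coInner β γ p (G p) (fderiv ℝ φ p)) (vol β γ) := by
  rw [integrable_vol_iff]
  have b1 := h.locallyIntegrable_snd_wt_mul_apply hγ (1, 0) (Or.inl rfl)
  have b2 := h.locallyIntegrable_snd_wt_mul_apply hγ (Complex.I, 0) (Or.inr rfl)
  have b3 := h.locallyIntegrable_fst_wt_mul_apply hβ (0, 1) (Or.inl rfl)
  have b4 := h.locallyIntegrable_fst_wt_mul_apply hβ (0, Complex.I) (Or.inr rfl)
  refine (((hφ.dirD (1, 0)).integrable_mul b1).add
    ((hφ.dirD (Complex.I, 0)).integrable_mul b2)).add (((hφ.dirD (0, 1)).integrable_mul b3).add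
    ((hφ.dirD (0, Complex.I)).integrable_mul b4)) |>.congr ?_
  filter_upwards [ae_ne_zero] with p hp
  rw [wt_mul_coInner hp.1 hp.2]
  simp only [dirD, Pi.add_apply]; ring

lemma locallyIntegrable_apply (hG : LocallyIntegrable G) (e : ℂ × ℂ) :
    LocallyIntegrable (fun p => G p e) := fun p => by
  obtain ⟨s, hs, hi⟩ := hG p
  exact ⟨s, hs, (ContinuousLinearMap.apply ℝ ℝ e).integrable_comp hi⟩

lemma locallyIntegrable_add {F : Type*} [NormedAddCommGroup F] {f g : ℂ × ℂ → F}
    (hf : LocallyIntegrable f) (hg : LocallyIntegrable g) : LocallyIntegrable (f + g) :=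
  hf.add hg

lemma IsWeakDifferential.add (h : IsWeakDifferential u G) (h' : IsWeakDifferential v H) :
    IsWeakDifferential (u + v) (G + H) := by
  refine ⟨locallyIntegrable_add h.1 h'.1, locallyIntegrable_add h.2.1 h'.2.1, fun φ hφ e => ?_⟩
  simp only [Pi.add_apply, add_apply, add_mul]
  have e1 := h.2.2 φ hφ e
  have e2 := h'.2.2 φ hφ e
  change ∫ p, u p * dirD e φ p = _ at e1
  change ∫ p, v p * dirD e φ p = _ at e2
  change ∫ p, (u p * dirD e φ p + v p * dirD e φ p) = _
  rw [integral_add ((hφ.dirD e).integrable_mul h.1) ((hφ.dirD e).integrable_mul h'.1),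
    integral_add (hφ.integrable_mul (locallyIntegrable_apply h.2.1 e))
      (hφ.integrable_mul (locallyIntegrable_apply h'.2.1 e)), e1, e2]
  ring

lemma locallyIntegrable_of_le_two_mul_add {μ : Measure (ℂ × ℂ)} {f f₁ f₂ : ℂ × ℂ → ℝ}
    (hf : AEStronglyMeasurable f μ) (h₁ : LocallyIntegrable f₁ μ) (h₂ : LocallyIntegrable f₂ μ)
    (h0 : ∀ p, 0 ≤ f p) (h : ∀ p, f p ≤ 2 * f₁ p + 2 * f₂ p) : LocallyIntegrable f μ := by
  refine ((h₁.smul (2 : ℝ)).add (h₂.smul (2 : ℝ))).mono hf (ae_of_all _ fun p => ?_)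
  rw [Real.norm_of_nonneg (h0 p)]
  exact (h p).trans (le_abs_self _)

lemma IsLocSobolev.add (h : IsLocSobolev β γ u G) (h' : IsLocSobolev β γ v H) :
    IsLocSobolev β γ (u + v) (G + H) := by
  have hu := h.1.1.aestronglyMeasurable
  have hv := h'.1.1.aestronglyMeasurable
  have hGm := h.1.2.1.aestronglyMeasurable
  have hHm := h'.1.2.1.aestronglyMeasurable
  have hac := vol_absolutelyContinuous β γ
  have m1 : AEStronglyMeasurable (fun p => (u + v) p ^ 2) (vol β γ) :=
    ((hu.add hv).mono_ac hac).pow 2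
  have m2 := (aestronglyMeasurable_coInner β γ (hGm.add hHm) (hGm.add hHm)).mono_ac hac
  refine ⟨h.1.add h'.1, locallyIntegrable_of_le_two_mul_add m1 h.2.1 h'.2.1
    (fun p => sq_nonneg _) fun p => ?_, locallyIntegrable_of_le_two_mul_add m2 h.2.2 h'.2.2
    (fun p => coInner_self_nonneg _ _ _ _) fun p => coInner_add_self_le _ _ _ _ _⟩
  simp only [Pi.add_apply]
  nlinarith [sq_nonneg (u p - v p)]

lemma IsLocSobolev.smul (c : ℝ) (h : IsLocSobolev β γ u G) :
    IsLocSobolev β γ (c • u) (c • G) := by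
  refine ⟨⟨h.1.1.smul c, h.1.2.1.smul c, fun φ hφ e => ?_⟩, ?_, ?_⟩
  · simp only [Pi.smul_apply, smul_apply, smul_eq_mul, mul_assoc]
    rw [integral_const_mul, integral_const_mul, h.1.2.2 φ hφ e]; ring
  · refine (h.2.1.smul (c ^ 2)).congr (ae_of_all _ fun p => ?_)
    simp only [Pi.smul_apply, smul_eq_mul]; ring
  · refine (h.2.2.smul (c ^ 2)).congr (ae_of_all _ fun p => ?_)
    simp only [Pi.smul_apply, smul_eq_mul, coInner, smul_apply]; ring

lemma IsHarmonic.add (hβ : 0 < β) (hγ : 0 < γ) (h : IsHarmonic β γ u) (h' : IsHarmonic β γ v) :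
    IsHarmonic β γ (u + v) := by
  obtain ⟨G, hG, hGh⟩ := h
  obtain ⟨H, hH, hHh⟩ := h'
  refine ⟨G + H, hG.add hH, fun φ hφ => ?_⟩
  simp only [Pi.add_apply, coInner_add_left]
  rw [integral_add (hG.integrable_coInner hβ hγ hφ) (hH.integrable_coInner hβ hγ hφ), hGh φ hφ,
    hHh φ hφ, add_zero]

lemma IsHarmonic.smul (c : ℝ) (h : IsHarmonic β γ u) : IsHarmonic β γ (c • u) := by
  obtain ⟨G, hG, hGh⟩ := h
  refine ⟨c • G, hG.smul c, fun φ hφ => ?_⟩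
  simp only [Pi.smul_apply, coInner_smul_left]
  rw [integral_const_mul, hGh φ hφ, mul_zero]

lemma IsHomogeneous.add {d : ℝ} (h : IsHomogeneous β γ d u) (h' : IsHomogeneous β γ d v) :
    IsHomogeneous β γ d (u + v) := fun t ht => by
  filter_upwards [h t ht, h' t ht] with p h1 h2
  simp only [Pi.add_apply, h1, h2]; ring

lemma IsHomogeneous.smul {d : ℝ} (c : ℝ) (h : IsHomogeneous β γ d u) :
    IsHomogeneous β γ d (c • u) := fun t ht => by
  filter_upwards [h t ht] with p h1
  simp only [Pi.smul_apply, smul_eq_mul, h1]; ring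

end Linear

/-! ### Planar harmonic polynomials -/

/-- The harmonic polynomial `Re (c z^m)`. -/
noncomputable def harmPoly (m : ℕ) (c : ℂ) (z : ℂ) : ℝ := (c * z ^ m).re

lemma hasFDerivAt_harmPoly (m : ℕ) (c z : ℂ) :
    HasFDerivAt (harmPoly m c)
      (Complex.reCLM.comp
        ((ContinuousLinearMap.toSpanSingleton ℂ (c * (m * z ^ (m - 1)))).restrictScalars ℝ)) z := by
  have h1 : HasDerivAt (fun z : ℂ => c * z ^ m) (c * (m * z ^ (m - 1))) z :=
    (hasDerivAt_pow m z).const_mul c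
  exact Complex.reCLM.hasFDerivAt.comp z (h1.hasFDerivAt.restrictScalars ℝ)

lemma dirD_harmPoly (m : ℕ) (c v : ℂ) :
    dirD v (harmPoly m c) = harmPoly (m - 1) (c * m * v) := by
  ext z
  rw [dirD, (hasFDerivAt_harmPoly m c z).fderiv]
  simp [harmPoly]
  ring_nf

lemma contDiff_harmPoly (m : ℕ) (c : ℂ) : ContDiff ℝ (⊤ : ℕ∞) (harmPoly m c) := by
  have : ContDiff ℝ (⊤ : ℕ∞) fun z : ℂ => c * z ^ m := by fun_prop
  exact Complex.reCLM.contDiff.comp this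

lemma harmPoly_real_mul (m : ℕ) (c z : ℂ) (r : ℝ) :
    harmPoly m c ((r : ℂ) * z) = r ^ m * harmPoly m c z := by
  rw [harmPoly, harmPoly, mul_pow, ← Complex.ofReal_pow, ← mul_assoc, mul_comm c, mul_assoc,
    Complex.re_ofReal_mul]

/-- The Laplacian in one plane. -/
noncomputable def lap (f : ℂ → ℝ) (z : ℂ) : ℝ :=
  dirD 1 (dirD 1 f) z + dirD Complex.I (dirD Complex.I f) z

/-- Euler's identity for a homogeneous polynomial of degree m. It evaluates the cross term between a
harmonic polynomial and a radial function. -/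
lemma harmPoly_euler (m : ℕ) (c z : ℂ) :
    z.re * dirD 1 (harmPoly m c) z + z.im * dirD Complex.I (harmPoly m c) z =
      m * harmPoly m c z := by
  rw [dirD_harmPoly, dirD_harmPoly]
  rcases m with _ | m
  · simp [harmPoly]
  · simp only [harmPoly, Nat.add_sub_cancel, pow_succ]
    have : z = z.re + z.im * Complex.I := (Complex.re_add_im z).symm
    rw [← Complex.re_ofReal_mul, ← Complex.re_ofReal_mul, ← Complex.add_re]
    have e : ((m + 1 : ℕ) : ℝ) * (c * (z ^ m * z)).re =
        ((((m + 1 : ℕ) : ℝ) : ℂ) * (c * (z ^ m * z))).re := by rw [Complex.re_ofReal_mul]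
    rw [e]
    congr 1
    conv_rhs => rw [this]
    push_cast
    simp only [Complex.re_add_im]
    linear_combination (c * (m + 1) * z ^ m) * (Complex.re_add_im z)

lemma lap_harmPoly (m : ℕ) (c z : ℂ) : lap (harmPoly m c) z = 0 := by
  rw [lap, dirD_harmPoly, dirD_harmPoly, dirD_harmPoly, dirD_harmPoly, harmPoly, harmPoly,
    ← Complex.add_re]
  have : c * m * 1 * ((m - 1 : ℕ) : ℂ) * 1 * z ^ (m - 1 - 1) +
      c * m * Complex.I * ((m - 1 : ℕ) : ℂ) * Complex.I * z ^ (m - 1 - 1) = 0 := by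
    linear_combination (c * m * ((m - 1 : ℕ) : ℂ) * z ^ (m - 1 - 1)) * Complex.I_mul_I
  rw [this]; rfl

/-! ### Slices -/

lemma dirD_fst_eq {Φ : ℂ × ℂ → ℝ} (h : Differentiable ℝ Φ) (v : ℂ) (p : ℂ × ℂ) :
    dirD (v, 0) Φ p = dirD v (fun z => Φ (z, p.2)) p.1 := by
  have h1 : HasFDerivAt (fun z : ℂ => ((z, p.2) : ℂ × ℂ))
      ((ContinuousLinearMap.id ℝ ℂ).prod 0) p.1 :=
    (hasFDerivAt_id p.1).prodMk (hasFDerivAt_const p.2 p.1)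
  have h2 : HasFDerivAt (fun z => Φ (z, p.2)) _ p.1 := (h p).hasFDerivAt.comp p.1 h1
  rw [dirD, dirD, h2.fderiv]; simp

lemma dirD_snd_eq {Φ : ℂ × ℂ → ℝ} (h : Differentiable ℝ Φ) (v : ℂ) (p : ℂ × ℂ) :
    dirD (0, v) Φ p = dirD v (fun w => Φ (p.1, w)) p.2 := by
  have h1 : HasFDerivAt (fun w : ℂ => ((p.1, w) : ℂ × ℂ))
      ((0 : ℂ →L[ℝ] ℂ).prod (ContinuousLinearMap.id ℝ ℂ)) p.2 :=
    (hasFDerivAt_const p.1 p.2).prodMk (hasFDerivAt_id p.2)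
  have h2 : HasFDerivAt (fun w => Φ (p.1, w)) _ p.2 := (h p).hasFDerivAt.comp p.2 h1
  rw [dirD, dirD, h2.fderiv]; simp

lemma lapFst_eq {Φ : ℂ × ℂ → ℝ} (h : ContDiff ℝ (⊤ : ℕ∞) Φ) (p : ℂ × ℂ) :
    lapFst Φ p = lap (fun z => Φ (z, p.2)) p.1 := by
  have hd := h.differentiable (by simp)
  have hd' : ∀ e, Differentiable ℝ (dirD e Φ) := fun e =>
    (contDiff_dirD h e).differentiable (by simp)
  have : ∀ v, (fun z => dirD (v, 0) Φ (z, p.2)) = dirD v (fun z => Φ (z, p.2)) :=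
    fun v => funext fun z => dirD_fst_eq hd v (z, p.2)
  rw [lapFst, lap, dirD_fst_eq (hd' _), dirD_fst_eq (hd' _), this, this]

lemma lapSnd_eq {Φ : ℂ × ℂ → ℝ} (h : ContDiff ℝ (⊤ : ℕ∞) Φ) (p : ℂ × ℂ) :
    lapSnd Φ p = lap (fun w => Φ (p.1, w)) p.2 := by
  have hd := h.differentiable (by simp)
  have hd' : ∀ e, Differentiable ℝ (dirD e Φ) := fun e =>
    (contDiff_dirD h e).differentiable (by simp)
  have : ∀ v, (fun w => dirD (0, v) Φ (p.1, w)) = dirD v (fun w => Φ (p.1, w)) :=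
    fun v => funext fun w => dirD_snd_eq hd v (p.1, w)
  rw [lapSnd, lap, dirD_snd_eq (hd' _), dirD_snd_eq (hd' _), this, this]

lemma dirD_mul_const (v : ℂ) (f : ℂ → ℝ) (c : ℝ) :
    dirD v (fun z => f z * c) = fun z => dirD v f z * c := by
  ext z
  have h : (fun z => f z * c) = c • f := by ext z; simp [mul_comm]
  rw [dirD, h, fderiv_const_smul_field]
  simp [dirD, mul_comm]

lemma lap_mul_const (f : ℂ → ℝ) (c : ℝ) (z : ℂ) : lap (fun z => f z * c) z = lap f z * c := by
  rw [lap, lap, dirD_mul_const, dirD_mul_const, dirD_mul_const, dirD_mul_const, add_mul]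

lemma lap_const_mul (f : ℂ → ℝ) (c : ℝ) (z : ℂ) : lap (fun z => c * f z) z = c * lap f z := by
  simp only [mul_comm c]; exact lap_mul_const f c z

lemma lap_add_const (f : ℂ → ℝ) (c : ℝ) (z : ℂ) : lap (fun z => f z + c) z = lap f z := by
  have : ∀ v, dirD v (fun z => f z + c) = dirD v f := fun v => by
    ext z; simp [dirD, fderiv_add_const]
  rw [lap, lap, this, this]

lemma lap_const_sub (f : ℂ → ℝ) (c : ℝ) (z : ℂ) : lap (fun z => c - f z) z = -lap f z := by
  have := lap_add_const (fun z => (-1) * f z) c z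
  rw [lap_const_mul] at this
  rw [← neg_one_mul, ← this]
  congr 1; ext z; ring

/-! ### Radial functions in one plane -/

lemma hasFDerivAt_radial {h : ℝ → ℝ} {h1 : ℝ} {z : ℂ} (hh : HasDerivAt h h1 (‖z‖ ^ 2)) :
    HasFDerivAt (fun z : ℂ => h (‖z‖ ^ 2)) (h1 • (2 • (innerSL ℝ z : ℂ →L[ℝ] ℝ))) z :=
  hh.comp_hasFDerivAt z (hasStrictFDerivAt_norm_sq z).hasFDerivAt

lemma dirD_radial {h : ℝ → ℝ} {h1 : ℝ} {z : ℂ} (hh : HasDerivAt h h1 (‖z‖ ^ 2)) (v : ℂ) :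
    dirD v (fun z : ℂ => h (‖z‖ ^ 2)) z = h1 * (2 * inner ℝ z v) := by
  rw [dirD, (hasFDerivAt_radial hh).fderiv, smul_apply, smul_apply, innerSL_apply_apply,
    smul_eq_mul,
    nsmul_eq_mul, Nat.cast_ofNat]

lemma dirD_mul {f g : ℂ → ℝ} {z : ℂ} (hf : DifferentiableAt ℝ f z) (hg : DifferentiableAt ℝ g z)
    (v : ℂ) : dirD v (fun z => f z * g z) z = f z * dirD v g z + dirD v f z * g z := by
  simp only [dirD]
  rw [fderiv_fun_mul hf hg]
  simp [mul_comm]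

lemma dirD_add {f g : ℂ → ℝ} {z : ℂ} (hf : DifferentiableAt ℝ f z) (hg : DifferentiableAt ℝ g z)
    (v : ℂ) : dirD v (fun z => f z + g z) z = dirD v f z + dirD v g z := by
  simp only [dirD]
  rw [fderiv_fun_add hf hg]; rfl

lemma dirD_inner (v z : ℂ) : dirD v (fun z : ℂ => inner ℝ z v) z = inner ℝ v v := by
  rw [dirD]
  have : HasFDerivAt (fun z : ℂ => inner ℝ z v) (innerSL ℝ v : ℂ →L[ℝ] ℝ) z := by
    have h := (innerSL ℝ v : ℂ →L[ℝ] ℝ).hasFDerivAt (x := z)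
    refine h.congr_of_eventuallyEq (Eventually.of_forall fun x => ?_)
    simp [real_inner_comm]
  rw [this.fderiv]; simp

lemma dirD_dirD_mul_radial {p : ℂ → ℝ} (hp : ContDiff ℝ (⊤ : ℕ∞) p) {h h1 h2 : ℝ → ℝ}
    (hh : ∀ x, 0 ≤ x → HasDerivAt h (h1 x) x) (hh1 : ∀ x, 0 ≤ x → HasDerivAt h1 (h2 x) x)
    (v z : ℂ) :
    dirD v (dirD v (fun z => p z * h (‖z‖ ^ 2))) z =
      dirD v (dirD v p) z * h (‖z‖ ^ 2) + 4 * dirD v p z * h1 (‖z‖ ^ 2) * inner ℝ z v +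
        p z * (4 * h2 (‖z‖ ^ 2) * inner ℝ z v ^ 2 + 2 * h1 (‖z‖ ^ 2) * inner ℝ v v) := by
  have pd : ∀ z, DifferentiableAt ℝ p z := fun z => hp.differentiable (by simp) z
  have pd' : ∀ z, DifferentiableAt ℝ (dirD v p) z := fun z =>
    (contDiff_dirD hp v).differentiable (by simp) z
  have r0 : ∀ z : ℂ, DifferentiableAt ℝ (fun z : ℂ => h (‖z‖ ^ 2)) z := fun z =>
    (hasFDerivAt_radial (hh _ (sq_nonneg _))).differentiableAt
  have r1 : ∀ z : ℂ, DifferentiableAt ℝ (fun z : ℂ => h1 (‖z‖ ^ 2)) z := fun z =>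
    (hasFDerivAt_radial (hh1 _ (sq_nonneg _))).differentiableAt
  have i1 : ∀ z : ℂ, DifferentiableAt ℝ (fun z : ℂ => inner ℝ z v) z := fun z =>
    differentiableAt_id.inner ℝ (differentiableAt_const v)
  have e1 : dirD v (fun z => p z * h (‖z‖ ^ 2)) = fun z =>
      (p z * (h1 (‖z‖ ^ 2) * (2 * inner ℝ z v))) + dirD v p z * h (‖z‖ ^ 2) := by
    ext z
    rw [dirD_mul (pd z) (r0 z), dirD_radial (hh _ (sq_nonneg _))]
  have d2 : DifferentiableAt ℝ (fun z : ℂ => h1 (‖z‖ ^ 2) * (2 * inner ℝ z v)) z :=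
    (r1 z).mul ((i1 z).const_mul 2)
  have d3 : dirD v (fun z : ℂ => 2 * inner ℝ z v) z = 2 * inner ℝ v v := by
    have := congrFun (dirD_mul_const v (fun z : ℂ => inner ℝ z v) 2) z
    simp only [mul_comm _ (2 : ℝ)] at this
    rw [this, dirD_inner]
  rw [e1, dirD_add ((pd z).fun_mul d2) ((pd' z).fun_mul (r0 z)), dirD_mul (pd z) d2,
      dirD_mul (r1 z) ((i1 z).const_mul 2), d3,
    dirD_mul (pd' z) (r0 z), dirD_radial (hh _ (sq_nonneg _)), dirD_radial (hh1 _ (sq_nonneg _))]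
  ring

/-- The Laplacian of a harmonic polynomial times a radial function. -/
lemma lap_harmPoly_mul_radial (m : ℕ) (c : ℂ) {h h1 h2 : ℝ → ℝ}
    (hh : ∀ x, 0 ≤ x → HasDerivAt h (h1 x) x) (hh1 : ∀ x, 0 ≤ x → HasDerivAt h1 (h2 x) x)
    (z : ℂ) :
    lap (fun z => harmPoly m c z * h (‖z‖ ^ 2)) z =
      harmPoly m c z * (4 * ‖z‖ ^ 2 * h2 (‖z‖ ^ 2) + 4 * (m + 1) * h1 (‖z‖ ^ 2)) := by
  have hp := contDiff_harmPoly m c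
  rw [lap, dirD_dirD_mul_radial hp hh hh1, dirD_dirD_mul_radial hp hh hh1]
  have e1 := harmPoly_euler m c z
  have e2 := lap_harmPoly m c z
  rw [lap] at e2
  have n1 : inner ℝ z (1 : ℂ) = z.re := by simp [Complex.inner]
  have n2 : inner ℝ z Complex.I = z.im := by simp [Complex.inner]
  have n3 : inner ℝ (1 : ℂ) (1 : ℂ) = (1 : ℝ) := by simp
  have n4 : inner ℝ Complex.I Complex.I = (1 : ℝ) := by simp
  have n5 : ‖z‖ ^ 2 = z.re ^ 2 + z.im ^ 2 := by rw [Complex.sq_norm, Complex.normSq_apply]; ring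
  rw [n1, n2, n3, n4]
  set N := ‖z‖ ^ 2
  -- The three corrections are harmonicity of the polynomial, Euler's identity for the cross term
  -- (giving 4m h'), and |z|² = x² + y² for the second radial derivative.
  linear_combination h N * e2 + 4 * h1 N * e1 - 4 * harmPoly m c z * h2 N * n5

/-! ### The explicit functions are harmonic -/

lemma locallyIntegrable_vol_of_continuous {β γ : ℝ} (hβ : 0 < β) (hγ : 0 < γ) {f : ℂ × ℂ → ℝ}
    (hf : Continuous f) : LocallyIntegrable f (vol β γ) :=
  locallyIntegrable_vol_iff.2
    (LocallyIntegrable.mul_continuous (locallyIntegrable_wt_mul_wt hβ hγ) hf)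

/-- Smoothness across the axes and separate harmonicity in each variable make the right-hand side of
Green's identity vanish identically, whatever the weights. -/
lemma isHarmonic_of_contDiff {β γ : ℝ} (hβ : 0 < β) (hβ1 : β ≤ 1) (hγ : 0 < γ)
    (hγ1 : γ ≤ 1) {U : ℂ × ℂ → ℝ} (hU : ContDiff ℝ (⊤ : ℕ∞) U) (hz : ∀ p, lapFst U p = 0)
    (hw : ∀ p, lapSnd U p = 0) : IsHarmonic β γ U := by
  have hc : Continuous (fderiv ℝ U) := hU.continuous_fderiv (by simp)
  have c1 : ∀ e, Continuous (dirD e U) := fun e => (contDiff_dirD hU e).continuous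
  refine ⟨fderiv ℝ U, ⟨⟨hU.continuous.locallyIntegrable, hc.locallyIntegrable, fun φ hφ e =>
    integral_mul_dirD hU hφ e⟩, locallyIntegrable_vol_of_continuous hβ hγ (hU.continuous.pow 2),
    ?_⟩, fun φ hφ => ?_⟩
  · rw [locallyIntegrable_vol_iff]
    have i1 : LocallyIntegrable (fun p => wt γ p.2 * (dirD (1, 0) U p * dirD (1, 0) U p +
        dirD (Complex.I, 0) U p * dirD (Complex.I, 0) U p)) :=
      LocallyIntegrable.mul_continuous (locallyIntegrable_wt_snd hγ)
        (((c1 _).mul (c1 _)).add ((c1 _).mul (c1 _)))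
    have i2 : LocallyIntegrable (fun p => wt β p.1 * (dirD (0, 1) U p * dirD (0, 1) U p +
        dirD (0, Complex.I) U p * dirD (0, Complex.I) U p)) :=
      LocallyIntegrable.mul_continuous (locallyIntegrable_wt_fst hβ)
        (((c1 _).mul (c1 _)).add ((c1 _).mul (c1 _)))
    refine (i1.add i2).congr ?_
    filter_upwards [ae_ne_zero] with p hp
    rw [wt_mul_coInner hp.1 hp.2]
    simp only [dirD, Pi.add_apply]
  · rw [integral_vol]
    have h := integral_grad_mul_grad hβ hβ1 hγ hγ1 hU hφ
    simp only [hz, hw, mul_zero, add_zero, zero_mul, integral_zero, neg_zero] at h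
    rw [← h]
    refine integral_congr_ae ?_
    filter_upwards [ae_ne_zero] with p hp
    rw [wt_mul_coInner hp.1 hp.2]
    simp only [dirD]

/-- The product of the harmonic polynomials `Re (c z^m)` and `Re (c' w^n)`. -/
noncomputable def harmProd (m : ℕ) (c : ℂ) (n : ℕ) (c' : ℂ) (p : ℂ × ℂ) : ℝ :=
  harmPoly m c p.1 * harmPoly n c' p.2

lemma contDiff_harmProd (m : ℕ) (c : ℂ) (n : ℕ) (c' : ℂ) :
    ContDiff ℝ (⊤ : ℕ∞) (harmProd m c n c') :=
  ((contDiff_harmPoly m c).comp contDiff_fst).mul ((contDiff_harmPoly n c').comp contDiff_snd)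

@[fun_prop]
lemma continuous_harmProd (m : ℕ) (c : ℂ) (n : ℕ) (c' : ℂ) : Continuous (harmProd m c n c') :=
  (contDiff_harmProd m c n c').continuous

section

variable {β γ : ℝ}

lemma isHarmonic_harmProd (hβ : 0 < β) (hβ1 : β ≤ 1) (hγ : 0 < γ) (hγ1 : γ ≤ 1)
    (m : ℕ) (c : ℂ) (n : ℕ) (c' : ℂ) : IsHarmonic β γ (harmProd m c n c') := by
  refine isHarmonic_of_contDiff hβ hβ1 hγ hγ1 (contDiff_harmProd m c n c') (fun p => ?_) fun p => ?_
  · rw [lapFst_eq (contDiff_harmProd m c n c')]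
    simp only [harmProd]
    rw [lap_mul_const, lap_harmPoly, zero_mul]
  · rw [lapSnd_eq (contDiff_harmProd m c n c')]
    simp only [harmProd]
    rw [lap_const_mul, lap_harmPoly, mul_zero]

lemma rpow_div_pow {t : ℝ} (ht : 0 < t) (β : ℝ) (m : ℕ) : (t ^ (1 / β)) ^ m = t ^ (m / β) := by
  rw [← Real.rpow_natCast, ← Real.rpow_mul ht.le]; congr 1; ring

lemma harmProd_dilation {t : ℝ} (ht : 0 < t) (m : ℕ) (c : ℂ) (n : ℕ) (c' : ℂ) (p : ℂ × ℂ) :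
    harmProd m c n c' (dilation β γ t p) = t ^ (m / β + n / γ) * harmProd m c n c' p := by
  simp only [harmProd, dilation, harmPoly_real_mul, rpow_div_pow ht]
  rw [Real.rpow_add ht]; ring

lemma isHomogeneous_harmProd (m : ℕ) (c : ℂ) (n : ℕ) (c' : ℂ) :
    IsHomogeneous β γ (m / β + n / γ) (harmProd m c n c') := fun _ ht =>
  ae_of_all _ fun p => harmProd_dilation ht m c n c' p

end

/-! ### Regularised squared distances -/

/-- The regularised squared distance to the apex of a cone, as a function of `|z|²`. -/
noncomputable def regSq (α δ x : ℝ) : ℝ := (x + δ) ^ α / α ^ 2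

/-- The squared distance `|z|^(2α) / α²` to the apex of the cone `ℂ_α`. -/
noncomputable def coneSq (α : ℝ) (z : ℂ) : ℝ := ‖z‖ ^ (2 * α) / α ^ 2

lemma coneSq_eq (α : ℝ) (z : ℂ) : coneSq α z = regSq α 0 (‖z‖ ^ 2) := by
  rw [coneSq, regSq, add_zero, norm_sq_rpow]

lemma hasDerivAt_regSq {α δ x : ℝ} (hα : α ≠ 0) (hx : 0 < x + δ) :
    HasDerivAt (regSq α δ) ((x + δ) ^ (α - 1) / α) x := by
  have h := (((hasDerivAt_id x).add_const δ).rpow_const (p := α) (Or.inl hx.ne')).div_const (α ^ 2)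
  refine h.congr_deriv ?_
  simp only [id_eq]
  field_simp

lemma hasDerivAt_regSq' {α δ x : ℝ} (hx : 0 < x + δ) :
    HasDerivAt (fun x => (x + δ) ^ (α - 1) / α) ((α - 1) * (x + δ) ^ (α - 2) / α) x := by
  have h := (((hasDerivAt_id x).add_const δ).rpow_const (p := α - 1) (Or.inl hx.ne')).div_const α
  refine h.congr_deriv ?_
  simp only [id_eq]
  rw [show α - 1 - 1 = α - 2 by ring]
  ring

lemma contDiff_regSq_norm {α δ : ℝ} (hδ : 0 < δ) :
    ContDiff ℝ (⊤ : ℕ∞) (fun z : ℂ => regSq α δ (‖z‖ ^ 2)) :=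
  (((contDiff_norm_sq ℝ).add contDiff_const).rpow_const_of_ne fun z => by positivity).div_const _

lemma dirD_regSq {α δ : ℝ} (hα : α ≠ 0) (hδ : 0 < δ) (v z : ℂ) :
    dirD v (fun z : ℂ => regSq α δ (‖z‖ ^ 2)) z = 2 / α * regWt α δ z * inner ℝ z v := by
  rw [dirD_radial (hasDerivAt_regSq hα (by positivity)), regWt]; ring

/-- The Laplacian of the regularised squared distance. -/
noncomputable def regLap (α δ : ℝ) (m : ℕ) (z : ℂ) : ℝ :=
  4 * ‖z‖ ^ 2 * ((α - 1) * (‖z‖ ^ 2 + δ) ^ (α - 2) / α) + 4 * (m + 1) * (regWt α δ z / α)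

lemma lap_regSq {α δ : ℝ} (hα : α ≠ 0) (hδ : 0 < δ) (z : ℂ) :
    lap (fun z : ℂ => regSq α δ (‖z‖ ^ 2)) z = regLap α δ 0 z := by
  have h := lap_harmPoly_mul_radial 0 1 (h := regSq α δ)
    (fun x hx => hasDerivAt_regSq hα (by positivity))
    (fun x hx => hasDerivAt_regSq' (α := α) (by positivity)) z
  simpa [harmPoly, regLap, regWt] using h

lemma mul_rpow_sub_two {x : ℝ} (hx : 0 < x) (α : ℝ) : x * x ^ (α - 2) = x ^ (α - 1) := by
  rw [show α - 1 = 1 + (α - 2) by ring, Real.rpow_add hx, Real.rpow_one]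

lemma mul_rpow_sub_two_le {α δ : ℝ} (hδ : 0 < δ) (z : ℂ) :
    ‖z‖ ^ 2 * (‖z‖ ^ 2 + δ) ^ (α - 2) ≤ regWt α δ z := by
  have h : 0 < ‖z‖ ^ 2 + δ := by positivity
  have e : regWt α δ z = (‖z‖ ^ 2 + δ) * (‖z‖ ^ 2 + δ) ^ (α - 2) := by
    rw [regWt, mul_rpow_sub_two h]
  rw [e]
  exact mul_le_mul_of_nonneg_right (by linarith) (Real.rpow_nonneg h.le _)

/-- The second-order part has the singular power α - 2, but it comes multiplied by |z|² ≤ |z|² + δ,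
so it is no worse than the weight. The bound is independent of δ and serves as the dominating
function. -/
lemma abs_regLap_le {α δ : ℝ} (hα : 0 < α) (hα1 : α ≤ 1) (hδ : 0 < δ) (m : ℕ) {z : ℂ}
    (hz : z ≠ 0) : |regLap α δ m z| ≤ 4 * (m + 2) / α * wt α z := by
  have h1 := mul_rpow_sub_two_le (α := α) hδ z
  have h2 := regWt_le hα1 hδ hz
  have h3 := regWt_nonneg α hδ z
  have h4 : 0 ≤ ‖z‖ ^ 2 * (‖z‖ ^ 2 + δ) ^ (α - 2) := by positivity
  have e : regLap α δ m z = 4 / α * ((m + 1) * regWt α δ z -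
      (1 - α) * (‖z‖ ^ 2 * (‖z‖ ^ 2 + δ) ^ (α - 2))) := by
    rw [regLap]; field_simp; ring
  set X := ‖z‖ ^ 2 * (‖z‖ ^ 2 + δ) ^ (α - 2)
  set Y := regWt α δ z
  rw [e, abs_mul, abs_of_pos (by positivity : 0 < 4 / α)]
  have : |(m + 1) * Y - (1 - α) * X| ≤ (m + 2) * wt α z := by
    have hm : (0 : ℝ) ≤ m := m.cast_nonneg
    have k1 : (m + 1) * Y ≤ (m + 1) * wt α z := by gcongr
    have k2 : 0 ≤ (m + 1) * Y := by positivity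
    have k3 : 0 ≤ (1 - α) * X := mul_nonneg (by linarith) h4
    have k4 : (1 - α) * X ≤ 1 * X := by gcongr; linarith
    rw [abs_le]; constructor <;> nlinarith
  calc 4 / α * |(m + 1) * Y - (1 - α) * X| ≤ 4 / α * ((m + 2) * wt α z) := by gcongr
    _ = _ := by ring

lemma tendsto_mul_rpow_sub_two {α : ℝ} {z : ℂ} (hz : z ≠ 0) {δ : ℕ → ℝ}
    (hδ : Tendsto δ atTop (𝓝 0)) :
    Tendsto (fun n => ‖z‖ ^ 2 * (‖z‖ ^ 2 + δ n) ^ (α - 2)) atTop (𝓝 (wt α z)) := by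
  have hn : 0 < ‖z‖ ^ 2 := by have := norm_pos_iff.2 hz; positivity
  have e : wt α z = ‖z‖ ^ 2 * (‖z‖ ^ 2) ^ (α - 2) := by
    rw [wt_eq_norm_sq, mul_rpow_sub_two hn]
  rw [e]
  exact (tendsto_add_rpow hn _ hδ).const_mul _

/-- For m = 0 the limit 4|z|^(2α-2) says that the squared distance to the apex of a flat cone has
cone Laplacian 4, whatever the angle. This is why the difference of the two squared distances is
harmonic. -/
lemma tendsto_regLap {α : ℝ} (hα : 0 < α) (m : ℕ) {z : ℂ} (hz : z ≠ 0) {δ : ℕ → ℝ}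
    (hδ : Tendsto δ atTop (𝓝 0)) :
    Tendsto (fun n => regLap α (δ n) m z) atTop (𝓝 (4 * (1 + m / α) * wt α z)) := by
  have h1 := (tendsto_mul_rpow_sub_two (α := α) hz hδ).const_mul (4 * ((α - 1) / α))
  have h2 := (tendsto_regWt α hz hδ).const_mul (4 * (m + 1) / α)
  have e : 4 * (1 + m / α) * wt α z =
      4 * ((α - 1) / α) * wt α z + 4 * (m + 1) / α * wt α z := by field_simp; ring
  rw [e]
  refine (h1.add h2).congr fun n => ?_
  rw [regLap]; ring

/-! ### The quadratic harmonic function -/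

/-- The difference of the squared distances to the two axes. -/
noncomputable def quadHarm (β γ : ℝ) (p : ℂ × ℂ) : ℝ := coneSq β p.1 - coneSq γ p.2

lemma continuous_coneSq {α : ℝ} (hα : 0 < α) : Continuous (coneSq α) := by
  unfold coneSq
  exact (continuous_norm.rpow_const fun z => Or.inr (by positivity)).div_const _

lemma continuous_quadHarm {β γ : ℝ} (hβ : 0 < β) (hγ : 0 < γ) : Continuous (quadHarm β γ) :=
  ((continuous_coneSq hβ).comp continuous_fst).sub ((continuous_coneSq hγ).comp continuous_snd)

lemma coneSq_nonneg (α : ℝ) (z : ℂ) : 0 ≤ coneSq α z :=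
  div_nonneg (Real.rpow_nonneg (norm_nonneg _) _) (sq_nonneg _)

lemma coneSq_rpow_mul {α t : ℝ} (hα : 0 < α) (ht : 0 < t) (z : ℂ) :
    coneSq α (((t ^ (1 / α) : ℝ) : ℂ) * z) = t ^ 2 * coneSq α z := by
  have h := Real.rpow_pos_of_pos ht (1 / α)
  rw [coneSq, coneSq, norm_mul, Complex.norm_real, Real.norm_of_nonneg h.le,
    Real.mul_rpow h.le (norm_nonneg _), ← Real.rpow_mul ht.le,
    show 1 / α * (2 * α) = (2 : ℕ) by field_simp; norm_num, Real.rpow_natCast, mul_div_assoc]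

lemma isHomogeneous_quadHarm {β γ : ℝ} (hβ : 0 < β) (hγ : 0 < γ) :
    IsHomogeneous β γ 2 (quadHarm β γ) := fun t ht => ae_of_all _ fun p => by
  simp only [quadHarm, dilation, coneSq_rpow_mul hβ ht, coneSq_rpow_mul hγ ht]
  rw [Real.rpow_two]; ring

/-- The differential of `quadHarm`. -/
noncomputable def quadGrad (β γ : ℝ) (p : ℂ × ℂ) : ℂ × ℂ →L[ℝ] ℝ :=
  (2 / β * wt β p.1) • (innerSL ℝ p.1 : ℂ →L[ℝ] ℝ).comp (ContinuousLinearMap.fst ℝ ℂ ℂ) -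
    (2 / γ * wt γ p.2) • (innerSL ℝ p.2 : ℂ →L[ℝ] ℝ).comp (ContinuousLinearMap.snd ℝ ℂ ℂ)

lemma quadGrad_apply (β γ : ℝ) (p e : ℂ × ℂ) : quadGrad β γ p e =
    2 / β * wt β p.1 * inner ℝ p.1 e.1 - 2 / γ * wt γ p.2 * inner ℝ p.2 e.2 := by
  simp only [quadGrad, sub_apply, smul_apply, ContinuousLinearMap.comp_apply,
    ContinuousLinearMap.coe_fst', ContinuousLinearMap.coe_snd', innerSL_apply_apply, smul_eq_mul]

lemma tendsto_integral_mul_test {F : ℕ → ℂ × ℂ → ℝ} {f B φ : ℂ × ℂ → ℝ} (hφ : IsTest φ)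
    (hF : ∀ n, AEStronglyMeasurable (F n)) (hB : LocallyIntegrable B)
    (hle : ∀ n, ∀ᵐ p, |F n p| ≤ B p) (hlim : ∀ᵐ p, Tendsto (fun n => F n p) atTop (𝓝 (f p))) :
    Tendsto (fun n => ∫ p, F n p * φ p) atTop (𝓝 (∫ p, f p * φ p)) := by
  refine tendsto_integral_filter_of_dominated_convergence (fun p => ‖B p * φ p‖)
    (Eventually.of_forall fun n => (hF n).mul hφ.1.continuous.aestronglyMeasurable)
    (Eventually.of_forall fun n => ?_) (hφ.integrable_mul hB).norm ?_
  · filter_upwards [hle n] with p hp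
    rw [norm_mul, norm_mul]
    exact mul_le_mul_of_nonneg_right (hp.trans (le_abs_self _)) (norm_nonneg _)
  · filter_upwards [hlim] with p hp using hp.mul_const _

/-- The sequence `1 / (n + 1)`. -/
noncomputable def del (n : ℕ) : ℝ := 1 / ((n : ℝ) + 1)

lemma del_pos (n : ℕ) : 0 < del n := Nat.one_div_pos_of_nat

lemma del_le_one (n : ℕ) : del n ≤ 1 := by
  rw [del, div_le_one (by positivity)]
  have : (0 : ℝ) ≤ n := n.cast_nonneg
  linarith

lemma tendsto_del : Tendsto del atTop (𝓝 0) := tendsto_one_div_add_atTop_nhds_zero_nat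

/-- Smooth approximations of `quadHarm`. -/
noncomputable def regQuad (β γ δ : ℝ) (p : ℂ × ℂ) : ℝ :=
  regSq β δ (‖p.1‖ ^ 2) - regSq γ δ (‖p.2‖ ^ 2)

lemma contDiff_regQuad (β γ : ℝ) {δ : ℝ} (hδ : 0 < δ) : ContDiff ℝ (⊤ : ℕ∞) (regQuad β γ δ) :=
  ((contDiff_regSq_norm hδ).comp contDiff_fst).sub ((contDiff_regSq_norm hδ).comp contDiff_snd)

lemma regSq_nonneg {α δ x : ℝ} (h : 0 ≤ x + δ) : 0 ≤ regSq α δ x :=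
  div_nonneg (Real.rpow_nonneg h _) (sq_nonneg _)

lemma regSq_mono {α δ δ' x : ℝ} (hα : 0 < α) (h : 0 ≤ x + δ) (h' : δ ≤ δ') :
    regSq α δ x ≤ regSq α δ' x := by
  unfold regSq
  gcongr

lemma tendsto_regSq {α x : ℝ} (hα : 0 < α) {δ : ℕ → ℝ} (hδ : Tendsto δ atTop (𝓝 0)) :
    Tendsto (fun n => regSq α (δ n) x) atTop (𝓝 (regSq α 0 x)) := by
  unfold regSq
  have h : Tendsto (fun n => x + δ n) atTop (𝓝 (x + 0)) := hδ.const_add x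
  exact (h.rpow_const (Or.inr hα.le)).div_const _

section

variable {β γ : ℝ}

lemma dirD_regQuad (hβ : 0 < β) (hγ : 0 < γ) {δ : ℝ} (hδ : 0 < δ) (e p : ℂ × ℂ) :
    dirD e (regQuad β γ δ) p =
      2 / β * regWt β δ p.1 * inner ℝ p.1 e.1 - 2 / γ * regWt γ δ p.2 * inner ℝ p.2 e.2 := by
  have hd := (contDiff_regQuad β γ hδ).differentiable (by simp)
  have e0 : dirD e (regQuad β γ δ) p =
      dirD (e.1, 0) (regQuad β γ δ) p + dirD (0, e.2) (regQuad β γ δ) p := by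
    rw [dirD, dirD, dirD, ← map_add]; simp
  rw [e0, dirD_fst_eq hd, dirD_snd_eq hd]
  have h1 : dirD e.1 (fun z => regQuad β γ δ (z, p.2)) p.1 =
      2 / β * regWt β δ p.1 * inner ℝ p.1 e.1 := by
    rw [← dirD_regSq hβ.ne' hδ]
    simp only [dirD, regQuad]
    rw [fderiv_sub_const]
  have h2 : dirD e.2 (fun w => regQuad β γ δ (p.1, w)) p.2 =
      -(2 / γ * regWt γ δ p.2 * inner ℝ p.2 e.2) := by
    rw [← dirD_regSq hγ.ne' hδ]
    simp only [dirD, regQuad]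
    rw [fderiv_const_sub]; rfl
  rw [h1, h2]; ring

lemma lapFst_regQuad (hβ : 0 < β) {δ : ℝ} (hδ : 0 < δ) (p : ℂ × ℂ) :
    lapFst (regQuad β γ δ) p = regLap β δ 0 p.1 := by
  rw [lapFst_eq (contDiff_regQuad β γ hδ), ← lap_regSq hβ.ne' hδ]
  simp only [regQuad, sub_eq_add_neg]
  rw [lap_add_const]

lemma lapSnd_regQuad (hγ : 0 < γ) {δ : ℝ} (hδ : 0 < δ) (p : ℂ × ℂ) :
    lapSnd (regQuad β γ δ) p = -regLap γ δ 0 p.2 := by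
  rw [lapSnd_eq (contDiff_regQuad β γ hδ), ← lap_regSq hγ.ne' hδ]
  simp only [regQuad]
  rw [lap_const_sub]

lemma wt_mul_norm {α : ℝ} {z : ℂ} (hz : z ≠ 0) : wt α z * ‖z‖ = ‖z‖ ^ (2 * α - 1) := by
  rw [wt, show 2 * α - 1 = 2 * α - 2 + 1 by ring, Real.rpow_add (norm_pos_iff.2 hz), Real.rpow_one]

/-- A bound for the gradient of `regQuad`, uniform in the regularisation. -/
noncomputable def gradBound (β γ : ℝ) (e p : ℂ × ℂ) : ℝ :=
  2 / β * ‖e.1‖ * ‖p.1‖ ^ (2 * β - 1) + 2 / γ * ‖e.2‖ * ‖p.2‖ ^ (2 * γ - 1)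

lemma abs_wt_mul_inner_le {α x : ℝ} (hα : 0 < α) {z : ℂ} (hz : z ≠ 0) (h0 : 0 ≤ x)
    (hx : x ≤ wt α z) (v : ℂ) :
    |2 / α * x * inner ℝ z v| ≤ 2 / α * ‖v‖ * ‖z‖ ^ (2 * α - 1) := by
  rw [← wt_mul_norm hz, abs_mul, abs_of_nonneg (by positivity : 0 ≤ 2 / α * x)]
  calc 2 / α * x * |inner ℝ z v| ≤ 2 / α * wt α z * (‖z‖ * ‖v‖) := by
        gcongr
        · exact mul_nonneg (by positivity) (wt_nonneg _ _)
        · exact abs_real_inner_le_norm z v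
    _ = _ := by ring

lemma abs_dirD_regQuad_le (hβ : 0 < β) (hβ1 : β ≤ 1) (hγ : 0 < γ) (hγ1 : γ ≤ 1) {δ : ℝ}
    (hδ : 0 < δ) (e : ℂ × ℂ) {p : ℂ × ℂ} (h1 : p.1 ≠ 0) (h2 : p.2 ≠ 0) :
    |dirD e (regQuad β γ δ) p| ≤ gradBound β γ e p := by
  rw [dirD_regQuad hβ hγ hδ]
  exact (abs_sub _ _).trans (add_le_add
    (abs_wt_mul_inner_le hβ h1 (regWt_nonneg _ hδ _) (regWt_le hβ1 hδ h1) _)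
    (abs_wt_mul_inner_le hγ h2 (regWt_nonneg _ hδ _) (regWt_le hγ1 hδ h2) _))

lemma abs_quadGrad_le (hβ : 0 < β) (hγ : 0 < γ) (e : ℂ × ℂ) {p : ℂ × ℂ} (h1 : p.1 ≠ 0)
    (h2 : p.2 ≠ 0) : |quadGrad β γ p e| ≤ gradBound β γ e p := by
  rw [quadGrad_apply]
  exact (abs_sub _ _).trans (add_le_add
    (abs_wt_mul_inner_le hβ h1 (wt_nonneg _ _) le_rfl _)
    (abs_wt_mul_inner_le hγ h2 (wt_nonneg _ _) le_rfl _))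

lemma tendsto_dirD_regQuad (hβ : 0 < β) (hγ : 0 < γ) (e : ℂ × ℂ) {p : ℂ × ℂ} (h1 : p.1 ≠ 0)
    (h2 : p.2 ≠ 0) :
    Tendsto (fun n => dirD e (regQuad β γ (del n)) p) atTop (𝓝 (quadGrad β γ p e)) := by
  rw [quadGrad_apply]
  refine Tendsto.congr (fun n => (dirD_regQuad hβ hγ (del_pos n) e p).symm) ?_
  exact (((tendsto_regWt β h1 tendsto_del).const_mul _).mul_const _).sub
    (((tendsto_regWt γ h2 tendsto_del).const_mul _).mul_const _)

lemma measurable_quadGrad (β γ : ℝ) : Measurable (quadGrad β γ) := by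
  have m1 : Measurable fun p : ℂ × ℂ => 2 / β * wt β p.1 := by fun_prop
  have m2 : Measurable fun p : ℂ × ℂ => 2 / γ * wt γ p.2 := by fun_prop
  have c1 : Continuous fun p : ℂ × ℂ =>
      (innerSL ℝ p.1 : ℂ →L[ℝ] ℝ).comp (ContinuousLinearMap.fst ℝ ℂ ℂ) := by fun_prop
  have c2 : Continuous fun p : ℂ × ℂ =>
      (innerSL ℝ p.2 : ℂ →L[ℝ] ℝ).comp (ContinuousLinearMap.snd ℝ ℂ ℂ) := by fun_prop
  exact (m1.smul c1.measurable).sub (m2.smul c2.measurable)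

lemma locallyIntegrable_fst_rpow {r : ℝ} (hr : -2 < r) :
    LocallyIntegrable (fun p : ℂ × ℂ => ‖p.1‖ ^ r) := by
  simpa using locallyIntegrable_norm_rpow_mul (r := r) (r' := 0) hr (by norm_num)

lemma locallyIntegrable_snd_rpow {r : ℝ} (hr : -2 < r) :
    LocallyIntegrable (fun p : ℂ × ℂ => ‖p.2‖ ^ r) := by
  simpa using locallyIntegrable_norm_rpow_mul (r := 0) (r' := r) (by norm_num) hr

lemma locallyIntegrable_const_mul {f : ℂ × ℂ → ℝ} (hf : LocallyIntegrable f) (c : ℝ) :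
    LocallyIntegrable (fun p => c * f p) := hf.smul c

lemma locallyIntegrable_gradBound (hβ : 0 < β) (hγ : 0 < γ) (e : ℂ × ℂ) :
    LocallyIntegrable (gradBound β γ e) :=
  (locallyIntegrable_const_mul (locallyIntegrable_fst_rpow (by linarith)) _).add
    (locallyIntegrable_const_mul (locallyIntegrable_snd_rpow (by linarith)) _)

lemma norm_quadGrad_le (hβ : 0 < β) (hγ : 0 < γ) {p : ℂ × ℂ} (h1 : p.1 ≠ 0)
    (h2 : p.2 ≠ 0) : ‖quadGrad β γ p‖ ≤ gradBound β γ (1, 1) p := by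
  have := norm_pos_iff.2 h1
  have := norm_pos_iff.2 h2
  have k1 : 0 ≤ 2 / β * ‖p.1‖ ^ (2 * β - 1) := by positivity
  have k2 : 0 ≤ 2 / γ * ‖p.2‖ ^ (2 * γ - 1) := by positivity
  refine ContinuousLinearMap.opNorm_le_bound _ (by simp [gradBound]; linarith) fun e => ?_
  refine (abs_quadGrad_le hβ hγ e h1 h2).trans ?_
  have g1 := mul_le_mul_of_nonneg_left (norm_fst_le e) k1
  have g2 := mul_le_mul_of_nonneg_left (norm_snd_le e) k2
  simp only [gradBound, norm_one, mul_one]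
  linarith

/-- The function need not be differentiable on the axes. The identity is the limit of integration by
parts for its smooth regularisations, whose gradients are dominated by multiples of |z|^(2β-1) and
|w|^(2γ-1). -/
lemma isWeakDifferential_quadHarm (hβ : 0 < β) (hβ1 : β ≤ 1) (hγ : 0 < γ) (hγ1 : γ ≤ 1) :
    IsWeakDifferential (quadHarm β γ) (quadGrad β γ) := by
  refine ⟨(continuous_quadHarm hβ hγ).locallyIntegrable, ?_, fun φ hφ e => ?_⟩
  · refine (locallyIntegrable_gradBound hβ hγ (1, 1)).mono
      (measurable_quadGrad β γ).aestronglyMeasurable ?_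
    filter_upwards [ae_ne_zero] with p hp
    exact (norm_quadGrad_le hβ hγ hp.1 hp.2).trans (le_abs_self _)
  · have hcd := fun n => contDiff_regQuad β γ (del_pos n)
    have l1 : Tendsto (fun n => ∫ p, regQuad β γ (del n) p * dirD e φ p) atTop
        (𝓝 (∫ p, quadHarm β γ p * dirD e φ p)) := by
      refine tendsto_integral_mul_test (hφ.dirD e)
        (B := fun p => regSq β 1 (‖p.1‖ ^ 2) + regSq γ 1 (‖p.2‖ ^ 2))
        (fun n => (hcd n).continuous.aestronglyMeasurable)
        (Continuous.locallyIntegrable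
          (((contDiff_regSq_norm one_pos).continuous.comp continuous_fst).add
            ((contDiff_regSq_norm one_pos).continuous.comp continuous_snd)))
        (fun n => ae_of_all _ fun p => ?_) (ae_of_all _ fun p => ?_)
      · have hn := (del_pos n).le
        have b1 : regSq β (del n) (‖p.1‖ ^ 2) ≤ _ :=
          regSq_mono hβ (by positivity) (del_le_one n)
        have b2 : regSq γ (del n) (‖p.2‖ ^ 2) ≤ _ :=
          regSq_mono hγ (by positivity) (del_le_one n)
        have b3 : 0 ≤ regSq β (del n) (‖p.1‖ ^ 2) := regSq_nonneg (by positivity)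
        have b4 : 0 ≤ regSq γ (del n) (‖p.2‖ ^ 2) := regSq_nonneg (by positivity)
        rw [regQuad, abs_le]; constructor <;> linarith
      · rw [quadHarm, coneSq_eq, coneSq_eq]
        exact (tendsto_regSq hβ tendsto_del).sub (tendsto_regSq hγ tendsto_del)
    have l2 : Tendsto (fun n => ∫ p, dirD e (regQuad β γ (del n)) p * φ p) atTop
        (𝓝 (∫ p, quadGrad β γ p e * φ p)) := by
      refine tendsto_integral_mul_test hφ
        (fun n => (contDiff_dirD (hcd n) e).continuous.aestronglyMeasurable)
        (locallyIntegrable_gradBound hβ hγ e) (fun n => ?_) ?_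
      · filter_upwards [ae_ne_zero] with p hp
        exact abs_dirD_regQuad_le hβ hβ1 hγ hγ1 (del_pos n) e hp.1 hp.2
      · filter_upwards [ae_ne_zero] with p hp
        exact tendsto_dirD_regQuad hβ hγ e hp.1 hp.2
    exact tendsto_nhds_unique l1
      (l2.neg.congr fun n => (integral_mul_dirD (hcd n) hφ e).symm)

lemma inner_sq_add (z : ℂ) : inner ℝ z (1 : ℂ) * inner ℝ z (1 : ℂ) +
    inner ℝ z Complex.I * inner ℝ z Complex.I = ‖z‖ ^ 2 := by
  rw [Complex.sq_norm, Complex.normSq_apply]; simp [Complex.inner]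

lemma wt_sq_mul_norm_sq {α : ℝ} {z : ℂ} (hz : z ≠ 0) :
    wt α z ^ 2 * ‖z‖ ^ 2 = ‖z‖ ^ (4 * α - 2) := by
  rw [← mul_pow, wt_mul_norm hz, ← Real.rpow_natCast, ← Real.rpow_mul (norm_nonneg _)]
  congr 1; push_cast; ring

/-- The weighted energy density is a combination of |z|^(4β-2)|w|^(2γ-2) and |z|^(2β-2)|w|^(4γ-2);
all four exponents exceed -2 for positive β and γ. -/
lemma isLocSobolev_quadHarm (hβ : 0 < β) (hβ1 : β ≤ 1) (hγ : 0 < γ) (hγ1 : γ ≤ 1) :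
    IsLocSobolev β γ (quadHarm β γ) (quadGrad β γ) := by
  refine ⟨isWeakDifferential_quadHarm hβ hβ1 hγ hγ1,
    locallyIntegrable_vol_of_continuous hβ hγ ((continuous_quadHarm hβ hγ).pow 2), ?_⟩
  rw [locallyIntegrable_vol_iff]
  have i1 := locallyIntegrable_const_mul (locallyIntegrable_norm_rpow_mul
    (r := 4 * β - 2) (r' := 2 * γ - 2) (by linarith) (by linarith)) ((2 / β) ^ 2)
  have i2 := locallyIntegrable_const_mul (locallyIntegrable_norm_rpow_mul
    (r := 2 * β - 2) (r' := 4 * γ - 2) (by linarith) (by linarith)) ((2 / γ) ^ 2)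
  refine (i1.add i2).congr ?_
  filter_upwards [ae_ne_zero] with p hp
  rw [wt_mul_coInner hp.1 hp.2]
  simp only [quadGrad_apply, inner_zero_right, mul_zero, sub_zero, zero_sub, Pi.add_apply,
    ← wt_sq_mul_norm_sq hp.1, ← wt_sq_mul_norm_sq hp.2]
  rw [← inner_sq_add p.1, ← inner_sq_add p.2]
  change _ * (_ * wt γ p.2) + _ * (wt β p.1 * _) = _
  ring

lemma isHarmonic_quadHarm (hβ : 0 < β) (hβ1 : β ≤ 1) (hγ : 0 < γ) (hγ1 : γ ≤ 1) :
    IsHarmonic β γ (quadHarm β γ) := by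
  have hS := isLocSobolev_quadHarm hβ hβ1 hγ hγ1
  refine ⟨quadGrad β γ, hS, fun φ hφ => ?_⟩
  have hcd := fun n => contDiff_regQuad β γ (del_pos n)
  rw [integral_vol]
  have hz : ∀ v : ℂ, Tendsto (fun n => ∫ p,
      wt γ p.2 * dirD (v, 0) (regQuad β γ (del n)) p * dirD (v, 0) φ p) atTop
      (𝓝 (∫ p, wt γ p.2 * quadGrad β γ p (v, 0) * dirD (v, 0) φ p)) := by
    intro v
    refine tendsto_integral_mul_test (hφ.dirD _) (fun n => (aestronglyMeasurable_wt_snd γ).mul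
      (contDiff_dirD (hcd n) _).continuous.aestronglyMeasurable)
      (B := fun p => 2 / β * ‖v‖ * (‖p.1‖ ^ (2 * β - 1) * ‖p.2‖ ^ (2 * γ - 2)))
      (locallyIntegrable_const_mul
        (locallyIntegrable_norm_rpow_mul (by linarith) (by linarith)) _) (fun n => ?_) ?_
    · filter_upwards [ae_ne_zero] with p hp
      have h := abs_dirD_regQuad_le hβ hβ1 hγ hγ1 (del_pos n) (v, 0) hp.1 hp.2
      have hw := wt_nonneg γ p.2
      rw [abs_mul, abs_of_nonneg hw]
      refine (mul_le_mul_of_nonneg_left h hw).trans_eq ?_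
      simp only [gradBound, norm_zero, wt]; ring
    · filter_upwards [ae_ne_zero] with p hp
      exact (tendsto_dirD_regQuad hβ hγ _ hp.1 hp.2).const_mul _
  have hw : ∀ v : ℂ, Tendsto (fun n => ∫ p,
      wt β p.1 * dirD (0, v) (regQuad β γ (del n)) p * dirD (0, v) φ p) atTop
      (𝓝 (∫ p, wt β p.1 * quadGrad β γ p (0, v) * dirD (0, v) φ p)) := by
    intro v
    refine tendsto_integral_mul_test (hφ.dirD _) (fun n => (aestronglyMeasurable_wt_fst β).mul
      (contDiff_dirD (hcd n) _).continuous.aestronglyMeasurable)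
      (B := fun p => 2 / γ * ‖v‖ * (‖p.1‖ ^ (2 * β - 2) * ‖p.2‖ ^ (2 * γ - 1)))
      (locallyIntegrable_const_mul
        (locallyIntegrable_norm_rpow_mul (by linarith) (by linarith)) _) (fun n => ?_) ?_
    · filter_upwards [ae_ne_zero] with p hp
      have h := abs_dirD_regQuad_le hβ hβ1 hγ hγ1 (del_pos n) (0, v) hp.1 hp.2
      have hw := wt_nonneg β p.1
      rw [abs_mul, abs_of_nonneg hw]
      refine (mul_le_mul_of_nonneg_left h hw).trans_eq ?_
      simp only [gradBound, norm_zero, wt]; ring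
    · filter_upwards [ae_ne_zero] with p hp
      exact (tendsto_dirD_regQuad hβ hγ _ hp.1 hp.2).const_mul _
  -- Both terms tend to 4|z|^(2β-2)|w|^(2γ-2) with opposite signs. The constants 8/β and 8/γ are
  -- 4(m+2)/α at m = 0.
  have hr : Tendsto (fun n => ∫ p, (wt γ p.2 * lapFst (regQuad β γ (del n)) p +
      wt β p.1 * lapSnd (regQuad β γ (del n)) p) * φ p) atTop (𝓝 (∫ p, (0 : ℝ) * φ p)) := by
    refine tendsto_integral_mul_test (f := fun _ => 0) hφ (fun n => ?_)
      (B := fun p => (8 / β + 8 / γ) * (wt β p.1 * wt γ p.2))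
      (locallyIntegrable_const_mul (locallyIntegrable_wt_mul_wt hβ hγ) _) (fun n => ?_) ?_
    · have c1 : ∀ e, AEStronglyMeasurable (dirD e (dirD e (regQuad β γ (del n)))) := fun e =>
        (contDiff_dirD (contDiff_dirD (hcd n) e) e).continuous.aestronglyMeasurable
      exact ((aestronglyMeasurable_wt_snd γ).mul ((c1 _).add (c1 _))).add
        ((aestronglyMeasurable_wt_fst β).mul ((c1 _).add (c1 _)))
    · filter_upwards [ae_ne_zero] with p hp
      rw [lapFst_regQuad hβ (del_pos n), lapSnd_regQuad hγ (del_pos n)]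
      have h1 := mul_le_mul_of_nonneg_left
        (abs_regLap_le hβ hβ1 (del_pos n) 0 hp.1) (wt_nonneg γ p.2)
      have h2 := mul_le_mul_of_nonneg_left
        (abs_regLap_le hγ hγ1 (del_pos n) 0 hp.2) (wt_nonneg β p.1)
      refine (abs_add_le _ _).trans ?_
      rw [abs_mul, abs_mul, abs_neg, abs_of_nonneg (wt_nonneg γ p.2),
        abs_of_nonneg (wt_nonneg β p.1)]
      refine (add_le_add h1 h2).trans_eq ?_
      push_cast; ring
    · filter_upwards [ae_ne_zero] with p hp
      simp only [fun n => lapFst_regQuad (γ := γ) hβ (del_pos n) p,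
        fun n => lapSnd_regQuad (β := β) hγ (del_pos n) p]
      have h1 := (tendsto_regLap hβ 0 hp.1 tendsto_del).const_mul (wt γ p.2)
      have h2 := (tendsto_regLap hγ 0 hp.2 tendsto_del).neg.const_mul (wt β p.1)
      convert h1.add h2 using 2
      push_cast; ring
  simp only [zero_mul, integral_zero] at hr
  have hG := fun n => integral_grad_mul_grad hβ hβ1 hγ hγ1 (hcd n) hφ
  have hsum := ((hz 1).add (hz Complex.I)).add ((hw 1).add (hw Complex.I))
  have b1 := hS.locallyIntegrable_snd_wt_mul_apply hγ (1, 0) (Or.inl rfl)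
  have b2 := hS.locallyIntegrable_snd_wt_mul_apply hγ (Complex.I, 0) (Or.inr rfl)
  have b3 := hS.locallyIntegrable_fst_wt_mul_apply hβ (0, 1) (Or.inl rfl)
  have b4 := hS.locallyIntegrable_fst_wt_mul_apply hβ (0, Complex.I) (Or.inr rfl)
  rw [← integral_four ((hφ.dirD _).integrable_mul b1) ((hφ.dirD _).integrable_mul b2)
    ((hφ.dirD _).integrable_mul b3) ((hφ.dirD _).integrable_mul b4)] at hsum
  have hlim : Tendsto (fun n => -∫ p, (wt γ p.2 * lapFst (regQuad β γ (del n)) p +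
      wt β p.1 * lapSnd (regQuad β γ (del n)) p) * φ p) atTop
      (𝓝 (∫ p, wt β p.1 * wt γ p.2 * coInner β γ p (quadGrad β γ p) (fderiv ℝ φ p))) := by
    have e : ∫ p, wt β p.1 * wt γ p.2 * coInner β γ p (quadGrad β γ p) (fderiv ℝ φ p) =
        ∫ p, (wt γ p.2 * quadGrad β γ p (1, 0) * dirD (1, 0) φ p +
          wt γ p.2 * quadGrad β γ p (Complex.I, 0) * dirD (Complex.I, 0) φ p +
          (wt β p.1 * quadGrad β γ p (0, 1) * dirD (0, 1) φ p +
          wt β p.1 * quadGrad β γ p (0, Complex.I) * dirD (0, Complex.I) φ p)) := by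
      refine integral_congr_ae ?_
      filter_upwards [ae_ne_zero] with p hp
      rw [wt_mul_coInner hp.1 hp.2]
      simp only [dirD]; ring
    rw [e]
    refine hsum.congr fun n => ?_
    have k1 : ∀ e, LocallyIntegrable
        (fun p => wt γ p.2 * dirD e (regQuad β γ (del n)) p) := fun e =>
      LocallyIntegrable.mul_continuous (locallyIntegrable_wt_snd hγ)
        (contDiff_dirD (hcd n) e).continuous
    have k2 : ∀ e, LocallyIntegrable
        (fun p => wt β p.1 * dirD e (regQuad β γ (del n)) p) := fun e =>
      LocallyIntegrable.mul_continuous (locallyIntegrable_wt_fst hβ)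
        (contDiff_dirD (hcd n) e).continuous
    rw [← hG n, ← integral_four ((hφ.dirD (1, 0)).integrable_mul (k1 _))
      ((hφ.dirD (Complex.I, 0)).integrable_mul (k1 _)) ((hφ.dirD (0, 1)).integrable_mul (k2 _))
      ((hφ.dirD (0, Complex.I)).integrable_mul (k2 _))]
    congr 1; ext p; ring
  have := tendsto_nhds_unique hlim hr.neg
  simpa using this

end

/-! ### The equation tested against profiles -/

/-- The squared distance to the apex. -/
noncomputable def rad (β γ : ℝ) (p : ℂ × ℂ) : ℝ := coneSq β p.1 + coneSq γ p.2

lemma rad_nonneg (β γ : ℝ) (p : ℂ × ℂ) : 0 ≤ rad β γ p :=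
  add_nonneg (coneSq_nonneg _ _) (coneSq_nonneg _ _)

lemma continuous_rad {β γ : ℝ} (hβ : 0 < β) (hγ : 0 < γ) : Continuous (rad β γ) :=
  ((continuous_coneSq hβ).comp continuous_fst).add ((continuous_coneSq hγ).comp continuous_snd)

lemma norm_le_of_coneSq_le {α A : ℝ} (hα : 0 < α) {z : ℂ} (h : coneSq α z ≤ A) :
    ‖z‖ ≤ (A * α ^ 2) ^ (1 / (2 * α)) := by
  have h1 : ‖z‖ ^ (2 * α) ≤ A * α ^ 2 := by
    rwa [coneSq, div_le_iff₀ (by positivity)] at h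
  have h2 : ‖z‖ = (‖z‖ ^ (2 * α)) ^ (1 / (2 * α)) := by
    rw [← Real.rpow_mul (norm_nonneg _), mul_one_div_cancel (by positivity), Real.rpow_one]
  rw [h2]
  exact Real.rpow_le_rpow (Real.rpow_nonneg (norm_nonneg _) _) h1 (by positivity)

lemma isCompact_rad_le {β γ : ℝ} (hβ : 0 < β) (hγ : 0 < γ) (A : ℝ) :
    IsCompact {p | rad β γ p ≤ A} := by
  refine Metric.isCompact_of_isClosed_isBounded
    (isClosed_le (continuous_rad hβ hγ) continuous_const) ?_
  refine ((Metric.isBounded_closedBall (x := (0 : ℂ)) (r := (A * β ^ 2) ^ (1 / (2 * β)))).prod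
    (Metric.isBounded_closedBall (x := (0 : ℂ)) (r := (A * γ ^ 2) ^ (1 / (2 * γ))))).subset ?_
  intro p hp
  have h1 := coneSq_nonneg β p.1
  have h2 := coneSq_nonneg γ p.2
  simp only [rad, mem_ofPred_eq] at hp
  exact ⟨by simpa using norm_le_of_coneSq_le hβ (by linarith : coneSq β p.1 ≤ A),
    by simpa using norm_le_of_coneSq_le hγ (by linarith : coneSq γ p.2 ≤ A)⟩

/-- `F` is smooth, vanishes for `s + t > A`, and has the given pure partial derivatives. -/
structure IsProfile (A : ℝ) (F F1 F11 F2 F22 : ℝ → ℝ → ℝ) : Prop where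
  smooth : ContDiff ℝ (⊤ : ℕ∞) (fun x : ℝ × ℝ => F x.1 x.2)
  d1 : ∀ s t, HasDerivAt (fun s => F s t) (F1 s t) s
  d11 : ∀ s t, HasDerivAt (fun s => F1 s t) (F11 s t) s
  d2 : ∀ s t, HasDerivAt (fun t => F s t) (F2 s t) t
  d22 : ∀ s t, HasDerivAt (fun t => F2 s t) (F22 s t) t
  c1 : Continuous (fun x : ℝ × ℝ => F1 x.1 x.2)
  c11 : Continuous (fun x : ℝ × ℝ => F11 x.1 x.2)
  c2 : Continuous (fun x : ℝ × ℝ => F2 x.1 x.2)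
  c22 : Continuous (fun x : ℝ × ℝ => F22 x.1 x.2)
  v : ∀ s t, A < s + t → F s t = 0
  v1 : ∀ s t, A < s + t → F1 s t = 0
  v11 : ∀ s t, A < s + t → F11 s t = 0
  v2 : ∀ s t, A < s + t → F2 s t = 0
  v22 : ∀ s t, A < s + t → F22 s t = 0

section

variable {β γ A : ℝ} {F F1 F11 F2 F22 : ℝ → ℝ → ℝ}

/-- The smooth test function built from a profile. -/
noncomputable def profileTest (β γ δ : ℝ) (m : ℕ) (c : ℂ) (n : ℕ) (c' : ℂ) (F : ℝ → ℝ → ℝ)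
    (p : ℂ × ℂ) : ℝ :=
  harmProd m c n c' p * F (regSq β δ (‖p.1‖ ^ 2)) (regSq γ δ (‖p.2‖ ^ 2))

lemma contDiff_profileTest (hF : IsProfile A F F1 F11 F2 F22) {δ : ℝ} (hδ : 0 < δ) (m : ℕ) (c : ℂ)
    (n : ℕ) (c' : ℂ) : ContDiff ℝ (⊤ : ℕ∞) (profileTest β γ δ m c n c' F) :=
  (contDiff_harmProd m c n c').mul (hF.smooth.comp
    (((contDiff_regSq_norm hδ).comp contDiff_fst).prodMk
      ((contDiff_regSq_norm hδ).comp contDiff_snd)))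

/-- Regularising increases the squared distances, so a profile that vanishes for s + t > A yields
test functions supported in one compact set, the same for all δ. -/
lemma rad_le_regSq (hβ : 0 < β) (hγ : 0 < γ) {δ : ℝ} (hδ : 0 < δ) (p : ℂ × ℂ) :
    rad β γ p ≤ regSq β δ (‖p.1‖ ^ 2) + regSq γ δ (‖p.2‖ ^ 2) := by
  rw [rad, coneSq_eq, coneSq_eq]
  exact add_le_add (regSq_mono hβ (by positivity) hδ.le) (regSq_mono hγ (by positivity) hδ.le)

lemma isTest_profileTest (hβ : 0 < β) (hγ : 0 < γ) (hF : IsProfile A F F1 F11 F2 F22) {δ : ℝ}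
    (hδ : 0 < δ) (m : ℕ) (c : ℂ) (n : ℕ) (c' : ℂ) : IsTest (profileTest β γ δ m c n c' F) := by
  refine ⟨contDiff_profileTest hF hδ m c n c',
    HasCompactSupport.intro (isCompact_rad_le hβ hγ A) fun p hp => ?_⟩
  have h := rad_le_regSq hβ hγ hδ p
  rw [profileTest, hF.v _ _ ((not_le.1 hp).trans_le h), mul_zero]

/-- The Laplacian of a profile in one variable, regularised. -/
noncomputable def regOp (α δ : ℝ) (m : ℕ) (f1 f11 : ℝ) (z : ℂ) : ℝ :=
  f1 * regLap α δ m z + f11 * (4 * ‖z‖ ^ 2 * (regWt α δ z / α) ^ 2)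

lemma lap_profile {α δ : ℝ} (hα : 0 < α) (hδ : 0 < δ) (m : ℕ) (c : ℂ) {f f1 f11 : ℝ → ℝ}
    (h1 : ∀ s, HasDerivAt f (f1 s) s) (h2 : ∀ s, HasDerivAt f1 (f11 s) s) (z : ℂ) :
    lap (fun z => harmPoly m c z * f (regSq α δ (‖z‖ ^ 2))) z =
      harmPoly m c z *
        regOp α δ m (f1 (regSq α δ (‖z‖ ^ 2))) (f11 (regSq α δ (‖z‖ ^ 2))) z := by
  have k1 : ∀ x, 0 ≤ x → HasDerivAt (fun x => f (regSq α δ x))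
      (f1 (regSq α δ x) * ((x + δ) ^ (α - 1) / α)) x := fun x hx =>
    (h1 _).comp x (hasDerivAt_regSq hα.ne' (by positivity))
  have k2 : ∀ x, 0 ≤ x → HasDerivAt (fun x => f1 (regSq α δ x) * ((x + δ) ^ (α - 1) / α))
      (f11 (regSq α δ x) * ((x + δ) ^ (α - 1) / α) * ((x + δ) ^ (α - 1) / α) +
        f1 (regSq α δ x) * ((α - 1) * (x + δ) ^ (α - 2) / α)) x := fun x hx =>
    ((h2 _).comp x (hasDerivAt_regSq hα.ne' (by positivity))).mul
      (hasDerivAt_regSq' (by positivity))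
  rw [lap_harmPoly_mul_radial m c k1 k2 z, regOp, regLap, regWt]
  ring

lemma lapFst_profileTest (hβ : 0 < β) (hF : IsProfile A F F1 F11 F2 F22) {δ : ℝ}
    (hδ : 0 < δ) (m : ℕ) (c : ℂ) (n : ℕ) (c' : ℂ) (p : ℂ × ℂ) :
    lapFst (profileTest β γ δ m c n c' F) p = harmProd m c n c' p *
      regOp β δ m (F1 (regSq β δ (‖p.1‖ ^ 2)) (regSq γ δ (‖p.2‖ ^ 2)))
        (F11 (regSq β δ (‖p.1‖ ^ 2)) (regSq γ δ (‖p.2‖ ^ 2))) p.1 := by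
  rw [lapFst_eq (contDiff_profileTest hF hδ m c n c')]
  have e : (fun z => profileTest β γ δ m c n c' F (z, p.2)) = fun z =>
      harmPoly m c z * F (regSq β δ (‖z‖ ^ 2)) (regSq γ δ (‖p.2‖ ^ 2)) * harmPoly n c' p.2 := by
    ext z; simp only [profileTest, harmProd]; ring
  rw [e, lap_mul_const, lap_profile hβ hδ m c (f := fun s => F s (regSq γ δ (‖p.2‖ ^ 2)))
    (fun s => hF.d1 s _) (fun s => hF.d11 s _), harmProd]
  ring

lemma lapSnd_profileTest (hγ : 0 < γ) (hF : IsProfile A F F1 F11 F2 F22) {δ : ℝ}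
    (hδ : 0 < δ) (m : ℕ) (c : ℂ) (n : ℕ) (c' : ℂ) (p : ℂ × ℂ) :
    lapSnd (profileTest β γ δ m c n c' F) p = harmProd m c n c' p *
      regOp γ δ n (F2 (regSq β δ (‖p.1‖ ^ 2)) (regSq γ δ (‖p.2‖ ^ 2)))
        (F22 (regSq β δ (‖p.1‖ ^ 2)) (regSq γ δ (‖p.2‖ ^ 2))) p.2 := by
  rw [lapSnd_eq (contDiff_profileTest hF hδ m c n c')]
  have e : (fun w => profileTest β γ δ m c n c' F (p.1, w)) = fun w =>
      harmPoly n c' w * F (regSq β δ (‖p.1‖ ^ 2)) (regSq γ δ (‖w‖ ^ 2)) * harmPoly m c p.1 := by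
    ext z; simp only [profileTest, harmProd]; ring
  rw [e, lap_mul_const, lap_profile hγ hδ n c' (f := fun t => F (regSq β δ (‖p.1‖ ^ 2)) t)
    (fun t => hF.d2 _ t) (fun t => hF.d22 _ t), harmProd]
  ring

/-- A bound uniform in δ for the dominated convergence below. The term with the second derivative of
the profile carries the square of the weight, which has to be reduced to a single power. -/
lemma abs_regOp_le {α δ M B f1 f11 : ℝ} (hα : 0 < α) (hα1 : α ≤ 1) (hδ : 0 < δ) (m : ℕ) {z : ℂ}
    (hz : z ≠ 0) (hB : regSq α δ (‖z‖ ^ 2) ≤ B) (h1 : |f1| ≤ M) (h11 : |f11| ≤ M) :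
    |regOp α δ m f1 f11 z| ≤ M * (4 * (m + 2) / α + 4 * B) * wt α z := by
  have hM : 0 ≤ M := (abs_nonneg _).trans h1
  have k1 := abs_regLap_le hα hα1 hδ m hz
  have hN : 0 < ‖z‖ ^ 2 + δ := by positivity
  have w0 := regWt_nonneg α hδ z
  -- One of the two weights is absorbed by |z|²: (|z|² + δ)^α is α² times the regularised squared
  -- distance, hence bounded on the support of the profile.
  have k2 : ‖z‖ ^ 2 * regWt α δ z ≤ B * α ^ 2 := by
    have e : (‖z‖ ^ 2 + δ) * regWt α δ z = regSq α δ (‖z‖ ^ 2) * α ^ 2 := by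
      rw [regWt, regSq, div_mul_cancel₀ _ (by positivity), Real.rpow_sub_one hN.ne',
        mul_div_cancel₀ _ hN.ne']
    have : ‖z‖ ^ 2 * regWt α δ z ≤ (‖z‖ ^ 2 + δ) * regWt α δ z := by gcongr; linarith
    rw [e] at this
    exact this.trans (by gcongr)
  have k3 : 4 * ‖z‖ ^ 2 * (regWt α δ z / α) ^ 2 ≤ 4 * B * wt α z := by
    have e : 4 * ‖z‖ ^ 2 * (regWt α δ z / α) ^ 2 =
        4 / α ^ 2 * (‖z‖ ^ 2 * regWt α δ z) * regWt α δ z := by field_simp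
    have hB0 : 0 ≤ B := (regSq_nonneg hN.le).trans hB
    calc 4 * ‖z‖ ^ 2 * (regWt α δ z / α) ^ 2
        = 4 / α ^ 2 * (‖z‖ ^ 2 * regWt α δ z) * regWt α δ z := e
      _ ≤ 4 / α ^ 2 * (B * α ^ 2) * wt α z := by
          gcongr
          exact regWt_le hα1 hδ hz
      _ = 4 * B * wt α z := by field_simp
  have k4 : 0 ≤ 4 * ‖z‖ ^ 2 * (regWt α δ z / α) ^ 2 := by positivity
  rw [regOp]
  calc |f1 * regLap α δ m z + f11 * (4 * ‖z‖ ^ 2 * (regWt α δ z / α) ^ 2)|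
      ≤ |f1| * |regLap α δ m z| + |f11| * (4 * ‖z‖ ^ 2 * (regWt α δ z / α) ^ 2) := by
        refine (abs_add_le _ _).trans_eq ?_
        rw [abs_mul, abs_mul, abs_of_nonneg k4]
    _ ≤ M * (4 * (m + 2) / α * wt α z) + M * (4 * B * wt α z) := by gcongr
    _ = _ := by ring

lemma tendsto_regOp {α : ℝ} (hα : 0 < α) (m : ℕ) {z : ℂ} (hz : z ≠ 0) {δ f1 f11 : ℕ → ℝ}
    {a1 a11 : ℝ} (hδ : Tendsto δ atTop (𝓝 0)) (h1 : Tendsto f1 atTop (𝓝 a1))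
    (h11 : Tendsto f11 atTop (𝓝 a11)) :
    Tendsto (fun n => regOp α (δ n) m (f1 n) (f11 n) z) atTop
      (𝓝 (4 * wt α z * (coneSq α z * a11 + (1 + m / α) * a1))) := by
  have hN : 0 < ‖z‖ ^ 2 := by have := norm_pos_iff.2 hz; positivity
  have k := (h1.mul (tendsto_regLap hα m hz hδ)).add (h11.mul
    ((((tendsto_regWt α hz hδ).div_const α).pow 2).const_mul (4 * ‖z‖ ^ 2)))
  have e : ‖z‖ ^ 2 * wt α z = coneSq α z * α ^ 2 := by
    rw [coneSq, div_mul_cancel₀ _ (by positivity), ← norm_sq_rpow, wt_eq_norm_sq,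
      Real.rpow_sub_one hN.ne', mul_div_cancel₀ _ hN.ne']
  have e2 : a1 * (4 * (1 + m / α) * wt α z) + a11 * (4 * ‖z‖ ^ 2 * (wt α z / α) ^ 2) =
      4 * wt α z * (coneSq α z * a11 + (1 + m / α) * a1) := by
    have : 4 * ‖z‖ ^ 2 * (wt α z / α) ^ 2 = 4 * wt α z * coneSq α z := by
      rw [div_pow, mul_div_assoc', div_eq_iff (by positivity)]
      linear_combination 4 * wt α z * e
    rw [this]; ring
  rw [← e2]
  exact k

lemma exists_bound_of_continuous {f : ℝ → ℝ → ℝ} (hc : Continuous fun x : ℝ × ℝ => f x.1 x.2)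
    (A : ℝ) : ∃ M, ∀ s t, 0 ≤ s → 0 ≤ t → s + t ≤ A → |f s t| ≤ M := by
  obtain ⟨M, hM⟩ := ((isCompact_Icc (a := (0 : ℝ)) (b := A)).prod
    (isCompact_Icc (a := (0 : ℝ)) (b := A))).exists_bound_of_continuousOn hc.continuousOn
  exact ⟨M, fun s t hs ht h => hM (s, t) ⟨⟨hs, by linarith⟩, ⟨ht, by linarith⟩⟩⟩

/-- The cone Laplacian of a profile, in the coordinates given by the squared distances. -/
noncomputable def profileOp (μ ν : ℝ) (F1 F11 F2 F22 : ℝ → ℝ → ℝ) (s t : ℝ) : ℝ :=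
  (s * F11 s t + (1 + μ) * F1 s t) + (t * F22 s t + (1 + ν) * F2 s t)

/-- The regularised profiles are genuine test functions. As δ → 0 their flat operators converge
almost everywhere to 4 |z|^(2β-2) |w|^(2γ-2) times the harmonic product times `profileOp`, and are
dominated by a constant multiple of the doubly weighted |u| on the compact set where the squared
distance is at most A. -/
lemma IsHarmonic.integral_profile_eq_zero (hβ : 0 < β) (hβ1 : β ≤ 1) (hγ : 0 < γ)
    (hγ1 : γ ≤ 1) {u : ℂ × ℂ → ℝ} (hu : IsHarmonic β γ u)
    (hF : IsProfile A F F1 F11 F2 F22) (m : ℕ) (c : ℂ) (n : ℕ) (c' : ℂ) :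
    ∫ p, u p * harmProd m c n c' p *
      profileOp (m / β) (n / γ) F1 F11 F2 F22 (coneSq β p.1) (coneSq γ p.2) ∂(vol β γ) = 0 := by
  have hu' := hu
  obtain ⟨G, hG, -⟩ := hu'
  have hum := hG.1.1.aestronglyMeasurable
  have hT := fun j => isTest_profileTest (β := β) (γ := γ) hβ hγ hF (del_pos j) m c n c'
  have hK := isCompact_rad_le hβ hγ A
  obtain ⟨P, hP⟩ := hK.exists_bound_of_continuousOn (continuous_harmProd m c n c').continuousOn
  obtain ⟨M1, hM1⟩ := exists_bound_of_continuous hF.c1 A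
  obtain ⟨M2, hM2⟩ := exists_bound_of_continuous hF.c11 A
  obtain ⟨M3, hM3⟩ := exists_bound_of_continuous hF.c2 A
  obtain ⟨M4, hM4⟩ := exists_bound_of_continuous hF.c22 A
  set M := max (max M1 M2) (max M3 M4) with hM
  set C := |P| * (M * (4 * (m + 2) / β + 4 * A) + M * (4 * (n + 2) / γ + 4 * A)) with hC
  have hint : Integrable (indicator {p | rad β γ p ≤ A}
      (fun p => ‖wt β p.1 * wt γ p.2 * u p‖ * C)) := by
    have h1 := (hG.locallyIntegrable_wt_mul hβ hγ).integrableOn_isCompact hK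
    exact (integrable_indicator_iff hK.measurableSet).2 (h1.norm.mul_const C)
  have hlim := tendsto_integral_filter_of_dominated_convergence (l := atTop) (μ := volume)
    (F := fun j p => u p * (wt γ p.2 * lapFst (profileTest β γ (del j) m c n c' F) p +
      wt β p.1 * lapSnd (profileTest β γ (del j) m c n c' F) p))
    (f := fun p => 4 * (wt β p.1 * wt γ p.2 * (u p * harmProd m c n c' p *
      profileOp (m / β) (n / γ) F1 F11 F2 F22 (coneSq β p.1) (coneSq γ p.2))))
    _ (Eventually.of_forall fun j => ?_) (Eventually.of_forall fun j => ?_) hint ?_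
  · simp only [fun j => hu.integral_mul_lap_eq_zero hβ hβ1 hγ hγ1 (hT j)] at hlim
    have h0 := tendsto_nhds_unique hlim tendsto_const_nhds
    rw [integral_const_mul] at h0
    rw [integral_vol]
    linarith
  · have c1 : ∀ e, AEStronglyMeasurable (dirD e (dirD e (profileTest β γ (del j) m c n c' F))) :=
      fun e => (contDiff_dirD (contDiff_dirD (hT j).1 e) e).continuous.aestronglyMeasurable
    exact hum.mul (((aestronglyMeasurable_wt_snd γ).mul ((c1 _).add (c1 _))).add
      ((aestronglyMeasurable_wt_fst β).mul ((c1 _).add (c1 _))))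
  · filter_upwards [ae_ne_zero] with p hp
    rw [lapFst_profileTest hβ hF (del_pos j), lapSnd_profileTest hγ hF (del_pos j)]
    set s := regSq β (del j) (‖p.1‖ ^ 2) with hs
    set t := regSq γ (del j) (‖p.2‖ ^ 2) with ht
    have hj := (del_pos j).le
    have hs0 : 0 ≤ s := regSq_nonneg (by positivity)
    have ht0 : 0 ≤ t := regSq_nonneg (by positivity)
    have hr : rad β γ p ≤ s + t := rad_le_regSq hβ hγ (del_pos j) p
    by_cases hA : s + t ≤ A
    · rw [indicator_of_mem (show p ∈ {p | rad β γ p ≤ A} from hr.trans hA)]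
      have b0 := hP p (hr.trans hA)
      have b1 := (hM1 s t hs0 ht0 hA).trans (show M1 ≤ M by simp [hM])
      have b2 := (hM2 s t hs0 ht0 hA).trans (show M2 ≤ M by simp [hM])
      have b3 := (hM3 s t hs0 ht0 hA).trans (show M3 ≤ M by simp [hM])
      have b4 := (hM4 s t hs0 ht0 hA).trans (show M4 ≤ M by simp [hM])
      have r1 := abs_regOp_le hβ hβ1 (del_pos j) m hp.1 (by linarith : s ≤ A) b1 b2
      have r2 := abs_regOp_le hγ hγ1 (del_pos j) n hp.2 (by linarith : t ≤ A) b3 b4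
      set R1 := regOp β (del j) m (F1 s t) (F11 s t) p.1
      set R2 := regOp γ (del j) n (F2 s t) (F22 s t) p.2
      have w1 := wt_nonneg β p.1
      have w2 := wt_nonneg γ p.2
      have e : u p * (wt γ p.2 * (harmProd m c n c' p * R1) +
          wt β p.1 * (harmProd m c n c' p * R2)) =
          u p * (harmProd m c n c' p * (wt γ p.2 * R1 + wt β p.1 * R2)) := by ring
      rw [e, norm_mul, norm_mul, norm_mul, Real.norm_of_nonneg (mul_nonneg w1 w2)]
      have r3 : ‖wt γ p.2 * R1 + wt β p.1 * R2‖ ≤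
          wt γ p.2 * (M * (4 * (m + 2) / β + 4 * A) * wt β p.1) +
          wt β p.1 * (M * (4 * (n + 2) / γ + 4 * A) * wt γ p.2) := by
        refine (norm_add_le _ _).trans ?_
        rw [norm_mul, norm_mul, Real.norm_of_nonneg w1, Real.norm_of_nonneg w2]
        exact add_le_add (mul_le_mul_of_nonneg_left r1 w2) (mul_le_mul_of_nonneg_left r2 w1)
      calc ‖u p‖ * (‖harmProd m c n c' p‖ * ‖wt γ p.2 * R1 + wt β p.1 * R2‖)
          ≤ ‖u p‖ * (|P| * (wt γ p.2 * (M * (4 * (m + 2) / β + 4 * A) * wt β p.1) +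
          wt β p.1 * (M * (4 * (n + 2) / γ + 4 * A) * wt γ p.2))) := by
            gcongr
            exact b0.trans (le_abs_self _)
        _ = _ := by rw [hC]; ring
    -- Here every derivative of the profile vanishes, and the dominating indicator only has to be
    -- nonnegative. At any point where it could be nonzero, A is at least a squared distance, so A ≥
    -- 0.
    · have hA' := not_le.1 hA
      rw [hF.v1 _ _ hA', hF.v11 _ _ hA', hF.v2 _ _ hA', hF.v22 _ _ hA']
      simp only [regOp, zero_mul, add_zero, mul_zero, norm_zero]
      refine indicator_nonneg (fun q hq => ?_) p
      have hAn : 0 ≤ A := (rad_nonneg β γ q).trans hq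
      have hMn : 0 ≤ M := ((abs_nonneg _).trans
        (hM1 0 0 le_rfl le_rfl (by linarith))).trans (by simp [hM])
      positivity
  · filter_upwards [ae_ne_zero] with p hp
    simp only [fun j => lapFst_profileTest (γ := γ) hβ hF (del_pos j) m c n c' p,
      fun j => lapSnd_profileTest (β := β) hγ hF (del_pos j) m c n c' p]
    have t1 := tendsto_regSq (x := ‖p.1‖ ^ 2) hβ tendsto_del
    have t2 := tendsto_regSq (x := ‖p.2‖ ^ 2) hγ tendsto_del
    rw [← coneSq_eq] at t1 t2
    have tt := t1.prodMk_nhds t2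
    have k1 := tendsto_regOp hβ m hp.1 tendsto_del ((hF.c1.tendsto _).comp tt)
      ((hF.c11.tendsto _).comp tt)
    have k2 := tendsto_regOp hγ n hp.2 tendsto_del ((hF.c2.tendsto _).comp tt)
      ((hF.c22.tendsto _).comp tt)
    have k := (((k1.const_mul (harmProd m c n c' p)).const_mul (wt γ p.2)).add
      ((k2.const_mul (harmProd m c n c' p)).const_mul (wt β p.1))).const_mul (u p)
    have e : 4 * (wt β p.1 * wt γ p.2 * (u p * harmProd m c n c' p *
        profileOp (m / β) (n / γ) F1 F11 F2 F22 (coneSq β p.1) (coneSq γ p.2))) =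
        u p * (wt γ p.2 * (harmProd m c n c' p * (4 * wt β p.1 * (coneSq β p.1 *
          F11 (coneSq β p.1) (coneSq γ p.2) + (1 + m / β) * F1 (coneSq β p.1) (coneSq γ p.2)))) +
        wt β p.1 * (harmProd m c n c' p * (4 * wt γ p.2 * (coneSq γ p.2 *
          F22 (coneSq β p.1) (coneSq γ p.2) +
            (1 + n / γ) * F2 (coneSq β p.1) (coneSq γ p.2))))) := by
      simp only [profileOp]; ring
    rw [e]
    exact k

end

/-! ### Integrals of homogeneous functions against radial functions -/

section

variable {β γ : ℝ}

/-- The dilation as a linear map. -/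
noncomputable def dilationLin (β γ t : ℝ) : ℂ × ℂ →ₗ[ℝ] ℂ × ℂ :=
  LinearMap.prodMap ((t ^ (1 / β)) • LinearMap.id) ((t ^ (1 / γ)) • LinearMap.id)

lemma coe_dilationLin (β γ t : ℝ) : ⇑(dilationLin β γ t) = dilation β γ t := by
  ext p <;> simp [dilationLin, dilation]

lemma det_dilationLin {t : ℝ} (ht : 0 < t) :
    LinearMap.det (dilationLin β γ t) = t ^ (2 / β + 2 / γ) := by
  rw [dilationLin, LinearMap.det_prodMap, LinearMap.det_smul, LinearMap.det_smul,
    Complex.finrank_real_complex, LinearMap.det_id, mul_one, mul_one, rpow_div_pow ht,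
    rpow_div_pow ht, Real.rpow_add ht]
  norm_num

lemma measurable_dilation (β γ t : ℝ) : Measurable (dilation β γ t) := by
  unfold dilation; fun_prop

lemma map_dilation {t : ℝ} (ht : 0 < t) : Measure.map (dilation β γ t) volume =
    ENNReal.ofReal (t ^ (-(2 / β + 2 / γ))) • (volume : Measure (ℂ × ℂ)) := by
  have hpos := Real.rpow_pos_of_pos ht (2 / β + 2 / γ)
  have h := Measure.map_linearMap_addHaar_eq_smul_addHaar (volume : Measure (ℂ × ℂ))
    (f := dilationLin β γ t) (by rw [det_dilationLin ht]; exact hpos.ne')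
  rw [coe_dilationLin, det_dilationLin ht, abs_of_pos (inv_pos.2 hpos), ← Real.rpow_neg ht.le] at h
  exact h

lemma measurableEmbedding_dilation {t : ℝ} (ht : 0 < t) :
    MeasurableEmbedding (dilation β γ t) := by
  have h1 := (Real.rpow_pos_of_pos ht (1 / β)).ne'
  have h2 := (Real.rpow_pos_of_pos ht (1 / γ)).ne'
  refine Continuous.measurableEmbedding (by unfold dilation; fun_prop) fun p q h => ?_
  simp only [dilation, Prod.mk.injEq] at h
  exact Prod.ext (mul_left_cancel₀ (by exact_mod_cast h1) h.1)
    (mul_left_cancel₀ (by exact_mod_cast h2) h.2)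

lemma integral_comp_dilation {t : ℝ} (ht : 0 < t) (f : ℂ × ℂ → ℝ) :
    ∫ p, f (dilation β γ t p) = t ^ (-(2 / β + 2 / γ)) * ∫ p, f p := by
  rw [← (measurableEmbedding_dilation ht).integral_map, map_dilation ht, integral_smul_measure,
    ENNReal.toReal_ofReal (Real.rpow_nonneg ht.le _), smul_eq_mul]

lemma wt_rpow_mul {α t : ℝ} (hα : 0 < α) (ht : 0 < t) (z : ℂ) :
    wt α (((t ^ (1 / α) : ℝ) : ℂ) * z) = t ^ (2 - 2 / α) * wt α z := by
  have h := Real.rpow_pos_of_pos ht (1 / α)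
  rw [wt, wt, norm_mul, Complex.norm_real, Real.norm_of_nonneg h.le,
    Real.mul_rpow h.le (norm_nonneg _), ← Real.rpow_mul ht.le]
  congr 2; field_simp

lemma rad_dilation (hβ : 0 < β) (hγ : 0 < γ) {t : ℝ} (ht : 0 < t) (p : ℂ × ℂ) :
    rad β γ (dilation β γ t p) = t ^ 2 * rad β γ p := by
  simp only [rad, dilation, coneSq_rpow_mul hβ ht, coneSq_rpow_mul hγ ht]; ring

lemma measurableSet_rad_lt (hβ : 0 < β) (hγ : 0 < γ) (x : ℝ) :
    MeasurableSet {p | rad β γ p < x} :=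
  (isOpen_lt (continuous_rad hβ hγ) continuous_const).measurableSet

/-- Scaling of the integral of a homogeneous function over balls. -/
lemma IsHomogeneous.setIntegral_rad_lt (hβ : 0 < β) (hγ : 0 < γ) {D : ℝ} {g : ℂ × ℂ → ℝ}
    (hg : IsHomogeneous β γ D g) {x : ℝ} (hx : 0 < x) :
    ∫ p in {p | rad β γ p < x}, g p ∂(vol β γ) =
      x ^ (D / 2 + 2) * ∫ p in {p | rad β γ p < 1}, g p ∂(vol β γ) := by
  have ht : 0 < √x := Real.sqrt_pos.2 hx
  set t := √x with htx
  have htt : t ^ 2 = x := Real.sq_sqrt hx.le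
  have m1 := measurableSet_rad_lt hβ hγ x
  have m2 := measurableSet_rad_lt hβ hγ 1
  rw [setIntegral_vol _ _ _ m1, setIntegral_vol _ _ _ m2, ← integral_indicator m1,
    ← integral_indicator m2]
  have h := integral_comp_dilation (β := β) (γ := γ) ht
    (indicator {p | rad β γ p < x} fun p => wt β p.1 * wt γ p.2 * g p)
  have h2 : ∫ p, indicator {p | rad β γ p < x} (fun p => wt β p.1 * wt γ p.2 * g p)
      (dilation β γ t p) = ∫ p, t ^ (2 - 2 / β) * t ^ (2 - 2 / γ) * t ^ D *
        indicator {p | rad β γ p < 1} (fun p => wt β p.1 * wt γ p.2 * g p) p := by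
    refine integral_congr_ae ?_
    filter_upwards [hg t ht] with p hp
    have e : (dilation β γ t p ∈ {p | rad β γ p < x}) ↔ p ∈ {p | rad β γ p < 1} := by
      simp only [mem_ofPred_eq, rad_dilation hβ hγ ht, htt]
      exact mul_lt_iff_lt_one_right hx
    by_cases hp1 : p ∈ {p | rad β γ p < 1}
    · rw [indicator_of_mem hp1, indicator_of_mem (e.2 hp1), hp]
      simp only [dilation, wt_rpow_mul hβ ht, wt_rpow_mul hγ ht]
      ring
    · rw [indicator_of_notMem hp1, indicator_of_notMem (fun h => hp1 (e.1 h)), mul_zero]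
  rw [h2, integral_const_mul] at h
  have hpos := Real.rpow_pos_of_pos ht (2 / β + 2 / γ)
  rw [Real.rpow_neg ht.le, eq_comm, inv_mul_eq_iff_eq_mul₀ hpos.ne', ← mul_assoc] at h
  rw [h]
  congr 1
  -- The Jacobian 2/β + 2/γ cancels against the scaling of the weights and leaves t^(D+4), where 4
  -- is the dimension of the cone; t² = x halves the exponent.
  rw [← Real.rpow_add ht, ← Real.rpow_add ht, ← Real.rpow_add ht, htx, Real.sqrt_eq_rpow,
    ← Real.rpow_mul hx.le]
  congr 1; ring

/-- There are no boundary terms: Y vanishes at 3 and x^e vanishes at 0. The condition e ≥ 1 also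
keeps x^(e-1) continuous at 0. -/
lemma integral_deriv_mul_rpow {Y Y1 : ℝ → ℝ} (hY : ∀ x, HasDerivAt Y (Y1 x) x)
    (hc : Continuous Y1) (hv : ∀ x, 2 < x → Y x = 0) {e : ℝ} (he : 1 ≤ e) :
    ∫ x in (0 : ℝ)..3, Y1 x * x ^ e = -(e * ∫ x in (0 : ℝ)..3, Y x * x ^ (e - 1)) := by
  have h := intervalIntegral.integral_mul_deriv_eq_deriv_mul (a := 0) (b := 3)
    (u := fun x : ℝ => x ^ e) (u' := fun x => e * x ^ (e - 1)) (v := Y) (v' := Y1)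
    (fun x _ => Real.hasDerivAt_rpow_const (Or.inr he)) (fun x _ => hY x)
    ((continuous_const.mul (Real.continuous_rpow_const (by linarith))).intervalIntegrable _ _)
    (hc.intervalIntegrable _ _)
  rw [hv 3 (by norm_num), Real.zero_rpow (by linarith), zero_mul, mul_zero, sub_zero, zero_sub] at h
  rw [← intervalIntegral.integral_const_mul]
  calc ∫ x in (0 : ℝ)..3, Y1 x * x ^ e = ∫ x in (0 : ℝ)..3, x ^ e * Y1 x := by
        congr 1; ext x; ring
    _ = _ := h
    _ = _ := by congr 2; ext x; ring

/-- Integrals of a homogeneous function against radial functions. -/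
lemma IsHomogeneous.integral_mul_radial (hβ : 0 < β) (hγ : 0 < γ) {D : ℝ} (hD : 0 ≤ D)
    {g : ℂ × ℂ → ℝ} (hg : IsHomogeneous β γ D g) (hgi : LocallyIntegrable g (vol β γ))
    {Y Y1 : ℝ → ℝ} (hY : ∀ x, HasDerivAt Y (Y1 x) x) (hc : Continuous Y1)
    (hv : ∀ x, 2 < x → Y x = 0) :
    ∫ p, g p * Y (rad β γ p) ∂(vol β γ) =
      (D / 2 + 2) * (∫ p in {p | rad β γ p < 1}, g p ∂(vol β γ)) *
        ∫ x in (0 : ℝ)..3, Y x * x ^ (D / 2 + 2 - 1) := by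
  set W := ∫ p in {p | rad β γ p < 1}, g p ∂(vol β γ)
  set S := {p : ℂ × ℂ | rad β γ p < 3} with hS
  have mS : MeasurableSet S := measurableSet_rad_lt hβ hγ 3
  have gS : IntegrableOn g S (vol β γ) :=
    (hgi.integrableOn_isCompact (isCompact_rad_le hβ hγ 3)).mono_set
      fun p hp => (show rad β γ p < 3 from hp).le
  have hYc : Continuous Y := continuous_iff_continuousAt.2 fun x => (hY x).continuousAt
  have e1 : ∫ p, g p * Y (rad β γ p) ∂(vol β γ) = ∫ p in S, g p * Y (rad β γ p) ∂(vol β γ) := by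
    rw [setIntegral_eq_integral_of_forall_compl_eq_zero]
    intro p hp
    rw [hv _ (lt_of_lt_of_le (by norm_num) (not_lt.1 hp)), mul_zero]
  have : SFinite (vol β γ) := by unfold vol; infer_instance
  have hI : Integrable (fun q : (ℂ × ℂ) × ℝ => g q.1 *
      indicator {q : (ℂ × ℂ) × ℝ | rad β γ q.1 < q.2} (fun q => Y1 q.2) q)
      (((vol β γ).restrict S).prod (volume.restrict (Ioc 0 3))) := by
    have h1 : Integrable (fun q : (ℂ × ℂ) × ℝ => g q.1 * Y1 q.2)
        (((vol β γ).restrict S).prod (volume.restrict (Ioc 0 3))) :=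
      Integrable.mul_prod gS (hc.integrableOn_Ioc)
    have hm : MeasurableSet {q : (ℂ × ℂ) × ℝ | rad β γ q.1 < q.2} :=
      measurableSet_lt ((continuous_rad hβ hγ).measurable.comp measurable_fst) measurable_snd
    refine (h1.indicator hm).congr (ae_of_all _ fun q => ?_)
    by_cases hq : q ∈ {q : (ℂ × ℂ) × ℝ | rad β γ q.1 < q.2}
    · simp only [indicator_of_mem hq]
    · simp only [indicator_of_notMem hq, mul_zero]
  -- Layer-cake argument: Y(ρ) is minus the integral of Y' over (ρ, 3]. Exchanging the integrals
  -- replaces the radial weight by integrals of g over balls, which homogeneity evaluates.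
  have hsw := integral_integral_swap (f := fun p x => g p *
      indicator {q : (ℂ × ℂ) × ℝ | rad β γ q.1 < q.2} (fun q => Y1 q.2) (p, x)) hI
  have inner1 : ∀ p ∈ S, ∫ x in Ioc (0 : ℝ) 3, g p *
      indicator {q : (ℂ × ℂ) × ℝ | rad β γ q.1 < q.2} (fun q => Y1 q.2) (p, x) =
      -(g p * Y (rad β γ p)) := by
    intro p hp
    have h0 := rad_nonneg β γ p
    have hp' : rad β γ p < 3 := hp
    rw [integral_const_mul]
    have h1 : ∫ x in Ioc (0 : ℝ) 3, indicator {q : (ℂ × ℂ) × ℝ | rad β γ q.1 < q.2}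
        (fun q => Y1 q.2) (p, x) = ∫ x in Ioc (0 : ℝ) 3, indicator (Ioi (rad β γ p)) Y1 x := rfl
    have h2 : Ioc 0 3 ∩ Ioi (rad β γ p) = Ioc (rad β γ p) 3 := by
      ext x; simp only [mem_inter_iff, mem_Ioc, mem_Ioi]
      constructor
      · rintro ⟨⟨_, h⟩, h'⟩; exact ⟨h', h⟩
      · rintro ⟨h, h'⟩; exact ⟨⟨by linarith, h'⟩, h⟩
    rw [h1, setIntegral_indicator measurableSet_Ioi, h2, ← intervalIntegral.integral_of_le hp'.le,
      intervalIntegral.integral_eq_sub_of_hasDerivAt (fun x _ => hY x)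
        (hc.intervalIntegrable _ _), hv 3 (by norm_num)]
    ring
  have inner2 : ∀ x ∈ Ioc (0 : ℝ) 3, ∫ p in S, g p *
      indicator {q : (ℂ × ℂ) × ℝ | rad β γ q.1 < q.2} (fun q => Y1 q.2) (p, x) ∂(vol β γ) =
      W * (Y1 x * x ^ (D / 2 + 2)) := by
    intro x hx
    have h1 : ∀ p, g p * indicator {q : (ℂ × ℂ) × ℝ | rad β γ q.1 < q.2} (fun q => Y1 q.2) (p, x) =
        indicator {p | rad β γ p < x} (fun p => g p * Y1 x) p := by
      intro p
      by_cases hp : rad β γ p < x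
      · rw [indicator_of_mem (show (p, x) ∈ {q : (ℂ × ℂ) × ℝ | rad β γ q.1 < q.2} from hp),
          indicator_of_mem (show p ∈ {p | rad β γ p < x} from hp)]
      · rw [indicator_of_notMem (show (p, x) ∉ {q : (ℂ × ℂ) × ℝ | rad β γ q.1 < q.2} from hp),
          indicator_of_notMem (show p ∉ {p | rad β γ p < x} from hp), mul_zero]
    have h2 : S ∩ {p | rad β γ p < x} = {p | rad β γ p < x} :=
      inter_eq_right.2 fun p (hp : _ < _) => lt_of_lt_of_le hp hx.2
    simp only [h1]
    rw [setIntegral_indicator (measurableSet_rad_lt hβ hγ x), h2, integral_mul_const,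
      hg.setIntegral_rad_lt hβ hγ hx.1]
    ring
  -- A one-dimensional integration by parts moves the derivative off Y again and brings out the
  -- factor D/2 + 2.
  rw [setIntegral_congr_fun mS inner1, setIntegral_congr_fun measurableSet_Ioc inner2,
    integral_neg, integral_const_mul, ← intervalIntegral.integral_of_le (by norm_num),
    integral_deriv_mul_rpow hY hc hv (by linarith)] at hsw
  rw [e1]
  linarith

end

/-! ### Radial cutoffs -/

/-- A smooth cutoff, positive exactly on `(-∞, 2)`. -/
noncomputable def cutoff (x : ℝ) : ℝ := Real.smoothTransition (2 - x)

lemma contDiff_cutoff : ContDiff ℝ (⊤ : ℕ∞) cutoff :=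
  Real.smoothTransition.contDiff.comp (contDiff_const.sub contDiff_id)

lemma cutoff_eq_zero {x : ℝ} (hx : 2 < x) : cutoff x = 0 :=
  Real.smoothTransition.zero_of_nonpos (by linarith)

lemma cutoff_pos {x : ℝ} (hx : x < 2) : 0 < cutoff x :=
  Real.smoothTransition.pos_of_pos (by linarith)

lemma cutoff_nonneg (x : ℝ) : 0 ≤ cutoff x := Real.smoothTransition.nonneg _

lemma contDiff_deriv {f : ℝ → ℝ} (h : ContDiff ℝ (⊤ : ℕ∞) f) : ContDiff ℝ (⊤ : ℕ∞) (deriv f) :=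
  (contDiff_infty_iff_deriv.1 h).2

lemma deriv_eq_zero_of_forall_gt {f : ℝ → ℝ} {a : ℝ} (h : ∀ x, a < x → f x = 0) {x : ℝ}
    (hx : a < x) : deriv f x = 0 := by
  have : f =ᶠ[𝓝 x] fun _ => 0 := by
    filter_upwards [lt_mem_nhds hx] with y hy using h y hy
  rw [this.deriv_eq]; simp

lemma hasDerivAt_deriv {f : ℝ → ℝ} (h : ContDiff ℝ (⊤ : ℕ∞) f) (x : ℝ) :
    HasDerivAt f (deriv f x) x := (h.differentiable (by simp) x).hasDerivAt

lemma integral_cutoff_pos {e : ℝ} (he : 0 ≤ e) :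
    0 < ∫ x in (0 : ℝ)..3, cutoff x * x ^ e := by
  have hc : Continuous fun x : ℝ => cutoff x * x ^ e :=
    contDiff_cutoff.continuous.mul (Real.continuous_rpow_const he)
  refine intervalIntegral.integral_pos (by norm_num) hc.continuousOn (fun x hx => ?_)
    ⟨1, by norm_num, ?_⟩
  · exact mul_nonneg (cutoff_nonneg x) (Real.rpow_nonneg hx.1.le _)
  · exact mul_pos (cutoff_pos (by norm_num)) (by simp)

/-- The strict sign matters: this integral is a factor that has to be cancelled from the moment
recursion. -/
lemma integral_deriv_cutoff_neg {e : ℝ} (he : 1 ≤ e) :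
    ∫ x in (0 : ℝ)..3, deriv cutoff x * x ^ e < 0 := by
  rw [integral_deriv_mul_rpow (hasDerivAt_deriv contDiff_cutoff)
    (contDiff_deriv contDiff_cutoff).continuous (fun x => cutoff_eq_zero) he]
  have := integral_cutoff_pos (e := e - 1) (by linarith)
  have := mul_pos (by linarith : 0 < e) this
  linarith

/-! ### Monomial profiles -/

/-- A first derivative of `s^k X(s + t)`. -/
noncomputable def prof1 (k : ℕ) (X : ℝ → ℝ) (s t : ℝ) : ℝ :=
  k * s ^ (k - 1) * X (s + t) + s ^ k * deriv X (s + t)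

/-- A second derivative of `s^k X(s + t)`. -/
noncomputable def prof2 (k : ℕ) (X : ℝ → ℝ) (s t : ℝ) : ℝ :=
  k * (((k - 1 : ℕ) : ℝ) * s ^ (k - 1 - 1)) * X (s + t) +
    2 * (k * s ^ (k - 1)) * deriv X (s + t) + s ^ k * deriv (deriv X) (s + t)

lemma hasDerivAt_comp_add {X : ℝ → ℝ} (hX : ContDiff ℝ (⊤ : ℕ∞) X) (s t : ℝ) :
    HasDerivAt (fun s => X (s + t)) (deriv X (s + t)) s :=
  (hasDerivAt_deriv hX (s + t)).comp_add_const s t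

lemma hasDerivAt_prof0 {X : ℝ → ℝ} (hX : ContDiff ℝ (⊤ : ℕ∞) X) (k : ℕ) (s t : ℝ) :
    HasDerivAt (fun s => s ^ k * X (s + t)) (prof1 k X s t) s :=
  (hasDerivAt_pow k s).mul (hasDerivAt_comp_add hX s t)

lemma hasDerivAt_prof1 {X : ℝ → ℝ} (hX : ContDiff ℝ (⊤ : ℕ∞) X) (k : ℕ) (s t : ℝ) :
    HasDerivAt (fun s => prof1 k X s t) (prof2 k X s t) s := by
  have h1 := ((hasDerivAt_pow (k - 1) s).const_mul (k : ℝ)).mul (hasDerivAt_comp_add hX s t)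
  have h2 := (hasDerivAt_pow k s).mul (hasDerivAt_comp_add (contDiff_deriv hX) s t)
  refine (h1.add h2).congr_deriv ?_
  simp only [prof2]; ring

lemma isProfile_monomial {X : ℝ → ℝ} (hX : ContDiff ℝ (⊤ : ℕ∞) X) (hv : ∀ x, 2 < x → X x = 0)
    (k l : ℕ) : IsProfile 2 (fun s t => s ^ k * t ^ l * X (s + t))
      (fun s t => t ^ l * prof1 k X s t) (fun s t => t ^ l * prof2 k X s t)
      (fun s t => s ^ k * prof1 l X t s) (fun s t => s ^ k * prof2 l X t s) := by
  have h0 := hX.continuous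
  have h1 := (contDiff_deriv hX).continuous
  have h2 := (contDiff_deriv (contDiff_deriv hX)).continuous
  have v1 : ∀ x, 2 < x → deriv X x = 0 := fun x => deriv_eq_zero_of_forall_gt hv
  have v2 : ∀ x, 2 < x → deriv (deriv X) x = 0 := fun x => deriv_eq_zero_of_forall_gt v1
  refine ⟨?_, fun s t => ?_, fun s t => ?_, fun s t => ?_, fun s t => ?_, ?_, ?_, ?_, ?_,
    fun s t h => ?_, fun s t h => ?_, fun s t h => ?_, fun s t h => ?_, fun s t h => ?_⟩
  · exact ((contDiff_fst.pow k).mul (contDiff_snd.pow l)).mul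
      (hX.comp (contDiff_fst.add contDiff_snd))
  · refine ((hasDerivAt_prof0 hX k s t).const_mul (t ^ l)).congr_of_eventuallyEq
      (Eventually.of_forall fun x => ?_)
    ring
  · exact (hasDerivAt_prof1 hX k s t).const_mul (t ^ l)
  · refine ((hasDerivAt_prof0 hX l t s).const_mul (s ^ k)).congr_of_eventuallyEq
      (Eventually.of_forall fun x => ?_)
    simp only [add_comm x s]; ring
  · exact (hasDerivAt_prof1 hX l t s).const_mul (s ^ k)
  · unfold prof1; fun_prop
  · unfold prof2; fun_prop
  · unfold prof1; fun_prop
  · unfold prof2; fun_prop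
  · rw [hv _ h, mul_zero]
  · rw [prof1, hv _ h, v1 _ h]; ring
  · rw [prof2, hv _ h, v1 _ h, v2 _ h]; ring
  · rw [add_comm] at h; rw [prof1, hv _ h, v1 _ h]; ring
  · rw [add_comm] at h; rw [prof2, hv _ h, v1 _ h, v2 _ h]; ring

/-- The factor k makes the truncated exponent k - 1 harmless at k = 0. -/
lemma mul_pow_pred (k : ℕ) (s : ℝ) : (k : ℝ) * s ^ (k - 1) * s = k * s ^ k := by
  rcases k with _ | k
  · simp
  · simp only [Nat.add_sub_cancel, pow_succ]; ring

lemma mul_pow_pred_pred (k : ℕ) (s : ℝ) :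
    (k : ℝ) * (((k - 1 : ℕ) : ℝ) * s ^ (k - 1 - 1)) * s = k * (k - 1) * s ^ (k - 1) := by
  rcases k with _ | k
  · simp
  · have := mul_pow_pred k s
    simp only [Nat.add_sub_cancel]
    push_cast
    linear_combination ((k : ℝ) + 1) * this

/-- The operator lowers k or l by one while leaving X alone, or preserves the monomial and acts on X
by a radial operator. This triangular shape is the source of the moment recursion. -/
lemma profileOp_monomial (X : ℝ → ℝ) (k l : ℕ) (μ ν s t : ℝ) :
    profileOp μ ν (fun s t => t ^ l * prof1 k X s t) (fun s t => t ^ l * prof2 k X s t)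
      (fun s t => s ^ k * prof1 l X t s) (fun s t => s ^ k * prof2 l X t s) s t =
    k * (k + μ) * (s ^ (k - 1) * t ^ l * X (s + t)) +
      l * (l + ν) * (s ^ k * t ^ (l - 1) * X (s + t)) +
      s ^ k * t ^ l * ((s + t) * deriv (deriv X) (s + t) +
        (2 * (k + l) + 2 + μ + ν) * deriv X (s + t)) := by
  simp only [profileOp, prof1, prof2, add_comm t s]
  linear_combination (t ^ l * X (s + t)) * mul_pow_pred_pred k s +
    (s ^ k * X (s + t)) * mul_pow_pred_pred l t +
    2 * t ^ l * deriv X (s + t) * mul_pow_pred k s + 2 * s ^ k * deriv X (s + t) * mul_pow_pred l t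

/-! ### Moments of a homogeneous harmonic function -/

section

variable {β γ d : ℝ} {u : ℂ × ℂ → ℝ}

/-- The integrand of the moments. -/
noncomputable def momentFun (β γ : ℝ) (u : ℂ × ℂ → ℝ) (m : ℕ) (c : ℂ) (n : ℕ) (c' : ℂ) (k l : ℕ)
    (p : ℂ × ℂ) : ℝ := u p * harmProd m c n c' p * (coneSq β p.1 ^ k * coneSq γ p.2 ^ l)

/-- The moments of `u` on the unit ball. -/
noncomputable def moment (β γ : ℝ) (u : ℂ × ℂ → ℝ) (m : ℕ) (c : ℂ) (n : ℕ) (c' : ℂ) (k l : ℕ) : ℝ :=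
  ∫ p in {p | rad β γ p < 1}, momentFun β γ u m c n c' k l p ∂(vol β γ)

lemma isHomogeneous_momentFun (hβ : 0 < β) (hγ : 0 < γ) (hu : IsHomogeneous β γ d u) (m : ℕ) (c : ℂ)
    (n : ℕ) (c' : ℂ) (k l : ℕ) : IsHomogeneous β γ (d + (m / β + n / γ) + 2 * (k + l))
      (momentFun β γ u m c n c' k l) := fun t ht => by
  filter_upwards [hu t ht] with p hp
  have e : t ^ (2 * ((k : ℝ) + l)) = (t ^ 2) ^ k * (t ^ 2) ^ l := by
    rw [← pow_mul, ← pow_mul, ← pow_add, ← Real.rpow_natCast]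
    congr 1; push_cast; ring
  have h1 : coneSq β (dilation β γ t p).1 = t ^ 2 * coneSq β p.1 := coneSq_rpow_mul hβ ht _
  have h2 : coneSq γ (dilation β γ t p).2 = t ^ 2 * coneSq γ p.2 := coneSq_rpow_mul hγ ht _
  rw [momentFun, hp, harmProd_dilation ht, h1, h2, momentFun]
  simp only [Real.rpow_add ht, e]
  ring

lemma locallyIntegrable_vol_mul (hu : LocallyIntegrable u (vol β γ)) {f : ℂ × ℂ → ℝ}
    (hf : Continuous f) : LocallyIntegrable (fun p => u p * f p) (vol β γ) := by
  rw [locallyIntegrable_iff] at hu ⊢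
  exact fun K hK => (hu K hK).mul_continuousOn hf.continuousOn hK

lemma continuous_coneSq_pow_mul (hβ : 0 < β) (hγ : 0 < γ) (k l : ℕ) :
    Continuous fun p : ℂ × ℂ => coneSq β p.1 ^ k * coneSq γ p.2 ^ l :=
  (((continuous_coneSq hβ).comp continuous_fst).pow k).mul
    (((continuous_coneSq hγ).comp continuous_snd).pow l)

lemma locallyIntegrable_momentFun (hβ : 0 < β) (hγ : 0 < γ) (hu : LocallyIntegrable u (vol β γ))
    (m : ℕ) (c : ℂ) (n : ℕ) (c' : ℂ) (k l : ℕ) :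
    LocallyIntegrable (momentFun β γ u m c n c' k l) (vol β γ) :=
  locallyIntegrable_vol_mul (locallyIntegrable_vol_mul hu (continuous_harmProd m c n c'))
    (continuous_coneSq_pow_mul hβ hγ k l)

lemma integrable_mul_radial (hβ : 0 < β) (hγ : 0 < γ) {g : ℂ × ℂ → ℝ}
    (hg : LocallyIntegrable g (vol β γ)) {Y : ℝ → ℝ} (hY : Continuous Y)
    (hv : ∀ x, 2 < x → Y x = 0) : Integrable (fun p => g p * Y (rad β γ p)) (vol β γ) :=
  hg.integrable_smul_right_of_hasCompactSupport (hY.comp (continuous_rad hβ hγ))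
    (HasCompactSupport.intro (isCompact_rad_le hβ hγ 2) fun _ hp => hv _ (not_le.1 hp))

lemma IsHarmonic.locallyIntegrable_vol (hβ : 0 < β) (hγ : 0 < γ) (hu : IsHarmonic β γ u) :
    LocallyIntegrable u (vol β γ) := by
  obtain ⟨G, hG, -⟩ := hu
  exact locallyIntegrable_vol_iff.2 (hG.locallyIntegrable_wt_mul hβ hγ)

lemma cutoff_deriv_facts :
    (∀ x, 2 < x → deriv cutoff x = 0) ∧ (∀ x, 2 < x → deriv (deriv cutoff) x = 0) :=
  have h := fun x => deriv_eq_zero_of_forall_gt (x := x) fun _ => cutoff_eq_zero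
  ⟨h, fun _ => deriv_eq_zero_of_forall_gt h⟩

lemma integral_momentFun_mul_eq_zero (hβ : 0 < β) (hγ : 0 < γ) (hd : 0 ≤ d)
    (hu : LocallyIntegrable u (vol β γ)) (hh : IsHomogeneous β γ d u) {m : ℕ} {c : ℂ}
    {n : ℕ} {c' : ℂ} {k l : ℕ} (h0 : moment β γ u m c n c' k l = 0) {Y : ℝ → ℝ}
    (hY : ContDiff ℝ (⊤ : ℕ∞) Y) (hv : ∀ x, 2 < x → Y x = 0) :
    ∫ p, momentFun β γ u m c n c' k l p * Y (rad β γ p) ∂(vol β γ) = 0 := by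
  rw [(isHomogeneous_momentFun hβ hγ hh m c n c' k l).integral_mul_radial hβ hγ (by positivity)
    (locallyIntegrable_momentFun hβ hγ hu m c n c' k l) (hasDerivAt_deriv hY)
    (contDiff_deriv hY).continuous hv]
  change _ * moment β γ u m c n c' k l * _ = 0
  rw [h0]; ring

lemma integral_add_three {μ : Measure (ℂ × ℂ)} {f₁ f₂ f₃ : ℂ × ℂ → ℝ} (h₁ : Integrable f₁ μ)
    (h₂ : Integrable f₂ μ) (h₃ : Integrable f₃ μ) :
    ∫ p, (f₁ p + f₂ p + f₃ p) ∂μ = (∫ p, f₁ p ∂μ) + (∫ p, f₂ p ∂μ) + ∫ p, f₃ p ∂μ := by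
  rw [integral_add (f := fun p => f₁ p + f₂ p) (h₁.add h₂) h₃, integral_add h₁ h₂]

/-- The recursion for the moments. -/
lemma moment_eq_zero_of_pred (hβ : 0 < β) (hβ1 : β ≤ 1) (hγ : 0 < γ) (hγ1 : γ ≤ 1) (hd : 0 ≤ d)
    (hu : IsHarmonic β γ u) (hh : IsHomogeneous β γ d u) (m : ℕ) (c : ℂ) (n : ℕ) (c' : ℂ)
    (k l : ℕ) (hk : k ≠ 0 → moment β γ u m c n c' (k - 1) l = 0)
    (hl : l ≠ 0 → moment β γ u m c n c' k (l - 1) = 0)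
    (hne : (k : ℝ) + l + (m / β + n / γ - d) / 2 ≠ 0) : moment β γ u m c n c' k l = 0 := by
  have hul := hu.locallyIntegrable_vol hβ hγ
  obtain ⟨v1, v2⟩ := cutoff_deriv_facts
  have s0 := contDiff_cutoff
  have s1 := contDiff_deriv s0
  have s2 := contDiff_deriv s1
  set μ := (m : ℝ) / β with hμ
  set ν := (n : ℝ) / γ with hν
  set b : ℝ := 2 * (k + l) + 2 + μ + ν with hb
  -- This is the radial operator that multiplies the undiminished monomial s^k t^l.
  set Y : ℝ → ℝ := fun x => x * deriv (deriv cutoff) x + b * deriv cutoff x with hYdef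
  have hY : ContDiff ℝ (⊤ : ℕ∞) Y := (contDiff_id.mul s2).add (contDiff_const.mul s1)
  have hYv : ∀ x, 2 < x → Y x = 0 := fun x hx => by simp only [hYdef, v1 x hx, v2 x hx]; ring
  have h := hu.integral_profile_eq_zero hβ hβ1 hγ hγ1
    (isProfile_monomial s0 (fun x => cutoff_eq_zero) k l) m c n c'
  have e : ∀ p, u p * harmProd m c n c' p * profileOp (m / β) (n / γ)
      (fun s t => t ^ l * prof1 k cutoff s t) (fun s t => t ^ l * prof2 k cutoff s t)
      (fun s t => s ^ k * prof1 l cutoff t s) (fun s t => s ^ k * prof2 l cutoff t s)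
      (coneSq β p.1) (coneSq γ p.2) =
      (k * (k + μ)) * (momentFun β γ u m c n c' (k - 1) l p * cutoff (rad β γ p)) +
      (l * (l + ν)) * (momentFun β γ u m c n c' k (l - 1) p * cutoff (rad β γ p)) +
      momentFun β γ u m c n c' k l p * Y (rad β γ p) := by
    intro p
    rw [profileOp_monomial]
    simp only [momentFun, hYdef, rad]
    ring
  simp only [e] at h
  have i1 := fun k l => integrable_mul_radial hβ hγ
    (locallyIntegrable_momentFun hβ hγ hul m c n c' k l) s0.continuous (fun x => cutoff_eq_zero)
  have i2 := integrable_mul_radial hβ hγ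
    (locallyIntegrable_momentFun hβ hγ hul m c n c' k l) hY.continuous hYv
  -- At k = 0 the truncated index k - 1 refers to no lower moment, but the coefficient is then zero.
  have z1 : (k * (k + μ)) * ∫ p, momentFun β γ u m c n c' (k - 1) l p * cutoff (rad β γ p)
      ∂(vol β γ) = 0 := by
    by_cases hk0 : k = 0
    · simp [hk0]
    · rw [integral_momentFun_mul_eq_zero hβ hγ hd hul hh (hk hk0) s0 (fun x => cutoff_eq_zero),
        mul_zero]
  have z2 : (l * (l + ν)) * ∫ p, momentFun β γ u m c n c' k (l - 1) p * cutoff (rad β γ p)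
      ∂(vol β γ) = 0 := by
    by_cases hl0 : l = 0
    · simp [hl0]
    · rw [integral_momentFun_mul_eq_zero hβ hγ hd hul hh (hl hl0) s0 (fun x => cutoff_eq_zero),
        mul_zero]
  rw [integral_add_three ((i1 _ _).const_mul _) ((i1 _ _).const_mul _) i2, integral_const_mul,
    integral_const_mul, z1, z2, (isHomogeneous_momentFun hβ hγ hh m c n c' k l).integral_mul_radial
      hβ hγ (by positivity) (locallyIntegrable_momentFun hβ hγ hul m c n c' k l)
      (hasDerivAt_deriv hY) (contDiff_deriv hY).continuous hYv] at h
  change 0 + 0 + _ * moment β γ u m c n c' k l * _ = 0 at h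
  set e' : ℝ := (d + (μ + ν) + 2 * (k + l)) / 2 + 2 with he'
  have hμ0 : 0 ≤ μ := by positivity
  have hν0 : 0 ≤ ν := by positivity
  have he1 : 2 ≤ e' := by
      rw [he']
      linarith [show (0 : ℝ) ≤ (d + (μ + ν) + 2 * (k + l)) / 2 by positivity]
  have J := integral_deriv_cutoff_neg (e := e' - 1) (by linarith)
  have hJ2 := integral_deriv_mul_rpow (hasDerivAt_deriv s1) s2.continuous v1 (e := e') (by linarith)
  -- Integrating x X'' by parts against x^(e'-1) contributes -e', so Y reduces to a multiple of X'
  -- and the factor b - e' decides the recursion.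
  have hInt : ∫ x in (0 : ℝ)..3, Y x * x ^ (e' - 1) =
      (b - e') * ∫ x in (0 : ℝ)..3, deriv cutoff x * x ^ (e' - 1) := by
    have h1 : ∀ x ∈ uIcc (0 : ℝ) 3, Y x * x ^ (e' - 1) =
        deriv (deriv cutoff) x * x ^ e' + b * (deriv cutoff x * x ^ (e' - 1)) := by
      intro x hx
      rw [uIcc_of_le (by norm_num)] at hx
      have : x ^ e' = x * x ^ (e' - 1) := by
        rw [← Real.rpow_one_add' hx.1 (by linarith)]; congr 1; ring
      rw [this]; simp only [hYdef]; ring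
    have c1 : Continuous fun x : ℝ => deriv (deriv cutoff) x * x ^ e' :=
      s2.continuous.mul (Real.continuous_rpow_const (by linarith))
    have c2 : Continuous fun x : ℝ => b * (deriv cutoff x * x ^ (e' - 1)) :=
      continuous_const.mul (s1.continuous.mul (Real.continuous_rpow_const (by linarith)))
    rw [intervalIntegral.integral_congr h1, intervalIntegral.integral_add
      (c1.intervalIntegrable _ _) (c2.intervalIntegrable _ _),
      intervalIntegral.integral_const_mul, hJ2]
    ring
  rw [hInt] at h
  have hbe : b - e' = (k : ℝ) + l + (μ + ν - d) / 2 := by rw [hb, he']; ring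
  rw [hbe, zero_add, zero_add, mul_eq_zero, mul_eq_zero, mul_eq_zero] at h
  rcases h with (h | h) | h | h
  · linarith
  · exact h
  · exact absurd h hne
  · exact absurd h J.ne

/-- Since s + t is itself radial, the factor s + t can be moved into the cutoff, and the sum becomes
a radial integral governed by the moment with k = l = 0. Harmonicity plays no part. -/
lemma moment_one_zero_add (hβ : 0 < β) (hγ : 0 < γ) (hd : 0 ≤ d)
    (hu : LocallyIntegrable u (vol β γ)) (hh : IsHomogeneous β γ d u) {m : ℕ} {c : ℂ}
    {n : ℕ} {c' : ℂ} (h0 : moment β γ u m c n c' 0 0 = 0) :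
    moment β γ u m c n c' 1 0 + moment β γ u m c n c' 0 1 = 0 := by
  have s0 := contDiff_cutoff
  have h := integral_momentFun_mul_eq_zero hβ hγ hd hu hh h0 (Y := fun x => x * cutoff x)
    (contDiff_id.mul s0) (fun x hx => by simp only [cutoff_eq_zero hx, mul_zero])
  have e : ∀ p, momentFun β γ u m c n c' 0 0 p * (rad β γ p * cutoff (rad β γ p)) =
      momentFun β γ u m c n c' 1 0 p * cutoff (rad β γ p) +
      momentFun β γ u m c n c' 0 1 p * cutoff (rad β γ p) := by
    intro p; simp only [momentFun, rad]; ring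
  have i1 := fun k l => integrable_mul_radial hβ hγ
    (locallyIntegrable_momentFun hβ hγ hu m c n c' k l) s0.continuous (fun x => cutoff_eq_zero)
  have I := fun k l => (isHomogeneous_momentFun hβ hγ hh m c n c' k l).integral_mul_radial hβ hγ
    (by positivity) (locallyIntegrable_momentFun hβ hγ hu m c n c' k l) (hasDerivAt_deriv s0)
    (contDiff_deriv s0).continuous (fun x => cutoff_eq_zero)
  simp only [e] at h
  rw [integral_add (i1 _ _) (i1 _ _), I, I] at h
  change _ * moment β γ u m c n c' 1 0 * _ + _ * moment β γ u m c n c' 0 1 * _ = 0 at h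
  simp only [Nat.cast_one, Nat.cast_zero, add_zero, zero_add, mul_one] at h
  set a : ℝ := (d + (m / β + n / γ) + 2) / 2 + 2
  have ha : 0 ≤ (d + (m / β + n / γ) + 2) / 2 := by positivity
  have J := integral_cutoff_pos (e := a - 1) (by simp only [a]; linarith)
  have h2 : a * (moment β γ u m c n c' 1 0 + moment β γ u m c n c' 0 1) *
      ∫ x in (0 : ℝ)..3, cutoff x * x ^ (a - 1) = 0 := by linear_combination h
  rw [mul_eq_zero, mul_eq_zero] at h2
  rcases h2 with (h2 | h2) | h2
  · simp only [a] at h2; linarith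
  · exact h2
  · exact absurd h2 J.ne'

/-! ### The explicit list -/

lemma one_eq_harmProd : (fun _ : ℂ × ℂ => (1 : ℝ)) = harmProd 0 1 0 1 := by
  ext p; simp [harmProd, harmPoly]

lemma fst_pow_re_eq (m : ℕ) : (fun p : ℂ × ℂ => (p.1 ^ m).re) = harmProd m 1 0 1 := by
  ext p; simp [harmProd, harmPoly]

lemma fst_pow_im_eq (m : ℕ) : (fun p : ℂ × ℂ => (p.1 ^ m).im) = harmProd m (-Complex.I) 0 1 := by
  ext p; simp [harmProd, harmPoly]

lemma snd_pow_re_eq (m : ℕ) : (fun p : ℂ × ℂ => (p.2 ^ m).re) = harmProd 0 1 m 1 := by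
  ext p; simp [harmProd, harmPoly]

lemma snd_pow_im_eq (m : ℕ) : (fun p : ℂ × ℂ => (p.2 ^ m).im) = harmProd 0 1 m (-Complex.I) := by
  ext p; simp [harmProd, harmPoly]

lemma mul_re_eq : (fun p : ℂ × ℂ => (p.1 * p.2).re) =
    harmProd 1 1 1 1 + (-1 : ℝ) • harmProd 1 (-Complex.I) 1 (-Complex.I) := by
  ext p; simp [harmProd, harmPoly]; ring

lemma mul_im_eq : (fun p : ℂ × ℂ => (p.1 * p.2).im) =
    harmProd 1 (-Complex.I) 1 1 + harmProd 1 1 1 (-Complex.I) := by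
  ext p; simp [harmProd, harmPoly]; ring

lemma mul_conj_re_eq : (fun p : ℂ × ℂ => (p.1 * (starRingEnd ℂ) p.2).re) =
    harmProd 1 1 1 1 + harmProd 1 (-Complex.I) 1 (-Complex.I) := by
  ext p; simp [harmProd, harmPoly]

lemma mul_conj_im_eq : (fun p : ℂ × ℂ => (p.1 * (starRingEnd ℂ) p.2).im) =
    harmProd 1 (-Complex.I) 1 1 + (-1 : ℝ) • harmProd 1 1 1 (-Complex.I) := by
  ext p; simp [harmProd, harmPoly]; ring

/-- Harmonic functions, homogeneous of degree `d`, that are continuous. -/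
def IsNice (β γ d : ℝ) (v : ℂ × ℂ → ℝ) : Prop :=
  IsHarmonic β γ v ∧ IsHomogeneous β γ d v ∧ Continuous v

lemma isNice_harmProd (hβ : 0 < β) (hβ1 : β ≤ 1) (hγ : 0 < γ) (hγ1 : γ ≤ 1) (m : ℕ) (c : ℂ) (n : ℕ)
    (c' : ℂ) (hd : m / β + n / γ = d) : IsNice β γ d (harmProd m c n c') :=
  ⟨isHarmonic_harmProd hβ hβ1 hγ hγ1 m c n c', hd ▸ isHomogeneous_harmProd m c n c',
    continuous_harmProd m c n c'⟩

lemma IsNice.add (hβ : 0 < β) (hγ : 0 < γ) {v w : ℂ × ℂ → ℝ} (hv : IsNice β γ d v)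
    (hw : IsNice β γ d w) : IsNice β γ d (v + w) :=
  ⟨hv.1.add hβ hγ hw.1, hv.2.1.add hw.2.1, hv.2.2.add hw.2.2⟩

lemma IsNice.smul {v : ℂ × ℂ → ℝ} (c : ℝ) (hv : IsNice β γ d v) : IsNice β γ d (c • v) :=
  ⟨hv.1.smul c, hv.2.1.smul c, hv.2.2.const_smul c⟩

lemma one_div_le_two {β : ℝ} (h : 1 / 2 ≤ β) : 1 / β ≤ 2 := by
  rw [div_le_iff₀ (by linarith)]; linarith

lemma exists_isNice_of_mem_explicitList (hβ : 0 < β) (hβ1 : β ≤ 1) (hγ : 0 < γ) (hγ1 : γ ≤ 1)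
    {v : ℂ × ℂ → ℝ} (hv : v ∈ explicitList β γ) : ∃ d, 0 ≤ d ∧ d ≤ 2 ∧ IsNice β γ d v := by
  have N := fun d m c n c' => isNice_harmProd (d := d) hβ hβ1 hγ hγ1 m c n c'
  rcases hv with rfl | ⟨h, rfl | rfl⟩ | ⟨rfl, rfl | rfl⟩ | ⟨h, rfl | rfl⟩ | ⟨rfl, rfl | rfl⟩ |
    ⟨rfl, rfl, rfl | rfl⟩ | ⟨rfl, rfl, rfl | rfl⟩ | rfl
  · exact ⟨0, le_rfl, by norm_num, one_eq_harmProd ▸ N _ _ _ _ _ (by simp)⟩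
  · exact ⟨1 / β, by positivity, one_div_le_two h, by
      have := fst_pow_re_eq 1; simp only [pow_one] at this
      exact this ▸ N _ _ _ _ _ (by simp)⟩
  · exact ⟨1 / β, by positivity, one_div_le_two h, by
      have := fst_pow_im_eq 1; simp only [pow_one] at this
      exact this ▸ N _ _ _ _ _ (by simp)⟩
  · exact ⟨2, by norm_num, le_rfl, fst_pow_re_eq 2 ▸ N _ _ _ _ _ (by simp)⟩
  · exact ⟨2, by norm_num, le_rfl, fst_pow_im_eq 2 ▸ N _ _ _ _ _ (by simp)⟩
  · exact ⟨1 / γ, by positivity, one_div_le_two h, by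
      have := snd_pow_re_eq 1; simp only [pow_one] at this
      exact this ▸ N _ _ _ _ _ (by simp)⟩
  · exact ⟨1 / γ, by positivity, one_div_le_two h, by
      have := snd_pow_im_eq 1; simp only [pow_one] at this
      exact this ▸ N _ _ _ _ _ (by simp)⟩
  · exact ⟨2, by norm_num, le_rfl, snd_pow_re_eq 2 ▸ N _ _ _ _ _ (by simp)⟩
  · exact ⟨2, by norm_num, le_rfl, snd_pow_im_eq 2 ▸ N _ _ _ _ _ (by simp)⟩
  · exact ⟨2, by norm_num, le_rfl, mul_re_eq ▸ (N _ _ _ _ _ (by norm_num)).add hβ hγ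
      ((N _ _ _ _ _ (by norm_num)).smul _)⟩
  · exact ⟨2, by norm_num, le_rfl, mul_im_eq ▸ (N _ _ _ _ _ (by norm_num)).add hβ hγ
      (N _ _ _ _ _ (by norm_num))⟩
  · exact ⟨2, by norm_num, le_rfl, mul_conj_re_eq ▸ (N _ _ _ _ _ (by norm_num)).add hβ hγ
      (N _ _ _ _ _ (by norm_num))⟩
  · exact ⟨2, by norm_num, le_rfl, mul_conj_im_eq ▸ (N _ _ _ _ _ (by norm_num)).add hβ hγ
      ((N _ _ _ _ _ (by norm_num)).smul _)⟩
  · exact ⟨2, by norm_num, le_rfl, isHarmonic_quadHarm hβ hβ1 hγ hγ1,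
      isHomogeneous_quadHarm hβ hγ, continuous_quadHarm hβ hγ⟩

/-- The span of the explicit functions that are homogeneous of degree `d`. -/
def explicitSpan (β γ d : ℝ) : Submodule ℝ (ℂ × ℂ → ℝ) :=
  Submodule.span ℝ {v | v ∈ explicitList β γ ∧ IsNice β γ d v}

lemma harmPoly_eq (m : ℕ) (c z : ℂ) :
    harmPoly m c z = c.re * harmPoly m 1 z - c.im * harmPoly m (-Complex.I) z := by
  simp [harmPoly]

lemma harmProd_eq (m : ℕ) (c : ℂ) (n : ℕ) (c' : ℂ) : harmProd m c n c' =
    (c.re * c'.re) • harmProd m 1 n 1 + (-(c.re * c'.im)) • harmProd m 1 n (-Complex.I) +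
      ((-(c.im * c'.re)) • harmProd m (-Complex.I) n 1 +
      (c.im * c'.im) • harmProd m (-Complex.I) n (-Complex.I)) := by
  ext p
  simp only [harmProd, Pi.add_apply, Pi.smul_apply, smul_eq_mul]
  rw [harmPoly_eq m c, harmPoly_eq n c']; ring

lemma harmProd_zero_snd_I (m : ℕ) (c : ℂ) : harmProd m c 0 (-Complex.I) = 0 := by
  ext p; simp [harmProd, harmPoly]

lemma harmProd_zero_fst_I (m : ℕ) (c : ℂ) : harmProd 0 (-Complex.I) m c = 0 := by
  ext p; simp [harmProd, harmPoly]

lemma half_le_of_one_div_le {β : ℝ} (hβ : 0 < β) (h : 1 / β ≤ 2) : 1 / 2 ≤ β := by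
  rw [div_le_iff₀ hβ] at h; linarith

lemma eq_one_of_two_div_le {β : ℝ} (hβ : 0 < β) (hβ1 : β ≤ 1) (h : 2 / β ≤ 2) : β = 1 := by
  rw [div_le_iff₀ hβ] at h; linarith

/-- Harmonic products of degree at most two lie in the explicit span. -/
lemma harmProd_mem_explicitSpan (hβ : 0 < β) (hβ1 : β ≤ 1) (hγ : 0 < γ) (hγ1 : γ ≤ 1) (hd : d ≤ 2)
    {m n : ℕ} (h : m / β + n / γ = d) (c c' : ℂ) : harmProd m c n c' ∈ explicitSpan β γ d := by
  have N := fun c c' => isNice_harmProd (d := d) hβ hβ1 hγ hγ1 m c n c' h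
  have sub : ∀ {v}, v ∈ explicitList β γ → IsNice β γ d v → v ∈ explicitSpan β γ d :=
    fun h1 h2 => Submodule.subset_span ⟨h1, h2⟩
  -- Cone angles of at most 2π raise degrees, so a degree of at most 2 leaves finitely many pairs
  -- (m, n).
  have hm : (m : ℝ) ≤ m / β := by rw [le_div_iff₀ hβ]; nlinarith [(m.cast_nonneg : (0 : ℝ) ≤ m)]
  have hn : (n : ℝ) ≤ n / γ := by rw [le_div_iff₀ hγ]; nlinarith [(n.cast_nonneg : (0 : ℝ) ≤ n)]
  have hmn : m + n ≤ 2 := by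
    have : ((m + n : ℕ) : ℝ) ≤ (2 : ℕ) := by push_cast; linarith
    exact_mod_cast this
  have key : harmProd m 1 n 1 ∈ explicitSpan β γ d ∧
      harmProd m 1 n (-Complex.I) ∈ explicitSpan β γ d ∧
      harmProd m (-Complex.I) n 1 ∈ explicitSpan β γ d ∧
      harmProd m (-Complex.I) n (-Complex.I) ∈ explicitSpan β γ d := by
    have cases : (m = 0 ∧ n = 0) ∨ (m = 1 ∧ n = 0) ∨ (m = 2 ∧ n = 0) ∨ (m = 0 ∧ n = 1) ∨
        (m = 0 ∧ n = 2) ∨ (m = 1 ∧ n = 1) := by omega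
    rcases cases with ⟨rfl, rfl⟩ | ⟨rfl, rfl⟩ | ⟨rfl, rfl⟩ | ⟨rfl, rfl⟩ | ⟨rfl, rfl⟩ | ⟨rfl, rfl⟩
    · simp only [harmProd_zero_snd_I, harmProd_zero_fst_I, zero_mem, and_true]
      exact sub (Or.inl one_eq_harmProd.symm) (N _ _)
    · simp only [harmProd_zero_snd_I, zero_mem, true_and, and_true]
      have hb : 1 / 2 ≤ β := half_le_of_one_div_le hβ (by simp at h ⊢; linarith)
      have e1 := fst_pow_re_eq 1
      have e2 := fst_pow_im_eq 1
      simp only [pow_one] at e1 e2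
      exact ⟨sub (Or.inr (Or.inl ⟨hb, Or.inl e1.symm⟩)) (N _ _),
        sub (Or.inr (Or.inl ⟨hb, Or.inr e2.symm⟩)) (N _ _)⟩
    · simp only [harmProd_zero_snd_I, zero_mem, true_and, and_true]
      have hb : β = 1 := eq_one_of_two_div_le hβ hβ1 (by simp at h ⊢; linarith)
      exact ⟨sub (Or.inr (Or.inr (Or.inl ⟨hb, Or.inl (fst_pow_re_eq 2).symm⟩))) (N _ _),
        sub (Or.inr (Or.inr (Or.inl ⟨hb, Or.inr (fst_pow_im_eq 2).symm⟩))) (N _ _)⟩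
    · simp only [harmProd_zero_fst_I, zero_mem, and_true]
      have hb : 1 / 2 ≤ γ := half_le_of_one_div_le hγ (by simp at h ⊢; linarith)
      have e1 := snd_pow_re_eq 1
      have e2 := snd_pow_im_eq 1
      simp only [pow_one] at e1 e2
      exact ⟨sub (Or.inr (Or.inr (Or.inr (Or.inl ⟨hb, Or.inl e1.symm⟩)))) (N _ _),
        sub (Or.inr (Or.inr (Or.inr (Or.inl ⟨hb, Or.inr e2.symm⟩)))) (N _ _)⟩
    · simp only [harmProd_zero_fst_I, zero_mem, and_true]
      have hb : γ = 1 := eq_one_of_two_div_le hγ hγ1 (by simp at h ⊢; linarith)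
      exact ⟨sub (Or.inr (Or.inr (Or.inr (Or.inr (Or.inl
          ⟨hb, Or.inl (snd_pow_re_eq 2).symm⟩))))) (N _ _),
        sub (Or.inr (Or.inr (Or.inr (Or.inr (Or.inl
          ⟨hb, Or.inr (snd_pow_im_eq 2).symm⟩))))) (N _ _)⟩
    · simp only [Nat.cast_one] at h hm hn
      have hb : β = 1 := by
        have : 1 / β ≤ 1 := by linarith
        rw [div_le_iff₀ hβ] at this; linarith
      have hc : γ = 1 := by
        have : 1 / γ ≤ 1 := by linarith
        rw [div_le_iff₀ hγ] at this; linarith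
      have f1 : harmProd 1 1 1 1 + (-1 : ℝ) • harmProd 1 (-Complex.I) 1 (-Complex.I) ∈
          explicitSpan β γ d := sub (mul_re_eq ▸ Or.inr (Or.inr (Or.inr (Or.inr (Or.inr (Or.inl
          ⟨hb, hc, Or.inl rfl⟩)))))) ((N _ _).add hβ hγ ((N _ _).smul _))
      have f2 : harmProd 1 (-Complex.I) 1 1 + harmProd 1 1 1 (-Complex.I) ∈
          explicitSpan β γ d := sub (mul_im_eq ▸ Or.inr (Or.inr (Or.inr (Or.inr (Or.inr (Or.inl
          ⟨hb, hc, Or.inr rfl⟩)))))) ((N _ _).add hβ hγ (N _ _))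
      have f3 : harmProd 1 1 1 1 + harmProd 1 (-Complex.I) 1 (-Complex.I) ∈
          explicitSpan β γ d := sub (mul_conj_re_eq ▸ Or.inr (Or.inr (Or.inr (Or.inr (Or.inr
          (Or.inr (Or.inl ⟨hb, hc, Or.inl rfl⟩))))))) ((N _ _).add hβ hγ (N _ _))
      have f4 : harmProd 1 (-Complex.I) 1 1 + (-1 : ℝ) • harmProd 1 1 1 (-Complex.I) ∈
          explicitSpan β γ d := sub (mul_conj_im_eq ▸ Or.inr (Or.inr (Or.inr (Or.inr (Or.inr
          (Or.inr (Or.inl ⟨hb, hc, Or.inr rfl⟩))))))) ((N _ _).add hβ hγ ((N _ _).smul _))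
      -- The list contains sums and differences of products of real and imaginary parts; half-sums
      -- and half-differences recover the products themselves.
      have comb : ∀ {a b : ℂ × ℂ → ℝ}, a + (-1 : ℝ) • b ∈ explicitSpan β γ d →
          a + b ∈ explicitSpan β γ d → a ∈ explicitSpan β γ d ∧ b ∈ explicitSpan β γ d := by
        intro a b h1 h2
        have k1 := (explicitSpan β γ d).smul_mem (1 / 2 : ℝ) (add_mem h1 h2)
        have k2 := (explicitSpan β γ d).smul_mem (1 / 2 : ℝ) (sub_mem h2 h1)
        constructor
        · convert k1 using 1; module
        · convert k2 using 1; module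
      have g1 := comb f1 f3
      have g2 := comb f4 f2
      exact ⟨g1.1, g2.2, g2.1, g1.2⟩
  rw [harmProd_eq]
  exact add_mem (add_mem (Submodule.smul_mem _ _ key.1) (Submodule.smul_mem _ _ key.2.1))
    (add_mem (Submodule.smul_mem _ _ key.2.2.1) (Submodule.smul_mem _ _ key.2.2.2))

lemma isNice_zero (hβ : 0 < β) (hβ1 : β ≤ 1) (hγ : 0 < γ) (hγ1 : γ ≤ 1) : IsNice β γ d 0 := by
  refine ⟨?_, fun t _ => ae_of_all _ fun p => by simp, continuous_zero⟩
  have := (isHarmonic_harmProd hβ hβ1 hγ hγ1 0 1 0 1).smul 0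
  rwa [zero_smul] at this

lemma isNice_of_mem_explicitSpan (hβ : 0 < β) (hβ1 : β ≤ 1) (hγ : 0 < γ) (hγ1 : γ ≤ 1)
    {v : ℂ × ℂ → ℝ} (hv : v ∈ explicitSpan β γ d) : IsNice β γ d v := by
  induction hv using Submodule.span_induction with
  | mem v hv => exact hv.2
  | zero => exact isNice_zero hβ hβ1 hγ hγ1
  | add v w _ _ hv hw => exact hv.add hβ hγ hw
  | smul c v _ hv => exact hv.smul c

/-- All moments of a homogeneous harmonic function of degree at most two vanish if it is orthogonal
to the explicit functions of the same degree. -/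
lemma moment_eq_zero (hβ : 0 < β) (hβ1 : β ≤ 1) (hγ : 0 < γ) (hγ1 : γ ≤ 1) (hd : 0 ≤ d)
    (hd2 : d ≤ 2) (hu : IsHarmonic β γ u) (hh : IsHomogeneous β γ d u)
    (horth : ∀ v ∈ explicitSpan β γ d, ∫ p in {p | rad β γ p < 1}, u p * v p ∂(vol β γ) = 0)
    (m : ℕ) (c : ℂ) (n : ℕ) (c' : ℂ) (k l : ℕ) : moment β γ u m c n c' k l = 0 := by
  have hμ0 : 0 ≤ (m : ℝ) / β := by positivity
  have hν0 : 0 ≤ (n : ℝ) / γ := by positivity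
  have hul := hu.locallyIntegrable_vol hβ hγ
  -- Either the harmonic product has the degree of u, and orthogonality applies, or the recursion
  -- factor (μ+ν-d)/2 is nonzero.
  have base : moment β γ u m c n c' 0 0 = 0 := by
    by_cases h : (m : ℝ) / β + n / γ = d
    · simpa [moment, momentFun] using
        horth _ (harmProd_mem_explicitSpan hβ hβ1 hγ hγ1 hd2 h c c')
    · refine moment_eq_zero_of_pred hβ hβ1 hγ hγ1 hd hu hh m c n c' 0 0 (by simp) (by simp) ?_
      intro h'; apply h; push_cast at h'; linarith
  have main : ∀ κ k l, k + l = κ → moment β γ u m c n c' k l = 0 := by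
    intro κ
    induction κ with
    | zero =>
      intro k l hkl
      obtain ⟨rfl, rfl⟩ : k = 0 ∧ l = 0 := by omega
      exact base
    | succ κ ih =>
      intro k l hkl
      by_cases hne : (k : ℝ) + l + (m / β + n / γ - d) / 2 = 0
      · have hkl' : (k : ℝ) + l = κ + 1 := by exact_mod_cast hkl
        have hκ0 : (0 : ℝ) ≤ κ := κ.cast_nonneg
        have hκ : (κ : ℝ) = 0 := by linarith
        have hμ : (m : ℝ) / β = 0 := by linarith
        have hν : (n : ℝ) / γ = 0 := by linarith
        obtain rfl : d = 2 := by linarith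
        obtain rfl : κ = 0 := by exact_mod_cast hκ
        obtain rfl : m = 0 := by
          rcases div_eq_zero_iff.1 hμ with h | h
          · exact_mod_cast h
          · exact absurd h hβ.ne'
        obtain rfl : n = 0 := by
          rcases div_eq_zero_iff.1 hν with h | h
          · exact_mod_cast h
          · exact absurd h hγ.ne'
        have h1 := moment_one_zero_add hβ hγ hd hul hh base
        have hq : quadHarm β γ ∈ explicitSpan β γ 2 := Submodule.subset_span
          ⟨Or.inr (Or.inr (Or.inr (Or.inr (Or.inr (Or.inr (Or.inr rfl)))))),
            isHarmonic_quadHarm hβ hβ1 hγ hγ1, isHomogeneous_quadHarm hβ hγ,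
            continuous_quadHarm hβ hγ⟩
        -- For m = n = 0 the harmonic product is the constant Re c · Re c', so this difference is a
        -- multiple of the pairing with the quadratic harmonic function. With the vanishing of the
        -- sum it determines both moments.
        have h2 : moment β γ u 0 c 0 c' 1 0 - moment β γ u 0 c 0 c' 0 1 = 0 := by
          have i := fun k l => ((locallyIntegrable_momentFun hβ hγ hul 0 c 0 c' k
            l).integrableOn_isCompact (isCompact_rad_le hβ hγ 1)).mono_set
            (fun p hp => (show rad β γ p < 1 from hp).le :
              {p | rad β γ p < 1} ⊆ {p | rad β γ p ≤ 1})
          rw [moment, moment, ← integral_sub (i 1 0) (i 0 1)]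
          have e : ∀ p, momentFun β γ u 0 c 0 c' 1 0 p - momentFun β γ u 0 c 0 c' 0 1 p =
              (c.re * c'.re) * (u p * quadHarm β γ p) := by
            intro p; simp [momentFun, quadHarm, harmProd, harmPoly]; ring
          simp only [e]
          rw [integral_const_mul, horth _ hq, mul_zero]
        have hc : (k = 1 ∧ l = 0) ∨ (k = 0 ∧ l = 1) := by omega
        rcases hc with ⟨rfl, rfl⟩ | ⟨rfl, rfl⟩ <;> linarith
      · exact moment_eq_zero_of_pred hβ hβ1 hγ hγ1 hd hu hh m c n c' k l
          (fun hk => ih _ _ (by omega)) (fun hl => ih _ _ (by omega)) hne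
  exact main _ k l rfl

end

/-! ### Functions with vanishing moments vanish -/

/-- Weierstrass approximation on [0,1]: orthogonality to all powers of s extends to all continuous
functions of s. -/
lemma integral_mul_comp_eq_zero {α : Type*} [MeasurableSpace α] {μ : Measure α} {h s : α → ℝ}
    (hh : Integrable h μ) (hs : AEStronglyMeasurable s μ) (hs01 : ∀ᵐ x ∂μ, s x ∈ Icc (0 : ℝ) 1)
    (h0 : ∀ k : ℕ, ∫ x, h x * s x ^ k ∂μ = 0) {f : ℝ → ℝ} (hf : Continuous f) :
    ∫ x, h x * f (s x) ∂μ = 0 := by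
  have hb : ∀ g : ℝ → ℝ, Continuous g → Integrable (fun x => h x * g (s x)) μ := by
    intro g hg
    obtain ⟨C, hC⟩ := (isCompact_Icc (a := (0 : ℝ)) (b := 1)).exists_bound_of_continuousOn
      hg.continuousOn
    refine hh.mul_bdd (c := C) (hg.comp_aestronglyMeasurable hs) ?_
    filter_upwards [hs01] with x hx using hC _ hx
  have hpoly : ∀ P : Polynomial ℝ, ∫ x, h x * P.eval (s x) ∂μ = 0 := by
    intro P
    simp only [Polynomial.eval_eq_sum_range, Finset.mul_sum]
    rw [integral_finsetSum]
    · refine Finset.sum_eq_zero fun k _ => ?_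
      have : ∀ x, h x * (P.coeff k * s x ^ k) = P.coeff k * (h x * s x ^ k) := fun x => by ring
      simp only [this]
      rw [integral_const_mul, h0, mul_zero]
    · exact fun k _ => hb (fun y => P.coeff k * y ^ k) (by fun_prop)
  by_contra hne
  have hpos : 0 < |∫ x, h x * f (s x) ∂μ| := abs_pos.2 hne
  set I := ∫ x, ‖h x‖ ∂μ with hI
  have hI0 : 0 ≤ I := integral_nonneg fun _ => norm_nonneg _
  -- With this tolerance the value J of the integral satisfies |J| ≤ I|J|/(I+1), which is impossible
  -- for J ≠ 0. The 1 in I + 1 avoids dividing by zero.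
  obtain ⟨P, hP⟩ := exists_polynomial_near_of_continuousOn 0 1 f hf.continuousOn
    (|∫ x, h x * f (s x) ∂μ| / (I + 1)) (by positivity)
  have h1 : ∫ x, h x * f (s x) ∂μ = ∫ x, h x * (f (s x) - P.eval (s x)) ∂μ := by
    simp only [mul_sub]
    rw [integral_sub (hb f hf) (hb _ P.continuous), hpoly, sub_zero]
  have h2 : |∫ x, h x * f (s x) ∂μ| ≤ ∫ x, ‖h x‖ * (|∫ x, h x * f (s x) ∂μ| / (I + 1)) ∂μ := by
    conv_lhs => rw [h1, ← Real.norm_eq_abs]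
    refine norm_integral_le_of_norm_le (hh.norm.mul_const _) ?_
    filter_upwards [hs01] with x hx
    rw [norm_mul]
    refine mul_le_mul_of_nonneg_left ?_ (norm_nonneg _)
    rw [Real.norm_eq_abs, abs_sub_comm]
    exact (hP _ hx).le
  rw [integral_mul_const, ← hI, mul_div_assoc', le_div_iff₀ (by linarith)] at h2
  nlinarith

section

variable {β γ : ℝ} {u : ℂ × ℂ → ℝ}

lemma integrableOn_ball (hβ : 0 < β) (hγ : 0 < γ) {g : ℂ × ℂ → ℝ}
    (hg : LocallyIntegrable g (vol β γ)) (A : ℝ) :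
    IntegrableOn g {p | rad β γ p < A} (vol β γ) :=
  (hg.integrableOn_isCompact (isCompact_rad_le hβ hγ A)).mono_set
    (fun p hp => (show rad β γ p < A from hp).le : {p | rad β γ p < A} ⊆ {p | rad β γ p ≤ A})

/-- The one-variable approximation is applied twice, first in s with a power of t frozen, then in t
with the continuous function of s frozen. -/
lemma setIntegral_mul_coneSq_eq_zero (hβ : 0 < β) (hγ : 0 < γ) (hu : LocallyIntegrable u (vol β γ))
    (h0 : ∀ m c n c' k l, moment β γ u m c n c' k l = 0) (m : ℕ) (c : ℂ) (n : ℕ) (c' : ℂ)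
    {f g : ℝ → ℝ} (hf : Continuous f) (hg : Continuous g) :
    ∫ p in {p | rad β γ p < 1}, u p * harmProd m c n c' p * (f (coneSq β p.1) * g (coneSq γ p.2))
      ∂(vol β γ) = 0 := by
  have c1 : Continuous fun p : ℂ × ℂ => coneSq β p.1 := (continuous_coneSq hβ).comp continuous_fst
  have c2 : Continuous fun p : ℂ × ℂ => coneSq γ p.2 := (continuous_coneSq hγ).comp continuous_snd
  have hm := measurableSet_rad_lt hβ hγ 1
  have s1 : ∀ᵐ p ∂(vol β γ).restrict {p | rad β γ p < 1}, coneSq β p.1 ∈ Icc (0 : ℝ) 1 := by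
    filter_upwards [ae_restrict_mem hm] with p hp
    have hp' : coneSq β p.1 + coneSq γ p.2 < 1 := hp
    exact ⟨coneSq_nonneg _ _, by linarith [coneSq_nonneg γ p.2]⟩
  have s2 : ∀ᵐ p ∂(vol β γ).restrict {p | rad β γ p < 1}, coneSq γ p.2 ∈ Icc (0 : ℝ) 1 := by
    filter_upwards [ae_restrict_mem hm] with p hp
    have hp' : coneSq β p.1 + coneSq γ p.2 < 1 := hp
    exact ⟨coneSq_nonneg _ _, by linarith [coneSq_nonneg β p.1]⟩
  have hH := locallyIntegrable_vol_mul hu (continuous_harmProd m c n c')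
  have step1 : ∀ l : ℕ, ∫ p in {p | rad β γ p < 1},
      (u p * harmProd m c n c' p * f (coneSq β p.1)) * coneSq γ p.2 ^ l ∂(vol β γ) = 0 := by
    intro l
    have := integral_mul_comp_eq_zero (s := fun p : ℂ × ℂ => coneSq β p.1)
      (integrableOn_ball hβ hγ (locallyIntegrable_vol_mul hH
        (f := fun p => coneSq γ p.2 ^ l) (c2.pow l)) 1)
      c1.aestronglyMeasurable s1 (fun k => ?_) hf
    · rw [← this]; congr 1; ext p; ring
    · rw [← h0 m c n c' k l, moment]
      congr 1; ext p; simp only [momentFun]; ring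
  have := integral_mul_comp_eq_zero (s := fun p : ℂ × ℂ => coneSq γ p.2)
      (integrableOn_ball hβ hγ (locallyIntegrable_vol_mul hH (hf.comp c1)) 1)
      c2.aestronglyMeasurable s2 step1 hg
  rw [← this]; congr 1; ext p; simp only [Function.comp]; ring

lemma coneSq_rpow {α : ℝ} (hα : 0 < α) (i : ℕ) (z : ℂ) :
    (coneSq α z * α ^ 2) ^ (i / α) = (‖z‖ ^ 2) ^ i := by
  rw [coneSq, div_mul_cancel₀ _ (by positivity), ← Real.rpow_mul (norm_nonneg _),
    show 2 * α * (i / α) = ((2 * i : ℕ) : ℝ) by push_cast; field_simp, Real.rpow_natCast, pow_mul]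

/-- The even power |z|^(2i) equals (β² s)^(i/β), a continuous function of s but in general not a
polynomial. This is why arbitrary continuous functions of s and t are needed first. -/
lemma setIntegral_mul_norm_eq_zero (hβ : 0 < β) (hγ : 0 < γ) (hu : LocallyIntegrable u (vol β γ))
    (h0 : ∀ m c n c' k l, moment β γ u m c n c' k l = 0) (m : ℕ) (c : ℂ) (n : ℕ) (c' : ℂ)
    (i j : ℕ) : ∫ p in {p | rad β γ p < 1},
      u p * harmProd m c n c' p * ((‖p.1‖ ^ 2) ^ i * (‖p.2‖ ^ 2) ^ j) ∂(vol β γ) = 0 := by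
  have h := setIntegral_mul_coneSq_eq_zero hβ hγ hu h0 m c n c'
    (f := fun x => (x * β ^ 2) ^ (i / β)) (g := fun x => (x * γ ^ 2) ^ (j / γ))
    ((continuous_id.mul continuous_const).rpow_const fun _ => Or.inr (by positivity))
    ((continuous_id.mul continuous_const).rpow_const fun _ => Or.inr (by positivity))
  simpa only [coneSq_rpow hβ, coneSq_rpow hγ] using h

/-- Pairing off the smaller exponent leaves an even power of |z| times z^m or its conjugate; c = -i
gives Im z^m, and c = i its negative for the conjugate. -/
lemma pow_mul_conj_pow (a b : ℕ) : ∃ (i m : ℕ) (c : ℂ), ∀ z : ℂ,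
    z ^ a * (starRingEnd ℂ) z ^ b =
      (((‖z‖ ^ 2) ^ i : ℝ) : ℂ) * (harmPoly m 1 z + harmPoly m c z * Complex.I) := by
  have hz : ∀ (z : ℂ) (n : ℕ), (((‖z‖ ^ 2) ^ n : ℝ) : ℂ) = z ^ n * (starRingEnd ℂ) z ^ n := by
    intro z n
    rw [← mul_pow, Complex.mul_conj']; push_cast; rfl
  rcases le_total b a with h | h
  · obtain ⟨m, rfl⟩ := Nat.exists_eq_add_of_le h
    refine ⟨b, m, -Complex.I, fun z => ?_⟩
    have : ((harmPoly m 1 z : ℝ) : ℂ) + harmPoly m (-Complex.I) z * Complex.I = z ^ m := by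
      rw [← Complex.re_add_im (z ^ m)]; simp [harmPoly]
    rw [this, hz]; ring
  · obtain ⟨m, rfl⟩ := Nat.exists_eq_add_of_le h
    refine ⟨a, m, Complex.I, fun z => ?_⟩
    have : ((harmPoly m 1 z : ℝ) : ℂ) + harmPoly m Complex.I z * Complex.I =
        (starRingEnd ℂ) z ^ m := by
      rw [← map_pow]; apply Complex.ext <;> simp [harmPoly, -map_pow]
    rw [this, hz]; ring

lemma setIntegral_mul_monomial_eq_zero (hβ : 0 < β) (hγ : 0 < γ)
    (hu : LocallyIntegrable u (vol β γ))
    (h0 : ∀ m c n c' k l, moment β γ u m c n c' k l = 0) (a b e f : ℕ) :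
    ∫ p in {p | rad β γ p < 1}, (u p : ℂ) * ((p.1 ^ a * (starRingEnd ℂ) p.1 ^ b) *
      (p.2 ^ e * (starRingEnd ℂ) p.2 ^ f)) ∂(vol β γ) = 0 := by
  obtain ⟨i, m, c, h1⟩ := pow_mul_conj_pow a b
  obtain ⟨j, n, c', h2⟩ := pow_mul_conj_pow e f
  set R : ℂ → ℂ → ℂ × ℂ → ℝ := fun c c' p =>
    u p * harmProd m c n c' p * ((‖p.1‖ ^ 2) ^ i * (‖p.2‖ ^ 2) ^ j) with hR
  have hRi : ∀ c c', IntegrableOn (R c c') {p | rad β γ p < 1} (vol β γ) := fun c c' =>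
    integrableOn_ball hβ hγ (locallyIntegrable_vol_mul
      (locallyIntegrable_vol_mul hu (continuous_harmProd m c n c')) (by fun_prop)) 1
  have hR0 : ∀ c c', ∫ p in {p | rad β γ p < 1}, R c c' p ∂(vol β γ) = 0 := fun c c' =>
    setIntegral_mul_norm_eq_zero hβ hγ hu h0 m c n c' i j
  have e1 : ∀ p : ℂ × ℂ, (u p : ℂ) * ((p.1 ^ a * (starRingEnd ℂ) p.1 ^ b) *
      (p.2 ^ e * (starRingEnd ℂ) p.2 ^ f)) =
      ((R 1 1 p - R c c' p : ℝ) : ℂ) + ((R 1 c' p + R c 1 p : ℝ) : ℂ) * Complex.I := by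
    intro p
    rw [h1, h2]
    simp only [hR, harmProd]
    push_cast
    linear_combination ((u p : ℂ) * harmPoly m c p.1 * harmPoly n c' p.2 *
      ((‖p.1‖ : ℂ) ^ 2) ^ i * ((‖p.2‖ : ℂ) ^ 2) ^ j) * Complex.I_mul_I
  simp only [e1]
  rw [integral_add ((hRi 1 1).sub (hRi c c')).ofReal
    (((hRi 1 c').add (hRi c 1)).ofReal.mul_const _), integral_mul_const,
    integral_complex_ofReal, integral_complex_ofReal, integral_sub (hRi 1 1) (hRi c c'),
    integral_add (hRi 1 c') (hRi c 1)]
  simp [hR0]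

/-- The polynomial functions in `z, z̄, w, w̄`. -/
noncomputable def polyFun : StarSubalgebra ℂ (ℂ × ℂ → ℂ) :=
  StarAlgebra.adjoin ℂ {Prod.fst, Prod.snd}

/-- An adjoined algebra is the linear span of the multiplicative monoid of its generators, here z, w
and their conjugates. -/
lemma mem_span_monomial {P : ℂ × ℂ → ℂ} (hP : P ∈ polyFun) :
    P ∈ Submodule.span ℂ {Q : ℂ × ℂ → ℂ | ∃ a b e f : ℕ, Q = fun p =>
      (p.1 ^ a * (starRingEnd ℂ) p.1 ^ b) * (p.2 ^ e * (starRingEnd ℂ) p.2 ^ f)} := by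
  rw [polyFun, ← StarSubalgebra.mem_toSubalgebra, StarAlgebra.adjoin_toSubalgebra,
    ← Subalgebra.mem_toSubmodule, Algebra.adjoin_eq_span] at hP
  refine Submodule.span_mono (fun Q hQ => ?_) hP
  induction hQ using Submonoid.closure_induction with
  | mem Q hQ =>
    rcases hQ with (rfl | rfl) | hQ
    · exact ⟨1, 0, 0, 0, by ext p; simp⟩
    · exact ⟨0, 0, 1, 0, by ext p; simp⟩
    · rw [Set.mem_star] at hQ
      rcases hQ with hQ | hQ
      · exact ⟨0, 1, 0, 0, by rw [← star_star Q, hQ]; ext p; simp⟩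
      · exact ⟨0, 0, 0, 1, by rw [← star_star Q, hQ]; ext p; simp⟩
  | one => exact ⟨0, 0, 0, 0, by ext p; simp⟩
  | mul Q Q' _ _ hQ hQ' =>
    obtain ⟨a, b, e, f, rfl⟩ := hQ
    obtain ⟨a', b', e', f', rfl⟩ := hQ'
    exact ⟨a + a', b + b', e + e', f + f', by ext p; simp only [Pi.mul_apply, pow_add]; ring⟩

lemma integrableOn_ofReal_mul (hβ : 0 < β) (hγ : 0 < γ) (hu : LocallyIntegrable u (vol β γ))
    {P : ℂ × ℂ → ℂ} (hP : Continuous P) :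
    IntegrableOn (fun p => (u p : ℂ) * P p) {p | rad β γ p < 1} (vol β γ) := by
  have h : IntegrableOn (fun p => (u p : ℂ)) {p | rad β γ p ≤ 1} (vol β γ) :=
    (hu.integrableOn_isCompact (isCompact_rad_le hβ hγ 1)).ofReal
  exact (h.mul_continuousOn hP.continuousOn (isCompact_rad_le hβ hγ 1)).mono_set
    (fun p hp => (show rad β γ p < 1 from hp).le : {p | rad β γ p < 1} ⊆ {p | rad β γ p ≤ 1})

lemma setIntegral_mul_polyFun_eq_zero (hβ : 0 < β) (hγ : 0 < γ)
    (hu : LocallyIntegrable u (vol β γ))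
    (h0 : ∀ m c n c' k l, moment β γ u m c n c' k l = 0) {P : ℂ × ℂ → ℂ} (hP : P ∈ polyFun) :
    Continuous P ∧ ∫ p in {p | rad β γ p < 1}, (u p : ℂ) * P p ∂(vol β γ) = 0 := by
  have h := mem_span_monomial hP
  clear hP
  induction h using Submodule.span_induction with
  | mem Q hQ =>
    obtain ⟨a, b, e, f, rfl⟩ := hQ
    refine ⟨?_, setIntegral_mul_monomial_eq_zero hβ hγ hu h0 a b e f⟩
    have := Complex.continuous_conj
    fun_prop
  | zero => exact ⟨continuous_zero, by simp⟩
  | add Q Q' _ _ hQ hQ' =>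
    refine ⟨hQ.1.add hQ'.1, ?_⟩
    simp only [Pi.add_apply, mul_add]
    rw [integral_add (integrableOn_ofReal_mul hβ hγ hu hQ.1)
      (integrableOn_ofReal_mul hβ hγ hu hQ'.1), hQ.2, hQ'.2, add_zero]
  | smul c Q _ hQ =>
    refine ⟨hQ.1.const_smul c, ?_⟩
    have : ∀ p, (u p : ℂ) * (c • Q) p = c * ((u p : ℂ) * Q p) := fun p => by
      simp only [Pi.smul_apply, smul_eq_mul]; ring
    simp only [this]
    rw [integral_const_mul, hQ.2, mul_zero]

/-- Complex Stone-Weierstrass on K: the two coordinates separate points. The approximants are needed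
as globally defined functions rather than as elements of C(K, ℂ). -/
lemma exists_polyFun_near {K : Set (ℂ × ℂ)} (hK : IsCompact K) {g : ℂ × ℂ → ℂ} (hg : Continuous g)
    {ε : ℝ} (hε : 0 < ε) : ∃ P ∈ polyFun, ∀ p ∈ K, ‖g p - P p‖ < ε := by
  have : CompactSpace K := isCompact_iff_compactSpace.1 hK
  set f1 : C(K, ℂ) := ⟨fun x => x.1.1, by fun_prop⟩ with hf1
  set f2 : C(K, ℂ) := ⟨fun x => x.1.2, by fun_prop⟩ with hf2
  set A : StarSubalgebra ℂ C(K, ℂ) := StarAlgebra.adjoin ℂ {f1, f2} with hA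
  have hf1A : f1 ∈ A := StarAlgebra.subset_adjoin ℂ _ (by simp)
  have hf2A : f2 ∈ A := StarAlgebra.subset_adjoin ℂ _ (by simp)
  have hsep : A.SeparatesPoints := by
    intro x y hxy
    by_cases h : x.1.1 = y.1.1
    · refine ⟨f2, ⟨f2, hf2A, rfl⟩, fun h2 => hxy (Subtype.ext (Prod.ext h h2))⟩
    · exact ⟨f1, ⟨f1, hf1A, rfl⟩, h⟩
  have htop := ContinuousMap.starSubalgebra_topologicalClosure_eq_top_of_separatesPoints A hsep
  set G : C(K, ℂ) := ⟨fun x => g x, by fun_prop⟩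
  have hG : G ∈ closure (A : Set C(K, ℂ)) := by
    rw [← StarSubalgebra.topologicalClosure_coe, htop]; trivial
  obtain ⟨a, ha, hGa⟩ := Metric.mem_closure_iff.1 hG ε hε
  -- Every element of the algebra on K is the restriction of a polynomial on the whole space, by
  -- induction on its construction.
  have key : ∀ a ∈ A, ∃ P ∈ polyFun, ∀ x : K, a x = P x := by
    intro a ha
    induction ha using StarAlgebra.adjoin_induction with
    | mem x hx =>
      rcases hx with rfl | rfl
      · exact ⟨Prod.fst, StarAlgebra.subset_adjoin ℂ _ (by simp), fun _ => rfl⟩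
      · exact ⟨Prod.snd, StarAlgebra.subset_adjoin ℂ _ (by simp), fun _ => rfl⟩
    | algebraMap r => exact ⟨algebraMap ℂ _ r, polyFun.algebraMap_mem r, fun _ => rfl⟩
    | add x y _ _ hx hy =>
      obtain ⟨P, hP, h1⟩ := hx
      obtain ⟨Q, hQ, h2⟩ := hy
      exact ⟨P + Q, add_mem hP hQ, fun x => by simp [h1, h2]⟩
    | mul x y _ _ hx hy =>
      obtain ⟨P, hP, h1⟩ := hx
      obtain ⟨Q, hQ, h2⟩ := hy
      exact ⟨P * Q, mul_mem hP hQ, fun x => by simp [h1, h2]⟩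
    | star x _ hx =>
      obtain ⟨P, hP, h1⟩ := hx
      exact ⟨star P, star_mem hP, fun x => by simp [h1]⟩
  obtain ⟨P, hP, hPa⟩ := key a ha
  refine ⟨P, hP, fun p hp => ?_⟩
  rw [← hPa ⟨p, hp⟩]
  rw [dist_eq_norm] at hGa
  exact lt_of_le_of_lt ((G - a).norm_coe_le_norm ⟨p, hp⟩) hGa

lemma setIntegral_mul_continuous_eq_zero (hβ : 0 < β) (hγ : 0 < γ)
    (hu : LocallyIntegrable u (vol β γ))
    (h0 : ∀ m c n c' k l, moment β γ u m c n c' k l = 0) {g : ℂ × ℂ → ℝ} (hg : Continuous g) :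
    ∫ p in {p | rad β γ p < 1}, u p * g p ∂(vol β γ) = 0 := by
  have hgC : Continuous fun p => (g p : ℂ) := Complex.continuous_ofReal.comp hg
  have e : ((∫ p in {p | rad β γ p < 1}, u p * g p ∂(vol β γ) : ℝ) : ℂ) =
      ∫ p in {p | rad β γ p < 1}, (u p : ℂ) * g p ∂(vol β γ) := by
    rw [← integral_complex_ofReal]; push_cast; rfl
  have hui := integrableOn_ball hβ hγ hu 1
  rw [← Complex.ofReal_eq_zero, e]
  by_contra hne
  set J := ∫ p in {p | rad β γ p < 1}, (u p : ℂ) * g p ∂(vol β γ) with hJ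
  have hpos : 0 < ‖J‖ := norm_pos_iff.2 hne
  set I := ∫ p in {p | rad β γ p < 1}, ‖u p‖ ∂(vol β γ) with hI
  have hI0 : 0 ≤ I := integral_nonneg fun _ => norm_nonneg _
  obtain ⟨P, hP, hPg⟩ := exists_polyFun_near (isCompact_rad_le hβ hγ 1) hgC
    (ε := ‖J‖ / (I + 1)) (by positivity)
  obtain ⟨hPc, hP0⟩ := setIntegral_mul_polyFun_eq_zero hβ hγ hu h0 hP
  have h1 : J = ∫ p in {p | rad β γ p < 1}, (u p : ℂ) * (g p - P p) ∂(vol β γ) := by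
    simp only [mul_sub]
    rw [integral_sub (integrableOn_ofReal_mul hβ hγ hu hgC)
      (integrableOn_ofReal_mul hβ hγ hu hPc), hP0, sub_zero]
  have h2 : ‖J‖ ≤ ∫ p in {p | rad β γ p < 1}, ‖u p‖ * (‖J‖ / (I + 1)) ∂(vol β γ) := by
    conv_lhs => rw [h1]
    refine norm_integral_le_of_norm_le (hui.norm.mul_const _) ?_
    filter_upwards [ae_restrict_mem (measurableSet_rad_lt hβ hγ 1)] with p hp
    rw [norm_mul, Complex.norm_real]
    exact mul_le_mul_of_nonneg_left (hPg p (show rad β γ p < 1 from hp).le).le (norm_nonneg _)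
  rw [integral_mul_const, ← hI, mul_div_assoc', le_div_iff₀ (by linarith)] at h2
  nlinarith

/-- Orthogonality to continuous functions includes all smooth test functions, so the weighted
function extended by zero vanishes almost everywhere; off the axes the weight is positive and can be
divided out. -/
lemma ae_eq_zero_of_moment_eq_zero (hβ : 0 < β) (hγ : 0 < γ) (hu : LocallyIntegrable u (vol β γ))
    (h0 : ∀ m c n c' k l, moment β γ u m c n c' k l = 0) :
    ∀ᵐ p : ℂ × ℂ, rad β γ p < 1 → u p = 0 := by
  have hm := measurableSet_rad_lt hβ hγ 1
  have hi : Integrable (indicator {p | rad β γ p < 1} fun p => wt β p.1 * wt γ p.2 * u p) :=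
    (integrable_indicator_iff hm).2 ((integrableOn_vol_iff hm).1 (integrableOn_ball hβ hγ hu 1))
  have h := ae_eq_zero_of_integral_contDiff_smul_eq_zero hi.locallyIntegrable fun g hg _ => by
    rw [← setIntegral_mul_continuous_eq_zero hβ hγ hu h0 hg.continuous, setIntegral_vol _ _ _ hm,
      ← integral_indicator hm]
    congr 1; ext p
    by_cases hp : p ∈ {p | rad β γ p < 1}
    · rw [indicator_of_mem hp, indicator_of_mem hp, smul_eq_mul]; ring
    · rw [indicator_of_notMem hp, indicator_of_notMem hp, smul_zero]
  filter_upwards [h, ae_ne_zero] with p hp hne hr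
  rw [indicator_of_mem (show p ∈ {p | rad β γ p < 1} from hr)] at hp
  rcases mul_eq_zero.1 hp with h1 | h1
  · exact absurd h1 (mul_pos (wt_pos hne.1) (wt_pos hne.2)).ne'
  · exact h1

/-- Every point is carried into the unit ball by a small dilation. Homogeneity holds only almost
everywhere for each factor, so a countable sequence of factors is used to keep one common null set.
-/
lemma IsHomogeneous.ae_eq_zero (hβ : 0 < β) (hγ : 0 < γ) {d : ℝ} (hh : IsHomogeneous β γ d u)
    (h : ∀ᵐ p : ℂ × ℂ, rad β γ p < 1 → u p = 0) : u =ᵐ[volume] 0 := by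
  have h1 : ∀ n : ℕ, ∀ᵐ p : ℂ × ℂ, rad β γ (dilation β γ (del n) p) < 1 →
      u (dilation β γ (del n) p) = 0 := by
    intro n
    have hq : Measure.QuasiMeasurePreserving (dilation β γ (del n))
        (volume : Measure (ℂ × ℂ)) volume :=
      ⟨measurable_dilation β γ _, by
        rw [map_dilation (del_pos n)]; exact Measure.smul_absolutelyContinuous⟩
    exact hq.ae h
  have h2 : ∀ n : ℕ, ∀ᵐ p : ℂ × ℂ, u (dilation β γ (del n) p) = del n ^ d * u p :=
    fun n => hh _ (del_pos n)
  filter_upwards [ae_all_iff.2 h1, ae_all_iff.2 h2] with p k1 k2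
  have hlim : Tendsto (fun n => del n ^ 2 * rad β γ p) atTop (𝓝 (0 ^ 2 * rad β γ p)) :=
    (tendsto_del.pow 2).mul_const _
  obtain ⟨n, hn⟩ := (hlim.eventually (gt_mem_nhds (by norm_num :
    (0 : ℝ) ^ 2 * rad β γ p < 1))).exists
  have h3 := k1 n (by rwa [rad_dilation hβ hγ (del_pos n)])
  rw [k2 n] at h3
  exact (mul_eq_zero.1 h3).resolve_left (Real.rpow_pos_of_pos (del_pos n) d).ne'

end

/-! ### Projection onto the explicit functions -/

section

variable {β γ d : ℝ} {u : ℂ × ℂ → ℝ}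

lemma memLp_two_ball (hβ : 0 < β) (hγ : 0 < γ) (hm : AEStronglyMeasurable u volume)
    (hu : LocallyIntegrable (fun p => u p ^ 2) (vol β γ)) (A : ℝ) :
    MemLp u 2 ((vol β γ).restrict {p | rad β γ p < A}) :=
  (memLp_two_iff_integrable_sq (hm.mono_ac
    (Measure.absolutelyContinuous_of_le Measure.restrict_le_self |>.trans
      (vol_absolutelyContinuous β γ)))).2 (integrableOn_ball hβ hγ hu A)

lemma memLp_two_ball_of_continuous (hβ : 0 < β) (hγ : 0 < γ) (hu : Continuous u) (A : ℝ) :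
    MemLp u 2 ((vol β γ).restrict {p | rad β γ p < A}) :=
  memLp_two_ball hβ hγ hu.aestronglyMeasurable
    (locallyIntegrable_vol_of_continuous hβ hγ (hu.pow 2)) A

lemma IsHarmonic.memLp_two_ball (hβ : 0 < β) (hγ : 0 < γ) (hu : IsHarmonic β γ u) (A : ℝ) :
    MemLp u 2 ((vol β γ).restrict {p | rad β γ p < A}) := by
  obtain ⟨G, hG, -⟩ := hu
  exact ConeProduct.memLp_two_ball hβ hγ hG.1.1.aestronglyMeasurable hG.2.1 A

lemma finite_explicitList (β γ : ℝ) : (explicitList β γ).Finite := by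
  have hr : ∀ h : ℂ × ℂ → ℂ, (reIm h).Finite := fun h => (finite_singleton _).insert _
  refine ((finite_singleton (fun _ : ℂ × ℂ => (1 : ℝ))).union ((hr fun p => p.1).union
    ((hr fun p => p.1 ^ 2).union ((hr fun p => p.2).union ((hr fun p => p.2 ^ 2).union
    ((hr fun p => p.1 * p.2).union ((hr fun p => p.1 * (starRingEnd ℂ) p.2).union
    (finite_singleton (quadHarm β γ))))))))).subset ?_
  rintro v (h | ⟨-, h⟩ | ⟨-, h⟩ | ⟨-, h⟩ | ⟨-, h⟩ | ⟨-, -, h⟩ | ⟨-, -, h⟩ | h)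
  · exact Or.inl h
  · exact Or.inr (Or.inl h)
  · exact Or.inr (Or.inr (Or.inl h))
  · exact Or.inr (Or.inr (Or.inr (Or.inl h)))
  · exact Or.inr (Or.inr (Or.inr (Or.inr (Or.inl h))))
  · exact Or.inr (Or.inr (Or.inr (Or.inr (Or.inr (Or.inl h)))))
  · exact Or.inr (Or.inr (Or.inr (Or.inr (Or.inr (Or.inr (Or.inl h))))))
  · exact Or.inr (Or.inr (Or.inr (Or.inr (Or.inr (Or.inr (Or.inr h))))))

/-- Orthogonal projection in L² onto the finite-dimensional image of V. The map from functions to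
classes need not be injective; any preimage of the projection will do. -/
lemma exists_orthogonal_sub {α : Type*} [MeasurableSpace α] {μ : Measure α}
    (V : Submodule ℝ (α → ℝ)) [FiniteDimensional ℝ V] (hV : ∀ v ∈ V, MemLp v 2 μ) {u : α → ℝ}
    (hu : MemLp u 2 μ) : ∃ w ∈ V, ∀ v ∈ V, ∫ x, (u x - w x) * v x ∂μ = 0 := by
  set T : V →ₗ[ℝ] Lp ℝ 2 μ :=
    { toFun := fun v => (hV v v.2).toLp
      map_add' := fun _ _ => rfl
      map_smul' := fun _ _ => rfl } with hT
  obtain ⟨w, hw⟩ := (LinearMap.range T).starProjection_apply_mem hu.toLp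
  refine ⟨w, w.2, fun v hv => ?_⟩
  have h := Submodule.inner_left_of_mem_orthogonal (LinearMap.mem_range_self T ⟨v, hv⟩)
    ((LinearMap.range T).sub_starProjection_mem_orthogonal hu.toLp)
  rw [← hw, real_inner_comm, L2.inner_def] at h
  rw [← h]
  refine integral_congr_ae ?_
  filter_upwards [hu.coeFn_toLp, (hV w w.2).coeFn_toLp, (hV v hv).coeFn_toLp,
    Lp.coeFn_sub hu.toLp (T w)] with x h1 h2 h3 h4
  have h2' : (T w : α → ℝ) x = (w : α → ℝ) x := h2
  have h3' : (T ⟨v, hv⟩ : α → ℝ) x = v x := h3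
  simp only [h3', h4, Pi.sub_apply, h1, h2', RCLike.inner_apply, conj_trivial]

/-- A homogeneous harmonic function of degree in `[0, 2]` is a combination of the explicit ones. -/
lemma exists_mem_explicitSpan_ae_eq (hβ : 0 < β) (hβ1 : β ≤ 1) (hγ : 0 < γ) (hγ1 : γ ≤ 1)
    (hd : 0 ≤ d) (hd2 : d ≤ 2) (hu : IsHarmonic β γ u) (hh : IsHomogeneous β γ d u) :
    ∃ w ∈ explicitSpan β γ d, u =ᵐ[volume] w := by
  have : FiniteDimensional ℝ (explicitSpan β γ d) :=
    FiniteDimensional.span_of_finite ℝ ((finite_explicitList β γ).subset fun _ h => h.1)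
  obtain ⟨w, hw, horth⟩ := exists_orthogonal_sub (explicitSpan β γ d)
    (fun v hv => memLp_two_ball_of_continuous hβ hγ
      (isNice_of_mem_explicitSpan hβ hβ1 hγ hγ1 hv).2.2 1) (hu.memLp_two_ball hβ hγ 1)
  have hwn := isNice_of_mem_explicitSpan hβ hβ1 hγ hγ1 hw
  -- The projection was taken within a single degree, so u - w is still homogeneous of degree d as
  -- well as harmonic.
  have hs := hu.add hβ hγ (hwn.1.smul (-1))
  have hsh := hh.add (hwn.2.1.smul (-1))
  have h0 := ae_eq_zero_of_moment_eq_zero hβ hγ (hs.locallyIntegrable_vol hβ hγ)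
    (moment_eq_zero hβ hβ1 hγ hγ1 hd hd2 hs hsh fun v hv => by
      rw [← horth v hv]
      refine integral_congr_ae (ae_of_all _ fun p => ?_)
      simp only [Pi.add_apply, Pi.smul_apply, smul_eq_mul]; ring)
  refine ⟨w, hw, ?_⟩
  filter_upwards [hsh.ae_eq_zero hβ hγ h0] with p hp
  simp only [Pi.add_apply, Pi.smul_apply, smul_eq_mul, Pi.zero_apply] at hp
  linarith

/-! ### Passage to L² of the ball of radius R -/

lemma rho_lt_iff {R : ℝ} (hR : 0 < R) (p : ℂ × ℂ) : rho β γ p < R ↔ rad β γ p < R ^ 2 := by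
  have h : ∀ (α : ℝ) (z : ℂ), (‖z‖ ^ α / α) ^ 2 = coneSq α z := fun α z => by
    rw [coneSq, div_pow, ← Real.rpow_natCast (‖z‖ ^ α), ← Real.rpow_mul (norm_nonneg z),
      mul_comm 2 α, Nat.cast_ofNat]
  rw [rho, Real.sqrt_lt' hR, h, h, rad]

lemma ballVol_eq {R : ℝ} (hR : 0 < R) :
    ballVol β γ R = (vol β γ).restrict {p | rad β γ p < R ^ 2} := by
  simp only [ballVol, rho_lt_iff hR]

lemma ballVol_absolutelyContinuous (β γ R : ℝ) : ballVol β γ R ≪ volume :=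
  (Measure.absolutelyContinuous_of_le Measure.restrict_le_self).trans
    (vol_absolutelyContinuous β γ)

/-- Transfers linear combinations from functions to classes; square integrability of each generator
guarantees that it has a class. -/
lemma mem_spanL2_of_ae_eq {R : ℝ} {S : Set (ℂ × ℂ → ℝ)} (hS : ∀ v ∈ S, MemLp v 2 (ballVol β γ R))
    {w : ℂ × ℂ → ℝ} (hw : w ∈ Submodule.span ℝ S) :
    ∀ f : Lp ℝ 2 (ballVol β γ R), f =ᵐ[ballVol β γ R] w → f ∈ spanL2 β γ R S := by
  have key : ∃ g ∈ spanL2 β γ R S, g =ᵐ[ballVol β γ R] w := by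
    induction hw using Submodule.span_induction with
    | mem v hv =>
      exact ⟨(hS v hv).toLp, Submodule.subset_span ⟨v, hv, (hS v hv).coeFn_toLp⟩,
        (hS v hv).coeFn_toLp⟩
    | zero => exact ⟨0, zero_mem _, Lp.coeFn_zero _ _ _⟩
    | add v w _ _ hv hw =>
      obtain ⟨f, hf, hfv⟩ := hv
      obtain ⟨g, hg, hgw⟩ := hw
      exact ⟨f + g, add_mem hf hg, (Lp.coeFn_add f g).trans (hfv.add hgw)⟩
    | smul c v _ hv =>
      obtain ⟨f, hf, hfv⟩ := hv
      exact ⟨c • f, Submodule.smul_mem _ c hf,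
        (Lp.coeFn_smul c f).trans (hfv.const_smul c)⟩
  obtain ⟨g, hg, hgw⟩ := key
  intro f hf
  rwa [Lp.ext (hf.trans hgw.symm)]

end

end ConeProduct

end

theorem mainTheorem9 (β γ : ℝ) (hβ : 0 < β) (hβ1 : β ≤ 1) (hγ : 0 < γ) (hγ1 : γ ≤ 1) :
    (∀ v ∈ ConeProduct.explicitList β γ, ConeProduct.IsSubquadraticHarmonic β γ v) ∧
    ∀ R : ℝ, 0 < R →
      ConeProduct.subquadraticHarmonics β γ R =
        ConeProduct.spanL2 β γ R (ConeProduct.explicitList β γ) := by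
  have h1 : ∀ v ∈ ConeProduct.explicitList β γ, ConeProduct.IsSubquadraticHarmonic β γ v := by
    intro v hv
    obtain ⟨d, hd, hd2, hn⟩ :=
      ConeProduct.exists_isNice_of_mem_explicitList hβ hβ1 hγ hγ1 hv
    exact ⟨hn.1, d, hd, hd2, hn.2.1⟩
  refine ⟨h1, fun R hR => le_antisymm (Submodule.span_le.2 ?_) (Submodule.span_mono ?_)⟩
  -- The combination found on the unit ball agrees with u almost everywhere on the whole cone, so
  -- the radius R plays no further part.
  · rintro f ⟨u, ⟨hu, d, hd, hd2, hh⟩, hfu⟩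
    obtain ⟨w, hw, huw⟩ :=
      ConeProduct.exists_mem_explicitSpan_ae_eq hβ hβ1 hγ hγ1 hd hd2 hu hh
    refine ConeProduct.mem_spanL2_of_ae_eq (fun v hv => ?_)
      (Submodule.span_mono (fun _ h => h.1) hw) f
      (hfu.trans ((ConeProduct.ballVol_absolutelyContinuous β γ R).ae_eq huw))
    rw [ConeProduct.ballVol_eq hR]
    exact (h1 v hv).1.memLp_two_ball hβ hγ _
  · rintro f ⟨u, hu, hfu⟩
    exact ⟨u, h1 u hu, hfu⟩
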